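/- For $N\ge 1$ particles in the plane write $\mathbf x=(x_1,\dots,x_N)\in(\mathbb R^2)^N=\mathbb R^{2N}$, and for $\alpha\in\mathbb R$ let $$D_j=-i\nabla_{x_j}+\alpha A_j,\qquad A_j(\mathbf x)=\sum_{k\ne j}\frac{(x_j-x_k)^\perp}{|x_j-x_k|^2},\qquad (x,y)^\perp=(-y,x).$$ Let $\mathscr D_\alpha^N\subset L^2_{\mathrm{sym}}(\mathbb R^{2N})$ (the permutation-symmetric square-integrable functions) be the form domain of $\hat T_\alpha=\sum_{j=1}^N D_j^2$ for ideal anyons, i.e. the domain of the closure of the operator $\Psi\mapsto(D_j\Psi)_{j=1}^N$ initially defined on the symmetric functions in $C_c^\infty(\mathbb R^{2N}\setminus\{\mathbf x: x_j=x_k\text{ for some }j\neq k\})$; for $\Psi\in\mathscr D^N_\alpha$ let $D_j\Psi$ denote the components of this closure. The one-body density of $\Psi$ is $$\varrho_\Psi(x)=N\int_{\mathbb R^{2(N-1)}}|\Psi(x,x_2,\dots,x_N)|^2\,dx_2\cdots dx_N .$$ There exists a universal constant $C>0$ such that the following hold. (i) For all $0\le\alpha\le1$, all $N\ge1$ and all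 $\Psi\in\mathscr D_\alpha^N$ with $\int_{\mathbb R^{2N}}|\Psi|^2=1$, $$\sum_{j=1}^N\int_{\mathbb R^{2N}}|D_j\Psi|^2\;\ge\; C\,\alpha\int_{\mathbb R^2}\varrho_\Psi(x)^2\,dx .$$ (ii) With the same $C$, for all $0<\alpha\le1$, all $N\ge1$ and every measurable $V:\mathbb R^2\to\mathbb R$, with $\hat V(\mathbf x)=\sum_{j=1}^N V(x_j)$ and $V_-=\max\{-V,0\}$, the ground-state energy of $\hat T_\alpha+\hat V$, that is $$\inf\Big\{\sum_{j=1}^N\int_{\mathbb R^{2N}}|D_j\Psi|^2+\int_{\mathbb R^{2N}}\hat V|\Psi|^2 \;:\; \Psi\in\mathscr D_\alpha^N,\ \int_{\mathbb R^{2N}}|\Psi|^2=1,\ \int_{\mathbb R^{2N}}|V(x_j)||\Psi|^2<\infty\ \text{for all } j\Big\},$$ is at least $-\dfrac{1}{4C\alpha}\displaystyle\int_{\mathbb R^2}V_-(x)^2\,dx$ (a trivial bound if this integral is infinite). -/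

import Mathlib

open MeasureTheory Filter Topology
open scoped ENNReal ContDiff

noncomputable section

namespace Anyon

/-- The plane `ℝ²` with its Euclidean norm and Lebesgue measure. -/
abbrev Plane : Type := EuclideanSpace ℝ (Fin 2)

/-- Configurations `(x₁, …, x_N)` of `N` particles in the plane, i.e. `ℝ^{2N}`; `volume` is
`2N`-dimensional Lebesgue measure. -/
abbrev Config (N : ℕ) : Type := Fin N → Plane

/-- The Aharonov–Bohm potential `x^{-⊥} = (-y, x) / (x² + y²)` of a flux `2π` at the origin. -/
def perpInv (x : Plane) : Plane := !₂[-(x 1) / ‖x‖ ^ 2, x 0 / ‖x‖ ^ 2]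

/-- The statistics vector potential `A_j = ∑_{k ≠ j} (x_j - x_k)^{-⊥}`. -/
def vectorPotential {N : ℕ} (j : Fin N) (x : Config N) : Plane :=
  ∑ k ∈ Finset.univ.erase j, perpInv (x j - x k)

/-- The partial derivative of `η` in the `a`-th coordinate of the `j`-th particle. -/
def partialDeriv {N : ℕ} (j : Fin N) (a : Fin 2) (η : Config N → ℂ) (x : Config N) : ℂ :=
  fderiv ℝ η x (Pi.single j (EuclideanSpace.single a 1))

/-- The magnetic momentum `D_j η = -i ∇_j η + α A_j η ∈ ℂ²` of a smooth function `η`. -/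
def momentum {N : ℕ} (α : ℝ) (j : Fin N) (η : Config N → ℂ) (x : Config N) :
    EuclideanSpace ℂ (Fin 2) :=
  WithLp.toLp 2 fun a =>
    -Complex.I * partialDeriv j a η x + (α : ℂ) * (vectorPotential j x a : ℂ) * η x

/-- The configurations without coinciding particles. -/
def offDiagonal (N : ℕ) : Set (Config N) := {x | ∀ j k, j ≠ k → x j ≠ x k}

/-- Permutation-symmetric smooth functions with compact support away from the diagonals. -/
structure IsCore {N : ℕ} (η : Config N → ℂ) : Prop where
  smooth : ContDiff ℝ ∞ η
  compact : HasCompactSupport η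
  support : tsupport η ⊆ offDiagonal N
  symmetric : ∀ (σ : Equiv.Perm (Fin N)) (x : Config N), η (x ∘ σ) = η x

/-- `IsMomentum α Ψ D`: the function `Ψ` belongs to the form domain of `N` ideal anyons with
statistics parameter `α` and `D_j Ψ = D j` (almost everywhere) for all `j`. That is, `(Ψ, D)` is in
the graph of the closure, as an operator from the symmetric `L²` functions to `L²`, of the operator
`η ↦ (D_j η)_j` on the symmetric smooth functions with compact support away from the diagonals. -/
structure IsMomentum {N : ℕ} (α : ℝ) (Ψ : Config N → ℂ)
    (D : Fin N → Config N → EuclideanSpace ℂ (Fin 2)) : Prop where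
  memLp : MemLp Ψ 2 volume
  memLp_momentum : ∀ j, MemLp (D j) 2 volume
  approx : ∃ η : ℕ → Config N → ℂ, (∀ m, IsCore (η m)) ∧
    Tendsto (fun m => eLpNorm (η m - Ψ) 2 volume) atTop (𝓝 0) ∧
    ∀ j, Tendsto (fun m => eLpNorm (momentum α j (η m) - D j) 2 volume) atTop (𝓝 0)

/-- The kinetic energy `∑_j ∫_{ℝ^{2N}} |D_j|²`. -/
def kineticEnergy {N : ℕ} (D : Fin N → Config N → EuclideanSpace ℂ (Fin 2)) : ℝ≥0∞ :=
  ∑ j, ∫⁻ x, ‖D j x‖ₑ ^ 2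

/-- The one-body density `ρ_Ψ(x) = N ∫ |Ψ(x, x₂, …, x_N)|² dx₂ ⋯ dx_N`, with `N = n + 1`. -/
def density {n : ℕ} (Ψ : Config (n + 1) → ℂ) (x : Plane) : ℝ≥0∞ :=
  ((n + 1 : ℕ) : ℝ≥0∞) * ∫⁻ y : Config n, ‖Ψ (Fin.cons x y : Config (n + 1))‖ₑ ^ 2

/-- The ground-state energy (bottom of the spectrum) of `T̂_α + V̂` with `V̂(x) = ∑_j V(x_j)`: the
infimum of its quadratic form `∑_j ∫ |D_j Ψ|² + ∫ V̂ |Ψ|²` over the normalized `Ψ` in the anyon form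
domain for which the potential energy is finite. -/
def groundStateEnergy (α : ℝ) (N : ℕ) (V : Plane → ℝ) : EReal :=
  sInf {e : EReal | ∃ (Ψ : Config N → ℂ) (D : Fin N → Config N → EuclideanSpace ℂ (Fin 2)),
    IsMomentum α Ψ D ∧ eLpNorm Ψ 2 volume = 1 ∧
    (∀ j, Integrable (fun x : Config N => V (x j) * ‖Ψ x‖ ^ 2)) ∧
    e = (kineticEnergy D : EReal) +
      ((∫ x : Config N, (∑ j, V (x j)) * ‖Ψ x‖ ^ 2 : ℝ) : EReal)}

end Anyon

end

/-! The bound combines local exclusion with local uncertainty on dyadic squares. Both are proved on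
the form core and passed to the form domain at the end.

Exclusion comes from statistics. A symmetric function is even in the relative coordinate `r` of a
pair, hence `π`-periodic on circles `|r| = t`, where the pair sees flux `α`. On `π`-periodic
functions `-i ∂_θ + α` has spectrum `2ℤ + α`, which stays at distance `α` from `0` for `0 ≤ α ≤ 1`.
Particles outside the disc contribute only a periodic gauge term (`exists_gauge`). A core function
vanishes at `r = 0`, so `|η|²` is bounded by integrating along rays. Balancing radial against
angular energy gives a cost of order `α / δ²`, linear in `α` (`disc_bound`, `IsCore.pair_bound`). A
Poincaré inequality brings two to four particles of a square into a position where this applies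
(`IsCore.exclusion_few`). Splitting into quarters then gives energy of order `α (n - 1) / ℓ²` for
`n` particles (`IsCore.exclusion`).

Uncertainty is a Ladyzhenskaya inequality together with the diamagnetic bound `|∂|u|²| ≤ 2 |u|
|Du|`. Up to constants, `ℓ² ∫ ρ² ≤ M² + ℓ² M T`, where `M` and `T` are the mass and the kinetic
energy in the square (`IsCore.uncertainty`). This is good when `M` is comparable to `m = ‖η‖²`.

A square with `M > 2m` is subdivided until the pieces have `M ≤ 2m`. The errors of order `m²` from
the pieces are paid by the exclusion energy of the smallest subdivided squares and propagated
upwards by a surplus term in the induction (`IsCore.density_bound_of_gt`). Letting the square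
exhaust the plane removes the remaining error. Fatou's lemma extends the inequality to the form
domain. The energy bound follows from it by Young's inequality applied to `V₋ ρ`. -/

noncomputable section

namespace Anyon

/-! ### The angular inequality -/

/-- Interval integrals of squared norms of continuous functions as Lebesgue integrals. -/
theorem ofReal_intervalIntegral_norm_sq {E : Type*} [NormedAddCommGroup E] {f : ℝ → E}
    (hf : Continuous f) {a b : ℝ} (hab : a ≤ b) :
    ENNReal.ofReal (∫ t in a..b, ‖f t‖ ^ 2) = ∫⁻ t in Set.Ioc a b, ‖f t‖ₑ ^ 2 := by
  rw [intervalIntegral.integral_of_le hab, ofReal_integral_eq_lintegral_ofReal]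
  · refine lintegral_congr fun t => ?_
    rw [ENNReal.ofReal_pow (norm_nonneg _), ofReal_norm]
  · exact ((hf.norm.pow 2).intervalIntegrable a b).1
  · exact Eventually.of_forall fun t => by positivity

/-- Only even integers occur, so the nearest competitor to `n = 0` is `n = -1`, with value `2 - α ≥
α`. With all integers allowed, the competitor would be `1 - α` and the bound would fail near `α =
1`. -/
theorem le_abs_two_mul_int_add {α : ℝ} (h1 : α ≤ 1) (n : ℤ) :
    α ≤ |2 * (n : ℝ) + α| := by
  rcases le_or_gt 0 n with hn | hn
  · have : (0 : ℝ) ≤ n := by exact_mod_cast hn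
    exact le_trans (by linarith) (le_abs_self _)
  · have : (n : ℝ) ≤ -1 := by exact_mod_cast (by omega : n ≤ -1)
    exact le_trans (by linarith) (neg_le_abs _)

/-- On `π`-periodic functions the operator `-i d/dθ + α` has spectrum `2ℤ + α`. -/
theorem sq_mul_integral_le_integral_momentum {α : ℝ} (h0 : 0 ≤ α) (h1 : α ≤ 1) {a : ℝ}
    {g g' : ℝ → ℂ} (hg : ∀ θ, HasDerivAt g (g' θ) θ) (hg' : Continuous g')
    (hper : g (a + Real.pi) = g a) :
    α ^ 2 * ∫ θ in a..(a + Real.pi), ‖g θ‖ ^ 2 ≤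
      ∫ θ in a..(a + Real.pi), ‖-Complex.I * g' θ + α * g θ‖ ^ 2 := by
  have hab : a < a + Real.pi := by linarith [Real.pi_pos]
  have hgc : Continuous g := continuous_iff_continuousAt.2 fun θ => (hg θ).continuousAt
  set h : ℝ → ℂ := fun θ => -Complex.I * g' θ + α * g θ with hh
  have hhc : Continuous h := by fun_prop
  have mem : ∀ {f : ℝ → ℂ}, Continuous f → MemLp f 2 (volume.restrict (Set.Ioc a (a + Real.pi))) :=
    fun {f} hf => (memLp_two_iff_integrable_sq_norm hf.aestronglyMeasurable).2
      ((hf.norm.pow 2).intervalIntegrable a (a + Real.pi)).1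
  -- On an interval of length `π` the characters are `e^{2inθ}`, so the operator multiplies the
  -- `n`-th coefficient by `2n + α`. Parseval then reduces the claim to a termwise comparison.
  have key : ∀ n : ℤ, fourierCoeffOn hab h n = (2 * (n : ℂ) + α) * fourierCoeffOn hab g n := by
    intro n
    have hlin : fourierCoeffOn hab h n =
        -Complex.I * fourierCoeffOn hab g' n + α * fourierCoeffOn hab g n := by
      have hF : Continuous fun x : ℝ => (fourier (-n) (x : AddCircle (a + Real.pi - a)) : ℂ) :=
        (map_continuous (fourier (-n))).comp (AddCircle.continuous_mk' _)
      simp only [fourierCoeffOn_eq_integral, hh, smul_eq_mul, Complex.real_smul]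
      have : ∀ x : ℝ, (fourier (-n) (x : AddCircle (a + Real.pi - a)) : ℂ) *
          (-Complex.I * g' x + α * g x) =
          -Complex.I * ((fourier (-n) (x : AddCircle (a + Real.pi - a)) : ℂ) * g' x) +
          α * ((fourier (-n) (x : AddCircle (a + Real.pi - a)) : ℂ) * g x) := by intro x; ring
      simp_rw [this]
      rw [intervalIntegral.integral_add, intervalIntegral.integral_const_mul,
        intervalIntegral.integral_const_mul]
      · ring
      · exact ((hF.mul hg').const_mul _).intervalIntegrable _ _
      · exact ((hF.mul hgc).const_mul _).intervalIntegrable _ _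
    rw [hlin]
    have hd : fourierCoeffOn hab g' n = 2 * Complex.I * n * fourierCoeffOn hab g n := by
      -- The integration-by-parts formula divides by `n`. For `n = 0` the mean of `g'` vanishes by
      -- periodicity.
      rcases eq_or_ne n 0 with rfl | hn
      · rw [fourierCoeffOn_eq_integral]
        simp only [neg_zero, fourier_zero, one_smul]
        rw [intervalIntegral.integral_eq_sub_of_hasDerivAt (fun x _ => hg x)
          (hg'.intervalIntegrable _ _), hper]
        simp
      · have := fourierCoeffOn_of_hasDerivAt hab hn (fun x _ => hg x)
          (hg'.intervalIntegrable _ _)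
        rw [this, hper]
        have hpi : (Real.pi : ℂ) ≠ 0 := by exact_mod_cast Real.pi_ne_zero
        have hn' : (n : ℂ) ≠ 0 := by exact_mod_cast hn
        push_cast
        field_simp
        ring
    rw [hd]
    linear_combination (-2 * n * fourierCoeffOn hab g n) * Complex.I_sq
  have s1 := hasSum_sq_fourierCoeffOn hab (mem hgc)
  have s2 := hasSum_sq_fourierCoeffOn hab (mem hhc)
  have hle := hasSum_le (fun n => ?_) (s1.mul_left (α ^ 2)) s2
  · have e : (a + Real.pi - a) = Real.pi := by ring
    rw [e, smul_eq_mul, smul_eq_mul, mul_left_comm] at hle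
    exact le_of_mul_le_mul_left hle (inv_pos.2 Real.pi_pos)
  · rw [key, norm_mul, mul_pow]
    gcongr
    have : (2 * (n : ℂ) + α) = ((2 * (n : ℝ) + α : ℝ) : ℂ) := by push_cast; ring
    rw [this, Complex.norm_real, Real.norm_eq_abs]
    exact le_abs_two_mul_int_add h1 n

/-- The angular inequality in an arbitrary periodic gauge. -/
theorem sq_mul_lintegral_le_lintegral_momentum {α : ℝ} (h0 : 0 ≤ α) (h1 : α ≤ 1) {a : ℝ}
    {f f' : ℝ → ℂ} {φ φ' : ℝ → ℝ} (hf : ∀ θ, HasDerivAt f (f' θ) θ) (hf' : Continuous f')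
    (hφ : ∀ θ, HasDerivAt φ (φ' θ) θ) (hφ' : Continuous φ')
    (hper : f (a + Real.pi) = f a) (hperφ : φ (a + Real.pi) = φ a) :
    ENNReal.ofReal α ^ 2 * ∫⁻ θ in Set.Ioc a (a + Real.pi), ‖f θ‖ₑ ^ 2 ≤
      ∫⁻ θ in Set.Ioc a (a + Real.pi),
        ‖-Complex.I * f' θ + α * (1 + φ' θ) * f θ‖ₑ ^ 2 := by
  have hab : a ≤ a + Real.pi := by linarith [Real.pi_pos]
  have hfc : Continuous f := continuous_iff_continuousAt.2 fun θ => (hf θ).continuousAt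
  have hφc : Continuous φ := continuous_iff_continuousAt.2 fun θ => (hφ θ).continuousAt
  -- Multiplication by `e^{iαφ}` preserves norms and conjugates `-i ∂ + α (1 + φ')` into `-i ∂ + α`.
  -- The factor is periodic because `φ` is.
  have hgauge : ∀ θ, ‖Complex.exp (Complex.I * (α * φ θ))‖ = 1 := fun θ => by
    rw [mul_comm]; exact_mod_cast Complex.norm_exp_ofReal_mul_I (α * φ θ)
  have hg : ∀ θ, HasDerivAt (fun θ => Complex.exp (Complex.I * (α * φ θ)) * f θ)
      (Complex.exp (Complex.I * (α * φ θ)) * (f' θ + Complex.I * α * φ' θ * f θ)) θ := by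
    intro θ
    have e := ((((hφ θ).ofReal_comp).const_mul (α : ℂ)).const_mul Complex.I).cexp
    exact (e.mul (hf θ)).congr_deriv (by ring)
  have main := sq_mul_integral_le_integral_momentum h0 h1 (a := a) hg (by fun_prop)
    (by simp only [hper, hperφ])
  have e1 : ∀ θ, ‖Complex.exp (Complex.I * (α * φ θ)) * f θ‖ = ‖f θ‖ := fun θ => by
    rw [norm_mul, hgauge, one_mul]
  have e2 : ∀ θ, ‖-Complex.I * (Complex.exp (Complex.I * (α * φ θ)) *
      (f' θ + Complex.I * α * φ' θ * f θ)) + α * (Complex.exp (Complex.I * (α * φ θ)) * f θ)‖ =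
      ‖-Complex.I * f' θ + α * (1 + φ' θ) * f θ‖ := fun θ => by
    rw [← one_mul ‖-Complex.I * f' θ + _‖, ← hgauge θ, ← norm_mul]
    congr 1
    linear_combination (-Complex.exp (Complex.I * (α * φ θ)) * α * φ' θ * f θ) * Complex.I_sq
  simp only [e1, e2] at main
  have := ENNReal.ofReal_le_ofReal main
  rwa [ENNReal.ofReal_mul (by positivity), ofReal_intervalIntegral_norm_sq hfc hab,
    ofReal_intervalIntegral_norm_sq (by fun_prop) hab, ENNReal.ofReal_pow h0] at this

end Anyon
end

noncomputable section

namespace Anyon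

/-! ### Integration over the plane -/

theorem lintegral_plane (f : Plane → ℝ≥0∞) :
    ∫⁻ z : Plane, f z = ∫⁻ p : ℝ × ℝ, f !₂[p.1, p.2] := by
  have h1 := (EuclideanSpace.volume_preserving_symm_measurableEquiv_toLp (Fin 2)).symm
  have h2 := (volume_preserving_finTwoArrow ℝ).symm
  have h := h1.comp h2
  rw [← h.map_eq]
  exact lintegral_map_equiv f ((MeasurableEquiv.finTwoArrow (α := ℝ)).symm.trans
    (MeasurableEquiv.toLp 2 (Fin 2 → ℝ)))

theorem measurable_toPlane : Measurable fun p : ℝ × ℝ => (!₂[p.1, p.2] : Plane) := by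
  fun_prop

/-- The unit vector at angle `θ`. -/
def unitVec (θ : ℝ) : Plane := !₂[Real.cos θ, Real.sin θ]

/-- The unit vector at angle `θ`, rotated by `π / 2`. -/
def unitPerp (θ : ℝ) : Plane := !₂[-Real.sin θ, Real.cos θ]

theorem norm_unitVec (θ : ℝ) : ‖unitVec θ‖ = 1 := by
  simp [unitVec, EuclideanSpace.norm_eq]

theorem norm_smul_unitVec {t : ℝ} (ht : 0 ≤ t) (θ : ℝ) : ‖t • unitVec θ‖ = t := by
  rw [norm_smul, norm_unitVec, mul_one, Real.norm_of_nonneg ht]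

theorem unitVec_add_pi (θ : ℝ) : unitVec (θ + Real.pi) = -unitVec θ := by
  ext a; fin_cases a <;> simp [unitVec]

theorem hasDerivAt_unitVec (θ : ℝ) : HasDerivAt unitVec (unitPerp θ) θ := by
  have h := ((Real.hasDerivAt_cos θ).smul_const (EuclideanSpace.single 0 1 : Plane)).add
    ((Real.hasDerivAt_sin θ).smul_const (EuclideanSpace.single 1 1 : Plane))
  refine (h.congr_deriv ?_).congr_of_eventuallyEq (Eventually.of_forall fun t => ?_)
  · ext a; fin_cases a <;> simp [unitPerp]
  · ext a; fin_cases a <;> simp [unitVec]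

@[fun_prop]
theorem continuous_unitVec : Continuous unitVec :=
  continuous_iff_continuousAt.2 fun θ => (hasDerivAt_unitVec θ).continuousAt

@[fun_prop]
theorem continuous_unitPerp : Continuous unitPerp := by
  unfold unitPerp
  fun_prop

/-- Polar coordinates on a disc. -/
theorem setLIntegral_ball_polar {h : Plane → ℝ≥0∞} (hh : Measurable h) (δ : ℝ) :
    ∫⁻ z in {z : Plane | ‖z‖ < δ}, h z =
      ∫⁻ s in Set.Ioo 0 δ, ENNReal.ofReal s *
        ∫⁻ θ in Set.Ioc (-Real.pi) Real.pi, h (s • unitVec θ) := by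
  have hm : MeasurableSet {z : Plane | ‖z‖ < δ} := measurableSet_lt measurable_norm measurable_const
  rw [← lintegral_indicator hm, lintegral_plane, ← lintegral_comp_polarCoord_symm]
  have hmeas : Measurable fun p : ℝ × ℝ => ({z : Plane | ‖z‖ < δ}.indicator h) (p.1 • unitVec p.2) :=
    (hh.indicator hm).comp (by fun_prop)
  have e : ∀ p : ℝ × ℝ, (!₂[(polarCoord.symm p).1, (polarCoord.symm p).2] : Plane) =
      p.1 • unitVec p.2 := fun p => by
    ext a; fin_cases a <;> simp [unitVec]
  simp only [e, smul_eq_mul]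
  rw [polarCoord_target, Measure.volume_eq_prod, ← Measure.prod_restrict, lintegral_prod]
  swap
  · exact (by fun_prop : Measurable fun p : ℝ × ℝ => ENNReal.ofReal p.1).mul hmeas |>.aemeasurable
  dsimp only
  rw [← lintegral_indicator measurableSet_Ioi, ← lintegral_indicator measurableSet_Ioo]
  refine lintegral_congr fun s => ?_
  by_cases hs : 0 < s
  · rw [Set.indicator_of_mem (show s ∈ Set.Ioi (0 : ℝ) from hs),
      lintegral_const_mul _
        (show Measurable fun θ : ℝ => {z : Plane | ‖z‖ < δ}.indicator h (s • unitVec θ) from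
          (hh.indicator hm).comp (by fun_prop : Measurable fun θ : ℝ => s • unitVec θ)),
      restrict_Ioo_eq_restrict_Ioc]
    by_cases hd : s < δ
    · rw [Set.indicator_of_mem (show s ∈ Set.Ioo 0 δ from ⟨hs, hd⟩)]
      congr 1
      refine lintegral_congr fun θ => ?_
      rw [Set.indicator_of_mem (show s • unitVec θ ∈ {z : Plane | ‖z‖ < δ} by
        rwa [Set.mem_ofPred_eq, norm_smul_unitVec hs.le])]
    · rw [Set.indicator_of_notMem fun h => hd h.2]
      have : ∀ θ, {z : Plane | ‖z‖ < δ}.indicator h (s • unitVec θ) = 0 := fun θ =>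
        Set.indicator_of_notMem (by simpa [norm_smul_unitVec hs.le] using hd) _
      simp [this]
  · rw [Set.indicator_of_notMem (by simpa using hs), Set.indicator_of_notMem fun h => hs h.1]

/-! ### The kinetic energy of a flux tube on a disc -/

theorem fderiv_plane_apply {F : Plane → ℂ} (r v : Plane) :
    fderiv ℝ F r v = ∑ a, (v a : ℂ) * fderiv ℝ F r (EuclideanSpace.single a 1) := by
  have hv : v = ∑ a, v a • (EuclideanSpace.single a 1 : Plane) := by
    ext b; fin_cases b <;> simp [Fin.sum_univ_two]
  conv_lhs => rw [hv]
  simp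

/-- The two real unit vectors are orthonormal, also as a basis of `ℂ²`. -/
theorem norm_sq_eq_radial_add_angular (G : EuclideanSpace ℂ (Fin 2)) (θ : ℝ) :
    ‖G‖ₑ ^ 2 = ‖∑ a, (unitVec θ a : ℂ) * G a‖ₑ ^ 2 + ‖∑ a, (unitPerp θ a : ℂ) * G a‖ₑ ^ 2 := by
  simp only [← ofReal_norm, ← ENNReal.ofReal_pow (norm_nonneg _)]
  rw [← ENNReal.ofReal_add (by positivity) (by positivity)]
  congr 1
  rw [EuclideanSpace.norm_sq_eq]
  simp only [Fin.sum_univ_two, unitVec, unitPerp, ← Complex.normSq_eq_norm_sq,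
    Complex.normSq_apply]
  simp [-Complex.ofReal_cos, -Complex.ofReal_sin]
  linear_combination (-((G 0).re ^ 2 + (G 0).im ^ 2 + (G 1).re ^ 2 + (G 1).im ^ 2)) *
    Real.sin_sq_add_cos_sq θ

/-- The derivative of `|u|²` is controlled by any covariant derivative of `u`. -/
theorem abs_two_mul_re_conj_mul_le (u u' : ℂ) (a : ℝ) :
    |2 * (u.re * u'.re + u.im * u'.im)| ≤ 2 * (‖u‖ * ‖-Complex.I * u' + a * u‖) := by
  rw [abs_mul, abs_two]
  gcongr
  -- A real potential drops out: `i ū (-i u' + a u) = ū u' + i a |u|²`, whose last term is purely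
  -- imaginary.
  have h : u.re * u'.re + u.im * u'.im =
      (Complex.I * ((starRingEnd ℂ) u * (-Complex.I * u' + a * u))).re := by
    simp; ring
  rw [h]
  refine (Complex.abs_re_le_norm _).trans ?_
  simp

theorem hasDerivAt_norm_sq {u : ℝ → ℂ} {u' : ℂ} {t : ℝ} (hu : HasDerivAt u u' t) :
    HasDerivAt (fun t => ‖u t‖ ^ 2) (2 * ((u t).re * u'.re + (u t).im * u'.im)) t := by
  have := hu.norm_sq
  refine this.congr_deriv ?_
  rw [Complex.inner]
  simp
  ring

/-- The fundamental theorem of calculus for `|u|²`. -/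
theorem enorm_sq_le_add_lintegral {u u' : ℝ → ℂ} (hu : ∀ t, HasDerivAt u (u' t) t)
    (hu' : Continuous u') {I : Set ℝ} {s t : ℝ} (hI : Set.uIoc s t ⊆ I) {g : ℝ → ℝ≥0∞}
    (hg : ∀ τ ∈ Set.uIoc s t,
      ENNReal.ofReal |2 * ((u τ).re * (u' τ).re + (u τ).im * (u' τ).im)| ≤ g τ) :
    ‖u t‖ₑ ^ 2 ≤ ‖u s‖ₑ ^ 2 + ∫⁻ τ in I, g τ := by
  have huc : Continuous u := continuous_iff_continuousAt.2 fun t => (hu t).continuousAt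
  set v' : ℝ → ℝ := fun τ => 2 * ((u τ).re * (u' τ).re + (u τ).im * (u' τ).im) with hv'
  have hc : Continuous v' := by fun_prop
  have h1 := intervalIntegral.integral_eq_sub_of_hasDerivAt
    (fun τ _ => hasDerivAt_norm_sq (hu τ)) (hc.intervalIntegrable s t)
  have h2 : ‖u t‖ ^ 2 ≤ ‖u s‖ ^ 2 + ∫ τ in Set.uIoc s t, ‖v' τ‖ := by
    have := intervalIntegral.norm_integral_le_integral_norm_uIoc (f := v') (a := s) (b := t)
      (μ := volume)
    rw [h1] at this
    linarith [le_abs_self (‖u t‖ ^ 2 - ‖u s‖ ^ 2), Real.norm_eq_abs (‖u t‖ ^ 2 - ‖u s‖ ^ 2)]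
  have h3 := ENNReal.ofReal_le_ofReal h2
  rw [ENNReal.ofReal_add (by positivity) (by positivity), ENNReal.ofReal_pow (norm_nonneg _),
    ENNReal.ofReal_pow (norm_nonneg _), ofReal_norm, ofReal_norm] at h3
  refine h3.trans ?_
  gcongr
  rw [ofReal_integral_eq_lintegral_ofReal (hc.norm.integrableOn_uIoc)
    (Eventually.of_forall fun _ => norm_nonneg _)]
  refine (setLIntegral_mono' measurableSet_uIoc fun τ hτ => hg τ hτ).trans ?_
  exact lintegral_mono_set hI

end Anyon
end

noncomputable section

namespace Anyon

/-- A full turn consists of two half turns, each a full period for an even function, so the angular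
inequality applies to each. -/
theorem lintegral_Ioc_neg_pi_pi (h : ℝ → ℝ≥0∞) :
    ∫⁻ θ in Set.Ioc (-Real.pi) Real.pi, h θ =
      (∫⁻ θ in Set.Ioc (-Real.pi) (-Real.pi + Real.pi), h θ) +
        ∫⁻ θ in Set.Ioc 0 (0 + Real.pi), h θ := by
  have hpi := Real.pi_pos
  rw [neg_add_cancel, zero_add, ← Set.Ioc_union_Ioc_eq_Ioc (b := 0) (by linarith) hpi.le,
    lintegral_union measurableSet_Ioc]
  exact Set.Ioc_disjoint_Ioc_of_le le_rfl

/-- The weight `t` is chosen for polar coordinates: the angular inequality turns `t⁻¹ α² |x|²` into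
`t` times the angular energy, and both terms then carry the area factor `t`. -/
theorem ofReal_two_mul_mul_le {α t : ℝ} (h0 : 0 ≤ α) (ht : 0 < t) (x y : ℂ) :
    ENNReal.ofReal α * ENNReal.ofReal (2 * (‖x‖ * ‖y‖)) ≤
      ENNReal.ofReal t⁻¹ * (ENNReal.ofReal α ^ 2 * ‖x‖ₑ ^ 2) + ENNReal.ofReal t * ‖y‖ₑ ^ 2 := by
  simp only [← ofReal_norm, ← ENNReal.ofReal_pow (norm_nonneg _), ← ENNReal.ofReal_pow h0]
  have : 0 ≤ t⁻¹ := by positivity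
  rw [← ENNReal.ofReal_mul h0, ← ENNReal.ofReal_mul (by positivity), ← ENNReal.ofReal_mul this,
    ← ENNReal.ofReal_mul ht.le, ← ENNReal.ofReal_add (by positivity) (by positivity)]
  apply ENNReal.ofReal_le_ofReal
  have h : t⁻¹ * (α ^ 2 * ‖x‖ ^ 2) + t * ‖y‖ ^ 2 - α * (2 * (‖x‖ * ‖y‖)) =
      t⁻¹ * (α * ‖x‖ - t * ‖y‖) ^ 2 := by
    field_simp; ring
  have h' : 0 ≤ t⁻¹ * (α * ‖x‖ - t * ‖y‖) ^ 2 := by positivity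
  linarith

theorem lintegral_ofReal_Ioo {δ : ℝ} (hδ : 0 ≤ δ) :
    ∫⁻ s in Set.Ioo 0 δ, ENNReal.ofReal s = ENNReal.ofReal (δ ^ 2 / 2) := by
  rw [restrict_Ioo_eq_restrict_Ioc, ← ofReal_integral_eq_lintegral_ofReal,
    ← intervalIntegral.integral_of_le hδ, integral_id]
  · simp
  · exact (continuous_id.intervalIntegrable 0 δ).1
  · filter_upwards [ae_restrict_mem measurableSet_Ioc] with s hs using hs.1.le

section Disc

variable {α δ : ℝ} {F : Plane → ℂ} {A : Plane → Plane} {G : Plane → EuclideanSpace ℂ (Fin 2)}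

/-- On each circle around a flux `α ∈ [0, 1]`, an even function has angular kinetic energy at
least `α² / t²`. -/
theorem angular_bound (h0 : 0 ≤ α) (h1 : α ≤ 1) (hF : ContDiff ℝ 1 F)
    (heven : ∀ r, F (-r) = F r)
    (hG : ∀ r a, 0 < ‖r‖ → ‖r‖ < δ → G r a =
      -Complex.I * fderiv ℝ F r (EuclideanSpace.single a 1) + α * A r a * F r)
    {t : ℝ} (ht : 0 < t) (htδ : t < δ)
    (hA : ∃ φ φ' : ℝ → ℝ, (∀ θ, HasDerivAt φ (φ' θ) θ) ∧ Continuous φ' ∧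
      (∀ θ, φ (θ + Real.pi) = φ θ) ∧
      ∀ θ, t * ∑ a, unitPerp θ a * A (t • unitVec θ) a = 1 + φ' θ) :
    ENNReal.ofReal α ^ 2 * ∫⁻ θ in Set.Ioc (-Real.pi) Real.pi, ‖F (t • unitVec θ)‖ₑ ^ 2 ≤
      ENNReal.ofReal t ^ 2 * ∫⁻ θ in Set.Ioc (-Real.pi) Real.pi,
        ‖∑ a, (unitPerp θ a : ℂ) * G (t • unitVec θ) a‖ₑ ^ 2 := by
  obtain ⟨φ, φ', hφ, hφ', hper, hflux⟩ := hA
  have hFd : ∀ r, HasFDerivAt F (fderiv ℝ F r) r := fun r =>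
    (hF.differentiable one_ne_zero r).hasFDerivAt
  have hf : ∀ θ, HasDerivAt (fun θ => F (t • unitVec θ))
      (fderiv ℝ F (t • unitVec θ) (t • unitPerp θ)) θ := fun θ =>
    (hFd _).comp_hasDerivAt θ ((hasDerivAt_unitVec θ).const_smul t)
  have hf' : Continuous fun θ => fderiv ℝ F (t • unitVec θ) (t • unitPerp θ) := by
    have := hF.continuous_fderiv one_ne_zero
    fun_prop
  have hfper : ∀ θ, F (t • unitVec (θ + Real.pi)) = F (t • unitVec θ) := fun θ => by
    rw [unitVec_add_pi, smul_neg, heven]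
  have key : ∀ θ, ‖-Complex.I * fderiv ℝ F (t • unitVec θ) (t • unitPerp θ) +
      α * (1 + φ' θ) * F (t • unitVec θ)‖ₑ ^ 2 =
      ENNReal.ofReal t ^ 2 * ‖∑ a, (unitPerp θ a : ℂ) * G (t • unitVec θ) a‖ₑ ^ 2 := by
    intro θ
    have hn := norm_smul_unitVec ht.le θ
    have e : -Complex.I * fderiv ℝ F (t • unitVec θ) (t • unitPerp θ) +
        α * (1 + φ' θ) * F (t • unitVec θ) =
        (t : ℂ) * ∑ a, (unitPerp θ a : ℂ) * G (t • unitVec θ) a := by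
      have hc : (1 + (φ' θ : ℂ)) = t * ∑ a, (unitPerp θ a : ℂ) * (A (t • unitVec θ) a : ℂ) := by
        exact_mod_cast (hflux θ).symm
      rw [hc, fderiv_plane_apply]
      simp only [hG (t • unitVec θ) _ (by rw [hn]; exact ht) (by rw [hn]; exact htδ),
        Fin.sum_univ_two, PiLp.smul_apply, smul_eq_mul, Complex.ofReal_mul]
      ring
    rw [e, enorm_mul, mul_pow]
    congr 2
    rw [← ofReal_norm, Complex.norm_real, Real.norm_of_nonneg ht.le]
  have hGc : ∀ a : ℝ, ENNReal.ofReal α ^ 2 * ∫⁻ θ in Set.Ioc a (a + Real.pi),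
      ‖F (t • unitVec θ)‖ₑ ^ 2 ≤ ENNReal.ofReal t ^ 2 * ∫⁻ θ in Set.Ioc a (a + Real.pi),
        ‖∑ a, (unitPerp θ a : ℂ) * G (t • unitVec θ) a‖ₑ ^ 2 := by
    intro a
    have := sq_mul_lintegral_le_lintegral_momentum h0 h1 hf hf' hφ hφ' (hfper a) (hper a)
    simp only [key] at this
    rwa [lintegral_const_mul' _ _ (by finiteness)] at this
  rw [lintegral_Ioc_neg_pi_pi, lintegral_Ioc_neg_pi_pi, mul_add, mul_add]
  exact add_le_add (hGc _) (hGc _)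

/-- An even function vanishing at a flux `α ∈ [0, 1]` has kinetic energy at least `2 α / δ²` on
a disc of radius `δ` around it. -/
theorem disc_bound (h0 : 0 ≤ α) (h1 : α ≤ 1) (hδ : 0 ≤ δ) (hF : ContDiff ℝ 1 F)
    (hF0 : F 0 = 0) (heven : ∀ r, F (-r) = F r) (hGm : Measurable G)
    (hG : ∀ r a, 0 < ‖r‖ → ‖r‖ < δ → G r a =
      -Complex.I * fderiv ℝ F r (EuclideanSpace.single a 1) + α * A r a * F r)
    (hA : ∀ t, 0 < t → t < δ → ∃ φ φ' : ℝ → ℝ, (∀ θ, HasDerivAt φ (φ' θ) θ) ∧ Continuous φ' ∧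
      (∀ θ, φ (θ + Real.pi) = φ θ) ∧
      ∀ θ, t * ∑ a, unitPerp θ a * A (t • unitVec θ) a = 1 + φ' θ) :
    ENNReal.ofReal α * ∫⁻ r in {r : Plane | ‖r‖ < δ}, ‖F r‖ₑ ^ 2 ≤
      ENNReal.ofReal (δ ^ 2 / 2) * ∫⁻ r in {r : Plane | ‖r‖ < δ}, ‖G r‖ₑ ^ 2 := by
  have hFd : ∀ r, HasFDerivAt F (fderiv ℝ F r) r := fun r =>
    (hF.differentiable one_ne_zero r).hasFDerivAt
  have hF' := hF.continuous_fderiv one_ne_zero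
  have hFc := hF.continuous
  have hGrm : Measurable fun p : ℝ × ℝ =>
      ‖∑ a, (unitVec p.2 a : ℂ) * G (p.1 • unitVec p.2) a‖ₑ ^ 2 := by fun_prop
  have hGpm : Measurable fun p : ℝ × ℝ =>
      ‖∑ a, (unitPerp p.2 a : ℂ) * G (p.1 • unitVec p.2) a‖ₑ ^ 2 := by fun_prop
  have hFm : Measurable fun p : ℝ × ℝ => ‖F (p.1 • unitVec p.2)‖ₑ ^ 2 :=
    (by fun_prop : Continuous fun p : ℝ × ℝ => F (p.1 • unitVec p.2)).measurable.enorm.pow_const 2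
  have hslice : ∀ {h : ℝ × ℝ → ℝ≥0∞}, Measurable h → ∀ t, Measurable fun θ => h (t, θ) :=
    fun hh t => hh.comp (by fun_prop)
  have hsum : Measurable fun p : ℝ × ℝ =>
      ENNReal.ofReal p.1⁻¹ * (ENNReal.ofReal α ^ 2 * ‖F (p.1 • unitVec p.2)‖ₑ ^ 2) +
        ENNReal.ofReal p.1 * ‖∑ a, (unitVec p.2 a : ℂ) * G (p.1 • unitVec p.2) a‖ₑ ^ 2 :=
    ((by fun_prop : Measurable fun p : ℝ × ℝ => ENNReal.ofReal p.1⁻¹).mul (hFm.const_mul _)).add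
      ((by fun_prop : Measurable fun p : ℝ × ℝ => ENNReal.ofReal p.1).mul hGrm)
  -- Integration starts at the origin, where `F` vanishes, so no boundary term appears.
  have radial : ∀ s, 0 < s → s < δ → ∀ θ, ENNReal.ofReal α * ‖F (s • unitVec θ)‖ₑ ^ 2 ≤
      ∫⁻ t in Set.Ioc 0 s, (ENNReal.ofReal t⁻¹ * (ENNReal.ofReal α ^ 2 * ‖F (t • unitVec θ)‖ₑ ^ 2)
        + ENNReal.ofReal t * ‖∑ a, (unitVec θ a : ℂ) * G (t • unitVec θ) a‖ₑ ^ 2) := by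
    intro s hs hsδ θ
    have hu : ∀ t : ℝ, HasDerivAt (fun t : ℝ => F (t • unitVec θ))
        (fderiv ℝ F (t • unitVec θ) (unitVec θ)) t := fun t => by
      exact ((hFd (t • unitVec θ)).comp_hasDerivAt t
        ((hasDerivAt_id t).smul_const (unitVec θ))).congr_deriv (by simp)
    have h := enorm_sq_le_add_lintegral hu (by fun_prop) (s := 0) (t := s) (I := Set.Ioc 0 s)
      (by rw [Set.uIoc_of_le hs.le])
      (g := fun t => ENNReal.ofReal (2 * (‖F (t • unitVec θ)‖ *
        ‖∑ a, (unitVec θ a : ℂ) * G (t • unitVec θ) a‖))) (fun t ht => ?_)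
    · simp only [zero_smul, hF0, enorm_zero, ne_eq, OfNat.ofNat_ne_zero, not_false_eq_true,
        zero_pow, zero_add] at h
      refine (mul_le_mul_right h _).trans ?_
      rw [← lintegral_const_mul' _ _ ENNReal.ofReal_ne_top]
      refine setLIntegral_mono' measurableSet_Ioc fun t ht => ?_
      exact ofReal_two_mul_mul_le h0 ht.1 _ _
    · rw [Set.uIoc_of_le hs.le] at ht
      have hn := norm_smul_unitVec ht.1.le θ
      apply ENNReal.ofReal_le_ofReal
      refine (abs_two_mul_re_conj_mul_le _ _
        (α * ∑ a, unitVec θ a * A (t • unitVec θ) a)).trans_eq ?_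
      congr 3
      rw [fderiv_plane_apply]
      simp only [hG (t • unitVec θ) _ (by rw [hn]; exact ht.1) (by rw [hn]; linarith [ht.2]),
        Fin.sum_univ_two]
      push_cast
      ring
  -- Integrating the radial bound over angles and swapping the integrals lets `angular_bound` act on
  -- each circle of radius `t ≤ s`. Radial and angular parts recombine into `|G|²`. The result is
  -- uniform in `s`.
  have circle : ∀ s, 0 < s → s < δ →
      ENNReal.ofReal α * ∫⁻ θ in Set.Ioc (-Real.pi) Real.pi, ‖F (s • unitVec θ)‖ₑ ^ 2 ≤
      ∫⁻ r in {r : Plane | ‖r‖ < δ}, ‖G r‖ₑ ^ 2 := by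
    intro s hs hsδ
    rw [← lintegral_const_mul' _ _ ENNReal.ofReal_ne_top,
      setLIntegral_ball_polar (by fun_prop : Measurable fun r => ‖G r‖ₑ ^ 2)]
    refine (lintegral_mono fun θ => radial s hs hsδ θ).trans ?_
    rw [lintegral_lintegral_swap (f := fun θ t => ENNReal.ofReal t⁻¹ *
      (ENNReal.ofReal α ^ 2 * ‖F (t • unitVec θ)‖ₑ ^ 2) + ENNReal.ofReal t *
        ‖∑ a, (unitVec θ a : ℂ) * G (t • unitVec θ) a‖ₑ ^ 2)
      (hsum.comp measurable_swap).aemeasurable]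
    refine le_trans (setLIntegral_mono' measurableSet_Ioc fun t ht => ?_)
      (lintegral_mono_set fun t (ht : t ∈ Set.Ioc 0 s) => ⟨ht.1, ht.2.trans_lt hsδ⟩)
    have ht0 : ENNReal.ofReal t ≠ 0 := by simpa using ht.1
    rw [lintegral_add_left (((hslice hFm t).const_mul _).const_mul _), lintegral_const_mul' _ _ ENNReal.ofReal_ne_top,
      lintegral_const_mul' _ _ (by finiteness), lintegral_const_mul' _ _ ENNReal.ofReal_ne_top]
    have hang := angular_bound h0 h1 hF heven hG ht.1 (ht.2.trans_lt hsδ)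
      (hA t ht.1 (ht.2.trans_lt hsδ))
    have : ENNReal.ofReal t⁻¹ * ENNReal.ofReal t ^ 2 = ENNReal.ofReal t := by
      rw [sq, ← mul_assoc, ← ENNReal.ofReal_mul (by have := ht.1; positivity),
        inv_mul_cancel₀ ht.1.ne', ENNReal.ofReal_one, one_mul]
    calc _ ≤ ENNReal.ofReal t⁻¹ * (ENNReal.ofReal t ^ 2 * ∫⁻ θ in Set.Ioc (-Real.pi) Real.pi,
          ‖∑ a, (unitPerp θ a : ℂ) * G (t • unitVec θ) a‖ₑ ^ 2) + ENNReal.ofReal t *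
          ∫⁻ θ in Set.Ioc (-Real.pi) Real.pi,
          ‖∑ a, (unitVec θ a : ℂ) * G (t • unitVec θ) a‖ₑ ^ 2 := by gcongr
      _ = _ := by
        rw [← mul_assoc, this, ← mul_add, ← lintegral_add_left (hslice hGpm t)]
        congr 1
        refine lintegral_congr fun θ => ?_
        rw [norm_sq_eq_radial_add_angular _ θ, add_comm]
  -- Integrating the uniform circle bound against `s ds` on `(0, δ)` produces the factor `δ² / 2`.
  rw [setLIntegral_ball_polar (hFc.measurable.enorm.pow_const 2),
    ← lintegral_const_mul' _ _ ENNReal.ofReal_ne_top, ← lintegral_ofReal_Ioo hδ]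
  rw [← lintegral_mul_const _ (by fun_prop)]
  refine setLIntegral_mono' measurableSet_Ioo fun s hs => ?_
  rw [mul_left_comm]
  gcongr
  exact circle s hs.1 hs.2

end Disc

end Anyon
end

noncomputable section

namespace Anyon

variable {N : ℕ}

/-! ### The pair potential in relative coordinates -/

/-- The identification of the plane with `ℂ`. -/
def toComplex (z : Plane) : ℂ := ⟨z 0, z 1⟩

@[simp] theorem toComplex_add (z w : Plane) : toComplex (z + w) = toComplex z + toComplex w := by
  apply Complex.ext <;> simp [toComplex]

@[simp] theorem toComplex_sub (z w : Plane) : toComplex (z - w) = toComplex z - toComplex w := by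
  apply Complex.ext <;> simp [toComplex]

@[simp] theorem toComplex_smul (c : ℝ) (z : Plane) : toComplex (c • z) = c * toComplex z := by
  apply Complex.ext <;> simp [toComplex]

theorem norm_toComplex (z : Plane) : ‖toComplex z‖ = ‖z‖ := by
  rw [EuclideanSpace.norm_eq, Complex.norm_eq_sqrt_sq_add_sq]
  simp [toComplex]

theorem toComplex_unitVec (θ : ℝ) : toComplex (unitVec θ) = Complex.exp (θ * Complex.I) := by
  apply Complex.ext <;> simp [toComplex, unitVec, Complex.exp_ofReal_mul_I_re,
    Complex.exp_ofReal_mul_I_im]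

theorem toComplex_unitPerp (θ : ℝ) :
    toComplex (unitPerp θ) = Complex.I * Complex.exp (θ * Complex.I) := by
  apply Complex.ext <;> simp [toComplex, unitPerp, Complex.exp_ofReal_mul_I_re,
    Complex.exp_ofReal_mul_I_im]

/-- In complex notation the potential at `u` is `i / ū`. Written this way, line integrals of the
potential become imaginary parts of logarithmic derivatives. -/
theorem sum_mul_perpInv (v u : Plane) :
    ∑ a, v a * perpInv u a = (toComplex v / toComplex u).im := by
  have : ‖u‖ ^ 2 = Complex.normSq (toComplex u) := by
    rw [Complex.normSq_eq_norm_sq, norm_toComplex]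
  rw [Complex.div_im, ← this]
  simp [perpInv, toComplex]
  ring

theorem sum_mul_vectorPotential (v : Plane) (j : Fin N) (x : Config N) :
    ∑ a, v a * vectorPotential j x a =
      ∑ l ∈ Finset.univ.erase j, (toComplex v / toComplex (x j - x l)).im := by
  simp only [← sum_mul_perpInv, vectorPotential, WithLp.ofLp_sum, Finset.sum_apply, Finset.mul_sum]
  rw [Finset.sum_comm]

/-- The configuration `x` with the particles `j` and `k` moved to `X ± r / 2`. -/
def pairPath (j k : Fin N) (X : Plane) (x : Config N) (r : Plane) : Config N :=
  fun l => if l = j then X + (1 / 2 : ℝ) • r else if l = k then X - (1 / 2 : ℝ) • r else x l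

theorem pairPath_left (j k : Fin N) (X : Plane) (x : Config N) (r : Plane) :
    pairPath j k X x r j = X + (1 / 2 : ℝ) • r := by simp [pairPath]

theorem pairPath_right {j k : Fin N} (hjk : j ≠ k) (X : Plane) (x : Config N) (r : Plane) :
    pairPath j k X x r k = X - (1 / 2 : ℝ) • r := by simp [pairPath, hjk.symm]

theorem pairPath_of_ne {j k l : Fin N} (hj : l ≠ j) (hk : l ≠ k) (X : Plane) (x : Config N)
    (r : Plane) : pairPath j k X x r l = x l := by simp [pairPath, hj, hk]

/-- The flux of a pair of particles through circles in the relative coordinate, up to the total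
derivative coming from particles outside the disc. -/
theorem exists_gauge {j k : Fin N} (hjk : j ≠ k) {X : Plane} {x : Config N} {t : ℝ} (ht : 0 < t)
    (hx : ∀ l, l ≠ j → l ≠ k → t / 2 < ‖X - x l‖) :
    ∃ φ φ' : ℝ → ℝ, (∀ θ, HasDerivAt φ (φ' θ) θ) ∧ Continuous φ' ∧
      (∀ θ, φ (θ + Real.pi) = φ θ) ∧
      ∀ θ, t * ∑ a, unitPerp θ a * ((1 / 2 : ℝ) •
        (vectorPotential j (pairPath j k X x (t • unitVec θ)) -
          vectorPotential k (pairPath j k X x (t • unitVec θ)))) a = 1 + φ' θ := by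
  set J := (Finset.univ.erase j).erase k with hJ
  have hmem : ∀ l ∈ J, l ≠ j ∧ l ≠ k := fun l hl => by simp [hJ] at hl; tauto
  set r : ℝ → ℂ := fun θ => t * Complex.exp (θ * Complex.I) with hr
  have hr' : ∀ θ, HasDerivAt r (Complex.I * r θ) θ := fun θ => by
    have := (((hasDerivAt_id θ).ofReal_comp.mul_const Complex.I).cexp).const_mul (t : ℂ)
    exact this.congr_deriv (by simp [hr]; ring)
  have hrn : ∀ θ, ‖r θ‖ = t := fun θ => by simp [hr, Complex.norm_exp_ofReal_mul_I, ht.le]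
  have hr0 : ∀ θ, r θ ≠ 0 := fun θ h => by have := hrn θ; rw [h, norm_zero] at this; linarith
  have hrc : Continuous r := by fun_prop
  set w : Fin N → ℂ := fun l => toComplex (X - x l) with hw
  have hwn : ∀ l ∈ J, t / 2 < ‖w l‖ := fun l hl => by
    rw [hw, norm_toComplex]; exact hx l (hmem l hl).1 (hmem l hl).2
  have hw0 : ∀ l ∈ J, w l ≠ 0 := fun l hl h => by
    have := hwn l hl; rw [h, norm_zero] at this; linarith
  -- Up to the constant `w²`, this is the product `(w + r/2)(w - r/2)` of the displacements from an
  -- outside particle to the pair. Its argument is the phase generated by that particle. As `|r| <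
  -- 2|w|`, the value stays in the right half-plane, so the principal logarithm is smooth. It
  -- depends on `r²` only, hence is `π`-periodic.
  set z : Fin N → ℝ → ℂ := fun l θ => 1 - (r θ / (2 * w l)) ^ 2 with hz
  have hslit : ∀ l ∈ J, ∀ θ, z l θ ∈ Complex.slitPlane := fun l hl θ => by
    left
    have h2 : ‖(r θ / (2 * w l)) ^ 2‖ < 1 := by
      rw [norm_pow, norm_div, hrn, norm_mul]
      have h3 := hwn l hl
      have : t / (‖(2 : ℂ)‖ * ‖w l‖) < 1 := by
        rw [div_lt_one (mul_pos (by simp) (by linarith))]; simp; linarith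
      exact pow_lt_one₀ (by positivity) this two_ne_zero
    have := (Complex.abs_re_le_norm ((r θ / (2 * w l)) ^ 2)).trans_lt h2
    simp only [hz, Complex.sub_re, Complex.one_re]
    linarith [le_abs_self ((r θ / (2 * w l)) ^ 2).re]
  have hz' : ∀ l, ∀ θ, HasDerivAt (z l) (-(2 * Complex.I * (r θ / (2 * w l)) ^ 2)) θ := fun l θ => by
    have := (((hr' θ).div_const (2 * w l)).pow 2).const_sub 1
    exact this.congr_deriv (by simp; ring)
  have hzc : ∀ l, Continuous (z l) := fun l => by fun_prop
  refine ⟨fun θ => ∑ l ∈ J, (Complex.log (z l θ)).im,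
    fun θ => ∑ l ∈ J, (-(2 * Complex.I * (r θ / (2 * w l)) ^ 2) / z l θ).im, ?_, ?_, ?_, ?_⟩
  · intro θ
    refine HasDerivAt.fun_sum fun l hl => ?_
    have h := (hz' l θ).clog_real (hslit l hl θ)
    exact (Complex.imCLM.hasFDerivAt.comp_hasDerivAt θ h)
  · refine continuous_finsetSum _ fun l hl => Complex.continuous_im.comp ?_
    exact Continuous.div (by fun_prop) (hzc l) fun θ => Complex.slitPlane_ne_zero (hslit l hl θ)
  · intro θ
    have : r (θ + Real.pi) = -r θ := by
      simp [hr, add_mul, Complex.exp_add]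
    simp only [hz, this, neg_div, neg_sq]
  · intro θ
    have e : ∀ (a : Fin 2) (V W : Plane), ((1 / 2 : ℝ) • (V - W)) a = (1 / 2) * V a - (1 / 2) * W a :=
      fun a V W => by simp; ring
    set y := pairPath j k X x (t • unitVec θ) with hy
    have hv : toComplex (t • unitPerp θ) = Complex.I * r θ := by
      rw [toComplex_smul, toComplex_unitPerp, hr]; ring
    have hrr : toComplex (t • unitVec θ) = r θ := by rw [toComplex_smul, toComplex_unitVec]
    have hyj : y j = X + (1 / 2 : ℝ) • (t • unitVec θ) := pairPath_left ..
    have hyk : y k = X - (1 / 2 : ℝ) • (t • unitVec θ) := pairPath_right hjk ..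
    have hyl : ∀ l ∈ J, y l = x l := fun l hl => pairPath_of_ne (hmem l hl).1 (hmem l hl).2 ..
    have e1 : t * ∑ a, unitPerp θ a * ((1 / 2 : ℝ) • (vectorPotential j y - vectorPotential k y)) a
        = (1 / 2) * ∑ a, (t • unitPerp θ) a * vectorPotential j y a -
          (1 / 2) * ∑ a, (t • unitPerp θ) a * vectorPotential k y a := by
      simp only [e, Fin.sum_univ_two, PiLp.smul_apply, smul_eq_mul]; ring
    have hk : k ∈ Finset.univ.erase j := by simp [hjk.symm]
    have hj : j ∈ Finset.univ.erase k := by simp [hjk]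
    rw [e1, sum_mul_vectorPotential, sum_mul_vectorPotential, ← Finset.add_sum_erase _ _ hk,
      ← Finset.add_sum_erase _ _ hj, Finset.erase_right_comm (a := k), ← hJ, hv]
    dsimp only
    -- The mutual terms of the pair are `1` and `-1`. Half their difference is the flux `1` in the
    -- statement.
    have d1 : (Complex.I * r θ / toComplex (y j - y k)).im = 1 := by
      have : toComplex (y j - y k) = r θ := by
        rw [hyj, hyk]; simp only [toComplex_sub, toComplex_add, toComplex_smul _ (t • _), hrr]
        push_cast; ring
      rw [this, mul_div_cancel_right₀ _ (hr0 θ), Complex.I_im]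
    have d2 : (Complex.I * r θ / toComplex (y k - y j)).im = -1 := by
      have : toComplex (y k - y j) = -r θ := by
        rw [hyj, hyk]; simp only [toComplex_sub, toComplex_add, toComplex_smul _ (t • _), hrr]
        push_cast; ring
      rw [this, div_neg, mul_div_cancel_right₀ _ (hr0 θ), Complex.neg_im, Complex.I_im]
    rw [d1, d2]
    have hs : ∀ l ∈ J, (-(2 * Complex.I * (r θ / (2 * w l)) ^ 2) / z l θ).im =
        (1 / 2) * (Complex.I * r θ / toComplex (y j - y l)).im -
        (1 / 2) * (Complex.I * r θ / toComplex (y k - y l)).im := by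
      intro l hl
      have a1 : toComplex (y j - y l) = w l + r θ / 2 := by
        rw [hyj, hyl l hl, hw]
        simp only [toComplex_sub, toComplex_add, toComplex_smul _ (t • _), hrr]
        push_cast; ring
      have a2 : toComplex (y k - y l) = w l - r θ / 2 := by
        rw [hyk, hyl l hl, hw]
        simp only [toComplex_sub, toComplex_smul _ (t • _), hrr]
        push_cast; ring
      have zne := Complex.slitPlane_ne_zero (hslit l hl θ)
      have hzz : z l θ = (w l + r θ / 2) * (w l - r θ / 2) / (w l) ^ 2 := by
        have := hw0 l hl
        simp only [hz]; field_simp; ring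
      have n1 : w l + r θ / 2 ≠ 0 := fun h => zne (by rw [hzz, h]; simp)
      have n2 : w l - r θ / 2 ≠ 0 := fun h => zne (by rw [hzz, h]; simp)
      have hhalf : ∀ c : ℂ, (1 / 2 : ℝ) * c.im = (c / 2).im := fun c => by
        rw [show c / 2 = ((1 / 2 : ℝ) : ℂ) * c by push_cast; ring, Complex.im_ofReal_mul]
      rw [a1, a2, hhalf, hhalf, ← Complex.sub_im]
      congr 1
      rw [hzz]
      have hwl := hw0 l hl
      -- Treating `p = w + r/2` and `q = w - r/2` as independent variables makes the identity a
      -- rational one with denominators `p`, `q` and `p + q`.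
      obtain ⟨p, hp⟩ : ∃ p, p = w l + r θ / 2 := ⟨_, rfl⟩
      obtain ⟨q, hq⟩ : ∃ q, q = w l - r θ / 2 := ⟨_, rfl⟩
      have hwpq : w l = (p + q) / 2 := by rw [hp, hq]; ring
      have hrpq : r θ = p - q := by rw [hp, hq]; ring
      rw [← hp] at n1
      rw [← hq] at n2
      have n3 : p + q ≠ 0 := fun h => hwl (by rw [hwpq, h, zero_div])
      rw [← hp, ← hq, hwpq, hrpq]
      field_simp
      ring
    rw [Finset.sum_congr rfl hs, Finset.sum_sub_distrib, ← Finset.mul_sum, ← Finset.mul_sum]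
    ring

end Anyon
end

noncomputable section

namespace Anyon

variable {N : ℕ}

/-! ### The kinetic energy of a pair -/

theorem measurable_perpInv : Measurable perpInv := by
  unfold perpInv
  fun_prop

theorem measurable_vectorPotential (j : Fin N) : Measurable (vectorPotential j) := by
  unfold vectorPotential
  exact Finset.measurable_sum _ fun k _ => measurable_perpInv.comp (by fun_prop)

theorem IsCore.continuous_partialDeriv {η : Config N → ℂ} (hη : IsCore η) (j : Fin N)
    (a : Fin 2) : Continuous (partialDeriv j a η) := by
  have := hη.smooth.continuous_fderiv (by simp)
  unfold partialDeriv
  fun_prop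

theorem IsCore.measurable_momentum {η : Config N → ℂ} (hη : IsCore η) (α : ℝ) (j : Fin N) :
    Measurable (momentum α j η) := by
  have h1 : ∀ a, Measurable (partialDeriv j a η) := fun a =>
    (hη.continuous_partialDeriv j a).measurable
  have h2 := measurable_vectorPotential j
  have h3 := hη.smooth.continuous.measurable
  unfold momentum
  fun_prop

/-- This supplies the zero at the centre of the relative disc. -/
theorem IsCore.eq_zero_of_eq {η : Config N → ℂ} (hη : IsCore η) {x : Config N} {j k : Fin N}
    (hjk : j ≠ k) (hx : x j = x k) : η x = 0 :=
  image_eq_zero_of_notMem_tsupport fun h => hη.support h j k hjk hx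

/-- The linear map to the configuration with midpoint `x j` and relative coordinate `x k`. -/
def pairLinear (j k : Fin N) : Config N →ₗ[ℝ] Config N where
  toFun x := pairPath j k (x j) x (x k)
  map_add' x y := by
    ext l : 1
    by_cases hj : l = j
    · subst hj; simp [pairPath]; module
    by_cases hk : l = k
    · subst hk; simp [pairPath, hj]; module
    · simp [pairPath, hj, hk]
  map_smul' c x := by
    ext l : 1
    by_cases hj : l = j
    · subst hj; simp [pairPath]; module
    by_cases hk : l = k
    · subst hk; simp [pairPath, hj]; module
    · simp [pairPath, hj, hk]

theorem pairLinear_injective {j k : Fin N} (hjk : j ≠ k) :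
    Function.Injective (pairLinear j k) := by
  rw [← LinearMap.ker_eq_bot, LinearMap.ker_eq_bot']
  intro x hx
  have hl : ∀ l, pairPath j k (x j) x (x k) l = 0 := fun l => congrFun hx l
  have h1 := hl j
  have h2 := hl k
  rw [pairPath_left] at h1
  rw [pairPath_right hjk] at h2
  have hj : x j = 0 := by
    have : x j = (1 / 2 : ℝ) • ((x j + (1 / 2 : ℝ) • x k) + (x j - (1 / 2 : ℝ) • x k)) := by module
    rw [this, h1, h2]; simp
  have hk : x k = 0 := by
    have : x k = (x j + (1 / 2 : ℝ) • x k) - (x j - (1 / 2 : ℝ) • x k) := by module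
    rw [this, h1, h2]; simp
  ext l : 1
  by_cases h : l = j
  · rw [h, hj]; rfl
  by_cases h' : l = k
  · rw [h', hk]; rfl
  · rw [← pairPath_of_ne h h' (x j) x (x k), hl]; rfl

/-- Integral inequalities may be checked along the relative coordinate of a pair. -/
theorem lintegral_le_of_pairPath {j k : Fin N} (hjk : j ≠ k) {f g : Config N → ℝ≥0∞}
    (hf : Measurable f) (hg : Measurable g)
    (h : ∀ X x, ∫⁻ r, f (pairPath j k X x r) ≤ ∫⁻ r, g (pairPath j k X x r)) :
    ∫⁻ x, f x ≤ ∫⁻ x, g x := by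
  have hL : Measurable (pairLinear (N := N) j k) :=
    (LinearMap.continuous_of_finiteDimensional _).measurable
  -- The Jacobian need not be computed: it is a nonzero constant and cancels from both sides.
  have hdet : LinearMap.det (pairLinear (N := N) j k) ≠ 0 := by
    have := (LinearMap.isUnit_iff_ker_eq_bot _).2 (LinearMap.ker_eq_bot.2 (pairLinear_injective hjk))
    exact (LinearMap.isUnit_det _ this).ne_zero
  have hmap := Measure.map_linearMap_addHaar_eq_smul_addHaar (volume : Measure (Config N)) hdet
  have hcomp : ∫⁻ x, f (pairLinear j k x) ≤ ∫⁻ x, g (pairLinear j k x) := by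
    refine lintegral_le_of_lmarginal_le (μ := fun _ => (volume : Measure Plane)) {k} (hf.comp hL)
      (hg.comp hL) ?_
    intro x
    rw [lmarginal_singleton, lmarginal_singleton]
    have e : ∀ r, pairLinear j k (Function.update x k r) = pairPath j k (x j) x r := by
      intro r
      show pairPath j k _ _ _ = _
      rw [Function.update_of_ne hjk, Function.update_self]
      ext l : 1
      by_cases hj : l = j <;> by_cases hk : l = k <;> simp [pairPath, hj, hk]
    simp only [e]
    exact h _ _
  rw [← lintegral_map hf hL, ← lintegral_map hg hL, hmap, lintegral_smul_measure,
    lintegral_smul_measure, smul_eq_mul, smul_eq_mul] at hcomp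
  refine (ENNReal.mul_le_mul_iff_right ?_ ENNReal.ofReal_ne_top).1 hcomp
  simpa using hdet

theorem pairPath_eq_add (j k : Fin N) (hjk : j ≠ k) (X : Plane) (x : Config N) (r : Plane) :
    pairPath j k X x r = pairPath j k X x 0 +
      (1 / 2 : ℝ) • (ContinuousLinearMap.single ℝ (fun _ : Fin N => Plane) j -
        ContinuousLinearMap.single ℝ (fun _ : Fin N => Plane) k) r := by
  ext l : 1
  by_cases hj : l = j
  · subst hj; simp [pairPath, hjk]
  by_cases hk : l = k
  · subst hk; simp [pairPath, hjk.symm, sub_eq_add_neg]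
  · simp [pairPath, hj, hk]

theorem hasFDerivAt_pairPath {j k : Fin N} (hjk : j ≠ k) (X : Plane) (x : Config N) (r : Plane) :
    HasFDerivAt (pairPath j k X x)
      ((1 / 2 : ℝ) • (ContinuousLinearMap.single ℝ (fun _ : Fin N => Plane) j -
        ContinuousLinearMap.single ℝ (fun _ : Fin N => Plane) k)) r := by
  have : pairPath j k X x = fun r => pairPath j k X x 0 +
      ((1 / 2 : ℝ) • (ContinuousLinearMap.single ℝ (fun _ : Fin N => Plane) j -
        ContinuousLinearMap.single ℝ (fun _ : Fin N => Plane) k)) r := by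
    ext r : 1
    exact pairPath_eq_add j k hjk X x r
  rw [this]
  exact (ContinuousLinearMap.hasFDerivAt _).const_add _

theorem contDiff_pairPath (j k : Fin N) (X : Plane) (x : Config N) :
    ContDiff ℝ ∞ (pairPath j k X x) := by
  rw [contDiff_pi]
  intro l
  unfold pairPath
  split_ifs <;> fun_prop

/-- This converts the energy in the relative coordinate into the energies of the two particles, and
the factor `1/2` lowers `δ² / 2` to `δ² / 4`. -/
theorem enorm_half_sub_sq_le (u v : EuclideanSpace ℂ (Fin 2)) :
    ‖(1 / 2 : ℝ) • (u - v)‖ₑ ^ 2 ≤ ENNReal.ofReal (1 / 2) * (‖u‖ₑ ^ 2 + ‖v‖ₑ ^ 2) := by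
  simp only [← ofReal_norm, ← ENNReal.ofReal_pow (norm_nonneg _)]
  rw [← ENNReal.ofReal_add (by positivity) (by positivity), ← ENNReal.ofReal_mul (by norm_num)]
  apply ENNReal.ofReal_le_ofReal
  rw [norm_smul, mul_pow, Real.norm_of_nonneg (by norm_num)]
  have h := norm_sub_le u v
  nlinarith [sq_nonneg (‖u‖ - ‖v‖), norm_nonneg (u - v), norm_nonneg u, norm_nonneg v,
    pow_le_pow_left₀ (norm_nonneg _) h 2]

/-- Two particles at distance less than `δ`, with no other particle in the disc around them, have
kinetic energy at least of order `α / δ²`. -/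
theorem IsCore.pair_bound {η : Config N → ℂ} (hη : IsCore η) {α δ : ℝ} (h0 : 0 ≤ α) (h1 : α ≤ 1)
    (hδ : 0 ≤ δ) {j k : Fin N} (hjk : j ≠ k) {A : Set (Config N)} (hA : MeasurableSet A)
    (hdist : ∀ X x r, pairPath j k X x r ∈ A → ‖r‖ < δ)
    (hother : ∀ X x r, pairPath j k X x r ∈ A → ∀ l, l ≠ j → l ≠ k → δ / 2 ≤ ‖X - x l‖)
    (hmove : ∀ X x r r', pairPath j k X x r ∈ A → ‖r'‖ < δ → pairPath j k X x r' ∈ A) :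
    ENNReal.ofReal α * ∫⁻ x in A, ‖η x‖ₑ ^ 2 ≤ ENNReal.ofReal (δ ^ 2 / 4) *
      ∫⁻ x in A, (‖momentum α j η x‖ₑ ^ 2 + ‖momentum α k η x‖ₑ ^ 2) := by
  have hηm := hη.smooth.continuous.measurable
  have hDj := hη.measurable_momentum α j
  have hDk := hη.measurable_momentum α k
  rw [← lintegral_const_mul' _ _ ENNReal.ofReal_ne_top,
    ← lintegral_const_mul' _ _ ENNReal.ofReal_ne_top, ← lintegral_indicator hA,
    ← lintegral_indicator hA]
  refine lintegral_le_of_pairPath hjk (by fun_prop (disch := assumption))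
    (by fun_prop (disch := assumption)) fun X x => ?_
  by_cases hex : ∃ r, pairPath j k X x r ∈ A
  swap
  · have : ∀ f : Config N → ℝ≥0∞, ∀ r, A.indicator f (pairPath j k X x r) = 0 := fun f r =>
      Set.indicator_of_notMem (fun h => hex ⟨r, h⟩) _
    simp [this]
  obtain ⟨r₀, hr₀⟩ := hex
  -- By `hdist` and `hmove`, a nonempty fibre of `A` in the relative coordinate is the entire open
  -- disc of radius `δ`.
  have hset : ∀ r, pairPath j k X x r ∈ A ↔ r ∈ {r : Plane | ‖r‖ < δ} := fun r =>
    ⟨hdist X x r, hmove X x r₀ r hr₀⟩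
  have hball : MeasurableSet {r : Plane | ‖r‖ < δ} := measurableSet_lt measurable_norm measurable_const
  have hind : ∀ f : Config N → ℝ≥0∞, ∫⁻ r, A.indicator f (pairPath j k X x r) =
      ∫⁻ r in {r : Plane | ‖r‖ < δ}, f (pairPath j k X x r) := fun f => by
    rw [← lintegral_indicator hball]
    refine lintegral_congr fun r => ?_
    by_cases h : pairPath j k X x r ∈ A
    · rw [Set.indicator_of_mem h, Set.indicator_of_mem ((hset r).1 h)]
    · rw [Set.indicator_of_notMem h, Set.indicator_of_notMem fun h' => h ((hset r).2 h')]
  rw [hind, hind, lintegral_const_mul' _ _ ENNReal.ofReal_ne_top,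
    lintegral_const_mul' _ _ ENNReal.ofReal_ne_top]
  have hpm : Measurable (pairPath j k X x) := (contDiff_pairPath j k X x).continuous.measurable
  -- At fixed midpoint the relative gradient is `(∇_j - ∇_k) / 2`, so the covariant derivative in
  -- `r` is half the difference of the two momenta.
  have hder : ∀ r a, fderiv ℝ (fun r => η (pairPath j k X x r)) r (EuclideanSpace.single a 1) =
      (1 / 2) * (partialDeriv j a η (pairPath j k X x r) -
        partialDeriv k a η (pairPath j k X x r)) := fun r a => by
    have h := ((hη.smooth.differentiable (by simp) (pairPath j k X x r)).hasFDerivAt.comp r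
      (hasFDerivAt_pairPath hjk X x r)).fderiv
    have h' : fderiv ℝ (fun r => η (pairPath j k X x r)) r = _ := h
    rw [h']
    simp [partialDeriv]
  have main := disc_bound (α := α) (δ := δ) (F := fun r => η (pairPath j k X x r))
    (A := fun r => (1 / 2 : ℝ) • (vectorPotential j (pairPath j k X x r) -
      vectorPotential k (pairPath j k X x r)))
    (G := fun r => (1 / 2 : ℝ) • (momentum α j η (pairPath j k X x r) -
      momentum α k η (pairPath j k X x r))) h0 h1 hδ
    ((hη.smooth.comp (contDiff_pairPath j k X x)).of_le (by simp)) ?_ ?_ ?_ ?_ ?_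
  · refine main.trans ?_
    have : ENNReal.ofReal (δ ^ 2 / 4) = ENNReal.ofReal (δ ^ 2 / 2) * ENNReal.ofReal (1 / 2) := by
      rw [← ENNReal.ofReal_mul (by positivity)]; congr 1; ring
    rw [this, mul_assoc, ← lintegral_const_mul' (ENNReal.ofReal (1 / 2)) _ ENNReal.ofReal_ne_top]
    exact mul_le_mul_right (lintegral_mono fun r => enorm_half_sub_sq_le _ _) _
  · refine hη.eq_zero_of_eq hjk ?_
    rw [pairPath_left, pairPath_right hjk]; simp
  · intro r
    -- Exchanging the particles replaces `r` by `-r`, so permutation symmetry becomes evenness.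
    rw [← hη.symmetric (Equiv.swap j k)]
    congr 1
    ext l : 1
    by_cases hj : l = j
    · subst hj
      simp only [Function.comp_apply, Equiv.swap_apply_left, pairPath_left, pairPath_right hjk]
      module
    by_cases hk : l = k
    · subst hk
      simp only [Function.comp_apply, Equiv.swap_apply_right, pairPath_left, pairPath_right hjk]
      module
    · simp only [Function.comp_apply, Equiv.swap_apply_of_ne_of_ne hj hk, pairPath_of_ne hj hk]
  · exact ((hDj.comp hpm).sub (hDk.comp hpm)).const_smul (1 / 2 : ℝ)
  · intro r a _ _
    rw [hder]
    simp [momentum]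
    ring
  · intro t ht htδ
    refine exists_gauge hjk ht fun l hj hk => ?_
    have := hother X x r₀ hr₀ l hj hk
    linarith

end Anyon
end

noncomputable section

namespace Anyon

variable {N : ℕ}

/-! ### One-dimensional slices -/

/-- The point of the plane whose coordinate `a` is `s` and whose other coordinate is `t`. -/
def slicePoint (a : Fin 2) (s t : ℝ) : Plane := if a = 0 then !₂[s, t] else !₂[t, s]

@[simp] theorem slicePoint_self (a : Fin 2) (s t : ℝ) : slicePoint a s t a = s := by
  fin_cases a <;> simp [slicePoint]

theorem slicePoint_of_ne {a b : Fin 2} (hab : b ≠ a) (s t : ℝ) : slicePoint a s t b = t := by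
  fin_cases a <;> fin_cases b <;> simp_all [slicePoint]

theorem slicePoint_eq_add (a : Fin 2) (s t : ℝ) :
    slicePoint a s t = slicePoint a 0 t + s • (EuclideanSpace.single a 1 : Plane) := by
  ext b
  fin_cases a <;> fin_cases b <;> simp [slicePoint]

@[fun_prop]
theorem measurable_slicePoint (a : Fin 2) :
    Measurable fun p : ℝ × ℝ => slicePoint a p.1 p.2 := by
  unfold slicePoint
  split_ifs <;> fun_prop

theorem lintegral_slice {f : Plane → ℝ≥0∞} (hf : Measurable f) (a : Fin 2) :
    ∫⁻ z, f z = ∫⁻ t, ∫⁻ s, f (slicePoint a s t) := by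
  rw [lintegral_plane, Measure.volume_eq_prod]
  have hm : Measurable fun p : ℝ × ℝ => f !₂[p.1, p.2] := hf.comp measurable_toPlane
  fin_cases a
  · rw [lintegral_prod_symm _ hm.aemeasurable]
    simp [slicePoint]
  · rw [lintegral_prod _ hm.aemeasurable]
    simp [slicePoint]

theorem lintegral_le_of_slice (j : Fin N) (a : Fin 2) {f g : Config N → ℝ≥0∞}
    (hf : Measurable f) (hg : Measurable g)
    (h : ∀ x t, ∫⁻ s, f (Function.update x j (slicePoint a s t)) ≤
      ∫⁻ s, g (Function.update x j (slicePoint a s t))) :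
    ∫⁻ x, f x ≤ ∫⁻ x, g x := by
  refine lintegral_le_of_lmarginal_le (μ := fun _ => (volume : Measure Plane)) {j} hf hg ?_
  intro x
  rw [lmarginal_singleton, lmarginal_singleton]
  dsimp only
  rw [lintegral_slice (f := fun z => f (Function.update x j z)) (hf.comp (measurable_update x)) a,
    lintegral_slice (f := fun z => g (Function.update x j z)) (hg.comp (measurable_update x)) a]
  exact lintegral_mono fun t => h x t

/-- The fundamental theorem of calculus for `|η|²` along one coordinate of one particle. -/
theorem IsCore.slice_bound {η : Config N → ℂ} (hη : IsCore η) (α : ℝ) (j : Fin N) (a : Fin 2)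
    (x : Config N) (t : ℝ) {I : Set ℝ} {s s' : ℝ} (hI : Set.uIoc s s' ⊆ I) :
    ‖η (Function.update x j (slicePoint a s' t))‖ₑ ^ 2 ≤
      ‖η (Function.update x j (slicePoint a s t))‖ₑ ^ 2 +
      ∫⁻ τ in I, 2 * (‖η (Function.update x j (slicePoint a τ t))‖ₑ *
        ‖momentum α j η (Function.update x j (slicePoint a τ t))‖ₑ) := by
  set γ : ℝ → Config N := fun τ => Function.update x j (slicePoint a τ t) with hγ
  have hγ' : ∀ τ, HasDerivAt γ (Pi.single j (EuclideanSpace.single a 1)) τ := by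
    intro τ
    rw [hasDerivAt_pi]
    intro l
    by_cases hl : l = j
    · subst hl
      simp only [hγ, Function.update_self, Pi.single_eq_same]
      have : (fun τ => slicePoint a τ t) = fun τ => slicePoint a 0 t +
          τ • (EuclideanSpace.single a 1 : Plane) := by
        ext τ : 1; exact slicePoint_eq_add a τ t
      rw [this]
      exact (((hasDerivAt_id τ).smul_const _).const_add _).congr_deriv (by simp)
    · simp only [hγ, Function.update_of_ne hl, Pi.single_eq_of_ne hl]
      exact hasDerivAt_const _ _
  have hγc : Continuous γ := continuous_iff_continuousAt.2 fun τ => (hγ' τ).continuousAt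
  have hu : ∀ τ, HasDerivAt (fun τ => η (γ τ)) (partialDeriv j a η (γ τ)) τ := fun τ =>
    (hη.smooth.differentiable (by simp) (γ τ)).hasFDerivAt.comp_hasDerivAt τ (hγ' τ)
  refine enorm_sq_le_add_lintegral hu ((hη.continuous_partialDeriv j a).comp hγc) hI fun τ _ => ?_
  have h := abs_two_mul_re_conj_mul_le (η (γ τ)) (partialDeriv j a η (γ τ))
    (α * vectorPotential j (γ τ) a)
  have h2 : ‖-Complex.I * partialDeriv j a η (γ τ) +
      ((α * vectorPotential j (γ τ) a : ℝ) : ℂ) * η (γ τ)‖ ≤ ‖momentum α j η (γ τ)‖ := by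
    refine le_trans (le_of_eq ?_) (PiLp.norm_apply_le (momentum α j η (γ τ)) a)
    simp [momentum]
  refine (ENNReal.ofReal_le_ofReal (h.trans (mul_le_mul_of_nonneg_left
    (mul_le_mul_of_nonneg_left h2 (norm_nonneg _)) zero_le_two))).trans_eq ?_
  rw [ENNReal.ofReal_mul zero_le_two, ENNReal.ofReal_mul (norm_nonneg _), ofReal_norm, ofReal_norm]
  simp [hγ]

/-! ### Poincaré inequality on an interval -/

theorem volume_mul_le_of_le_add {v : ℝ → ℝ≥0∞} {c : ℝ≥0∞} {J : Set ℝ} (hJ : MeasurableSet J)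
    {y : ℝ≥0∞} (h : ∀ s ∈ J, y ≤ v s + c) :
    volume J * y ≤ (∫⁻ s in J, v s) + volume J * c := by
  calc volume J * y = ∫⁻ _ in J, y := by rw [setLIntegral_const, mul_comm]
    _ ≤ ∫⁻ s in J, (v s + c) := setLIntegral_mono' hJ h
    _ = _ := by rw [lintegral_add_right _ measurable_const, setLIntegral_const, mul_comm c]

/-- The coefficient `1/2` in front of `p²` is what allows this term to be absorbed into the
left-hand side of the Poincaré inequality. -/
theorem two_mul_mul_mul_le (ℓ : ℝ≥0∞) (p q : ℝ≥0∞) :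
    ℓ * (2 * (p * q)) ≤ 2⁻¹ * p ^ 2 + 2 * ℓ ^ 2 * q ^ 2 := by
  have h : 2 * (p * (2 * ℓ * q)) ≤ p ^ 2 + (2 * ℓ * q) ^ 2 := by
    rcases eq_or_ne p ⊤ with rfl | hp
    · simp
    rcases eq_or_ne (2 * ℓ * q) ⊤ with hr | hr
    · rw [hr]; simp
    lift p to NNReal using hp
    lift 2 * ℓ * q to NNReal using hr with r
    norm_cast
    rw [← mul_assoc]
    exact two_mul_le_add_sq p r
  calc ℓ * (2 * (p * q)) = (2⁻¹ * 2) * (ℓ * (2 * (p * q))) := by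
        rw [ENNReal.inv_mul_cancel two_ne_zero ENNReal.ofNat_ne_top, one_mul]
    _ = 2⁻¹ * (2 * (p * (2 * ℓ * q))) := by ring
    _ ≤ 2⁻¹ * (p ^ 2 + (2 * ℓ * q) ^ 2) := by gcongr
    _ = _ := by
      rw [mul_add]
      congr 1
      calc 2⁻¹ * (2 * ℓ * q) ^ 2 = (2⁻¹ * 2) * (2 * ℓ ^ 2 * q ^ 2) := by ring
        _ = _ := by rw [ENNReal.inv_mul_cancel two_ne_zero ENNReal.ofNat_ne_top, one_mul]

/-- A Poincaré inequality on an interval, for functions whose square has derivative at most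
`2 p q`. -/
theorem poincare_interval {p q : ℝ → ℝ≥0∞} (hp : Measurable p) {I J : Set ℝ}
    (hI : MeasurableSet I) (hJ : MeasurableSet J) (hJI : J ⊆ I) (hI0 : volume I ≠ 0)
    (hItop : volume I ≠ ⊤) (hvol : volume I ≤ 8 * volume J)
    (hfin : ∫⁻ s in I, p s ^ 2 ≠ ⊤)
    (h : ∀ s ∈ I, ∀ s' ∈ I, p s' ^ 2 ≤ p s ^ 2 + ∫⁻ τ in I, 2 * (p τ * q τ)) :
    ∫⁻ s in I, p s ^ 2 ≤ 16 * (∫⁻ s in J, p s ^ 2) + 4 * volume I ^ 2 * ∫⁻ s in I, q s ^ 2 := by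
  set L := volume I
  set μ := volume J with hμ
  have hμ0 : μ ≠ 0 := fun h0 => hI0 (by simpa [h0] using hvol)
  have hμt : μ ≠ ⊤ := (measure_mono hJI).trans_lt (lt_top_iff_ne_top.2 hItop) |>.ne
  set K := ∫⁻ τ in I, 2 * (p τ * q τ)
  -- The value at `s'` is compared with its average over `J`. The hypothesis `hvol` then bounds `L /
  -- μ` by `8`.
  have h1 : ∀ s' ∈ I, μ * p s' ^ 2 ≤ (∫⁻ s in J, p s ^ 2) + μ * K := fun s' hs' =>
    volume_mul_le_of_le_add hJ fun s hs => h s (hJI hs) s' hs'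
  have h2 : μ * ∫⁻ s in I, p s ^ 2 ≤ μ * (8 * (∫⁻ s in J, p s ^ 2) + L * K) := by
    calc μ * ∫⁻ s in I, p s ^ 2 = ∫⁻ s in I, μ * p s ^ 2 :=
          (lintegral_const_mul' _ _ hμt).symm
      _ ≤ ∫⁻ _ in I, ((∫⁻ s in J, p s ^ 2) + μ * K) := setLIntegral_mono' hI h1
      _ = L * (∫⁻ s in J, p s ^ 2) + L * (μ * K) := by rw [setLIntegral_const]; ring
      _ ≤ (8 * μ) * (∫⁻ s in J, p s ^ 2) + L * (μ * K) := by gcongr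
      _ = _ := by ring
  have h3 : ∫⁻ s in I, p s ^ 2 ≤ 8 * (∫⁻ s in J, p s ^ 2) + L * K :=
    (ENNReal.mul_le_mul_iff_right hμ0 hμt).1 h2
  have h4 : L * K ≤ 2⁻¹ * (∫⁻ s in I, p s ^ 2) + 2 * L ^ 2 * ∫⁻ s in I, q s ^ 2 := by
    rw [← lintegral_const_mul' _ _ hItop, ← lintegral_const_mul' _ _ (by finiteness),
      ← lintegral_const_mul' _ _ (by finiteness),
      ← lintegral_add_left (by fun_prop : Measurable fun s => 2⁻¹ * p s ^ 2)]
    exact lintegral_mono fun s => two_mul_mul_mul_le _ _ _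
  set P := ∫⁻ s in I, p s ^ 2
  set B := 8 * (∫⁻ s in J, p s ^ 2) + 2 * L ^ 2 * ∫⁻ s in I, q s ^ 2 with hB
  have h5 : P ≤ B + 2⁻¹ * P := by
    refine h3.trans ((add_le_add_right h4 _).trans_eq ?_)
    rw [hB]; ring
  have h6 : P ≤ 2 * B := by
    -- Half of `P` is cancelled, which requires `hfin`. Doubling what remains turns the constants
    -- `8` and `2` into `16` and `4`.
    have hhalf : P = 2⁻¹ * P + 2⁻¹ * P := by
      rw [← add_mul, ENNReal.inv_two_add_inv_two, one_mul]
    have hne : 2⁻¹ * P ≠ ⊤ := ENNReal.mul_ne_top (by simp) hfin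
    have : 2⁻¹ * P ≤ B := by
      rw [hhalf] at h5
      exact (ENNReal.add_le_add_iff_right hne).1 (h5.trans_eq (by rw [← hhalf]))
    calc P = 2 * (2⁻¹ * P) := by
          rw [← mul_assoc, ENNReal.mul_inv_cancel two_ne_zero ENNReal.ofNat_ne_top, one_mul]
      _ ≤ 2 * B := by gcongr
  refine h6.trans_eq ?_
  rw [hB]; ring

/-! ### The Poincaré inequality for one particle in a square -/

/-- The half-open square with lower left corner `c` and side `ℓ`. -/
def square (c : Plane) (ℓ : ℝ) : Set Plane := {z | ∀ a, z a ∈ Set.Ico (c a) (c a + ℓ)}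

theorem measurableSet_square (c : Plane) (ℓ : ℝ) : MeasurableSet (square c ℓ) := by
  unfold square
  rw [show {z : Plane | ∀ a, z a ∈ Set.Ico (c a) (c a + ℓ)} =
    ⋂ a, (fun z : Plane => z a) ⁻¹' Set.Ico (c a) (c a + ℓ) by ext; simp]
  exact MeasurableSet.iInter fun a => measurableSet_Ico.preimage (by fun_prop)

theorem IsCore.enorm_bounded {η : Config N → ℂ} (hη : IsCore η) :
    ∃ C : ℝ≥0∞, C ≠ ⊤ ∧ ∀ x, ‖η x‖ₑ ≤ C := by
  obtain ⟨C, hC⟩ := hη.smooth.continuous.bounded_above_of_compact_support hη.compact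
  exact ⟨ENNReal.ofReal C, ENNReal.ofReal_ne_top, fun x => by
    rw [← ofReal_norm]; exact ENNReal.ofReal_le_ofReal (hC x)⟩

/-- The Poincaré inequality along one coordinate of one particle. -/
theorem IsCore.poincare_coord {η : Config N → ℂ} (hη : IsCore η) (α : ℝ) (j : Fin N) (a : Fin 2)
    {I J : Set ℝ} (hI : MeasurableSet I) (hJ : MeasurableSet J) (hIc : I.OrdConnected)
    (hJI : J ⊆ I) (hI0 : volume I ≠ 0) (hItop : volume I ≠ ⊤) (hvol : volume I ≤ 8 * volume J)
    {A : Set (Config N)} (hA : MeasurableSet A) (hAI : ∀ x ∈ A, x j a ∈ I)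
    (hAu : ∀ x s s' t, Function.update x j (slicePoint a s t) ∈ A → s' ∈ I →
      Function.update x j (slicePoint a s' t) ∈ A) :
    ∫⁻ x in A, ‖η x‖ₑ ^ 2 ≤ 16 * (∫⁻ x in A ∩ {x | x j a ∈ J}, ‖η x‖ₑ ^ 2) +
      4 * volume I ^ 2 * ∫⁻ x in A, ‖momentum α j η x‖ₑ ^ 2 := by
  have hηm := hη.smooth.continuous.measurable
  have hDm := hη.measurable_momentum α j
  have hAJ : MeasurableSet (A ∩ {x : Config N | x j a ∈ J}) :=
    hA.inter (hJ.preimage (by fun_prop : Measurable fun x : Config N => x j a))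
  have hη2 : Measurable fun x => ‖η x‖ₑ ^ 2 := by fun_prop
  have hD2 : Measurable fun x => ‖momentum α j η x‖ₑ ^ 2 := by fun_prop
  rw [← lintegral_indicator hA, ← lintegral_indicator hA, ← lintegral_indicator hAJ,
    ← lintegral_const_mul' _ _ (by finiteness), ← lintegral_const_mul' _ _ (by finiteness),
    ← lintegral_add_left ((hη2.indicator hAJ).const_mul _)]
  refine lintegral_le_of_slice j a (hη2.indicator hA)
    (((hη2.indicator hAJ).const_mul _).add ((hD2.indicator hA).const_mul _)) fun x t => ?_
  have hγ : Measurable fun s => Function.update x j (slicePoint a s t) :=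
    (measurable_update x).comp
      ((measurable_slicePoint a).comp (by fun_prop : Measurable fun s : ℝ => (s, t)))
  by_cases hex : ∃ s, Function.update x j (slicePoint a s t) ∈ A
  swap
  · have : ∀ s, A.indicator (fun x => ‖η x‖ₑ ^ 2) (Function.update x j (slicePoint a s t)) = 0 :=
      fun s => Set.indicator_of_notMem (fun h => hex ⟨s, h⟩) _
    simp [this]
  obtain ⟨s₀, hs₀⟩ := hex
  have hset : ∀ s, Function.update x j (slicePoint a s t) ∈ A ↔ s ∈ I := fun s =>
    ⟨fun h => by simpa using hAI _ h, hAu x s₀ s t hs₀⟩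
  have hset' : ∀ s, Function.update x j (slicePoint a s t) ∈ A ∩ {x : Config N | x j a ∈ J} ↔
      s ∈ J := fun s => by
    rw [Set.mem_inter_iff, hset]
    simpa using fun h => hJI h
  have hind : ∀ (B : Set (Config N)) (K : Set ℝ) (f : Config N → ℝ≥0∞) (s : ℝ),
      (Function.update x j (slicePoint a s t) ∈ B ↔ s ∈ K) →
      B.indicator f (Function.update x j (slicePoint a s t)) =
        K.indicator (fun s => f (Function.update x j (slicePoint a s t))) s := by
    intro B K f s h
    by_cases hs : s ∈ K
    · rw [Set.indicator_of_mem hs, Set.indicator_of_mem (h.2 hs)]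
    · rw [Set.indicator_of_notMem hs, Set.indicator_of_notMem fun h' => hs (h.1 h')]
  have e1 := fun f s => hind A I f s (hset s)
  have e2 := fun f s => hind _ J f s (hset' s)
  simp only [e1, e2]
  have hηγ : Measurable fun s => ‖η (Function.update x j (slicePoint a s t))‖ₑ ^ 2 := hη2.comp hγ
  rw [lintegral_add_left ((hηγ.indicator hJ).const_mul _),
    lintegral_const_mul' _ _ (by finiteness), lintegral_const_mul' _ _ (by finiteness),
    lintegral_indicator hI, lintegral_indicator hI, lintegral_indicator hJ]
  refine poincare_interval (p := fun s => ‖η (Function.update x j (slicePoint a s t))‖ₑ)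
    (hηm.comp hγ).enorm hI hJ hJI hI0 hItop hvol ?_ fun s hs s' hs' => ?_
  · obtain ⟨C, hC, hb⟩ := hη.enorm_bounded
    refine ne_top_of_le_ne_top (b := C ^ 2 * volume I) (by finiteness) ?_
    rw [← setLIntegral_const]
    exact lintegral_mono fun s => by gcongr; exact hb _
  · exact hη.slice_bound α j a x t (Set.uIoc_subset_uIcc.trans (hIc.uIcc_subset hs hs'))

/-- The Poincaré inequality for one particle in a square. -/
theorem IsCore.poincare_square {η : Config N → ℂ} (hη : IsCore η) (α : ℝ) (j : Fin N)
    {c c' : Plane} {ℓ ℓ' : ℝ} (hℓ : 0 < ℓ) (hℓ' : ℓ ≤ 8 * ℓ') (hsub : ∀ a, c a ≤ c' a)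
    (hsub' : ∀ a, c' a + ℓ' ≤ c a + ℓ) {A : Set (Config N)} (hA : MeasurableSet A)
    (hAQ : ∀ x ∈ A, x j ∈ square c ℓ)
    (hAu : ∀ x ∈ A, ∀ z ∈ square c ℓ, Function.update x j z ∈ A) :
    ∫⁻ x in A, ‖η x‖ₑ ^ 2 ≤ 256 * ((∫⁻ x in A ∩ {x | x j ∈ square c' ℓ'}, ‖η x‖ₑ ^ 2) +
      ENNReal.ofReal ℓ ^ 2 * ∫⁻ x in A, ‖momentum α j η x‖ₑ ^ 2) := by
  have hI : ∀ a, volume (Set.Ico (c a) (c a + ℓ)) = ENNReal.ofReal ℓ := fun a => by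
    rw [Real.volume_Ico]; congr 1; ring
  have hJ : ∀ a, volume (Set.Ico (c' a) (c' a + ℓ')) = ENNReal.ofReal ℓ' := fun a => by
    rw [Real.volume_Ico]; congr 1; ring
  have hvol : ∀ a, volume (Set.Ico (c a) (c a + ℓ)) ≤ 8 * volume (Set.Ico (c' a) (c' a + ℓ')) := by
    intro a
    rw [hI, hJ, ← ENNReal.ofReal_ofNat 8, ← ENNReal.ofReal_mul (by norm_num)]
    exact ENNReal.ofReal_le_ofReal hℓ'
  have hJI : ∀ a, Set.Ico (c' a) (c' a + ℓ') ⊆ Set.Ico (c a) (c a + ℓ) := fun a =>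
    Set.Ico_subset_Ico (hsub a) (hsub' a)
  have hI0 : ∀ a, volume (Set.Ico (c a) (c a + ℓ)) ≠ 0 := fun a => by rw [hI]; simpa using hℓ
  have hIt : ∀ a, volume (Set.Ico (c a) (c a + ℓ)) ≠ ⊤ := fun a => by rw [hI]; finiteness
  -- The coordinates are confined one after the other. `A'` restricts only coordinate `0`, so
  -- coordinate `1` can still move freely.
  set A' := A ∩ {x : Config N | x j 0 ∈ Set.Ico (c' 0) (c' 0 + ℓ')} with hA'
  have hA'm : MeasurableSet A' := hA.inter
    (measurableSet_Ico.preimage (by fun_prop : Measurable fun x : Config N => x j 0))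
  have hcoord : ∀ a x s s' t, Function.update x j (slicePoint a s t) ∈ A →
      s' ∈ Set.Ico (c a) (c a + ℓ) → Function.update x j (slicePoint a s' t) ∈ A := by
    intro a x s s' t hx hs'
    have := hAu _ hx (slicePoint a s' t) fun b => ?_
    · simpa using this
    · by_cases hb : b = a
      · subst hb; simpa using hs'
      · have h := hAQ _ hx b
        rw [Function.update_self, slicePoint_of_ne hb] at h
        rwa [slicePoint_of_ne hb]
  have h1 := hη.poincare_coord α j 0 measurableSet_Ico measurableSet_Ico Set.ordConnected_Ico
    (hJI 0) (hI0 0) (hIt 0) (hvol 0) hA (fun x hx => hAQ x hx 0) (hcoord 0)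
  have h2 := hη.poincare_coord α j 1 measurableSet_Ico measurableSet_Ico Set.ordConnected_Ico
    (hJI 1) (hI0 1) (hIt 1) (hvol 1) hA'm (fun x hx => hAQ x hx.1 1) (fun x s s' t hx hs' =>
      ⟨hcoord 1 x s s' t hx.1 hs', by
        have := hx.2
        simp only [Set.mem_ofPred_eq, Function.update_self,
          slicePoint_of_ne (show (0 : Fin 2) ≠ 1 by decide)] at this ⊢
        exact this⟩)
  rw [hI] at h1 h2
  have hset : A' ∩ {x : Config N | x j 1 ∈ Set.Ico (c' 1) (c' 1 + ℓ')} =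
      A ∩ {x | x j ∈ square c' ℓ'} := by
    ext x
    simp [hA', square, Fin.forall_fin_two, and_assoc]
  rw [hset] at h2
  have h3 : ∫⁻ x in A', ‖momentum α j η x‖ₑ ^ 2 ≤ ∫⁻ x in A, ‖momentum α j η x‖ₑ ^ 2 :=
    lintegral_mono_set Set.inter_subset_left
  set T := ∫⁻ x in A, ‖momentum α j η x‖ₑ ^ 2
  set P := ∫⁻ x in A ∩ {x | x j ∈ square c' ℓ'}, ‖η x‖ₑ ^ 2
  -- The constants are `16² = 256` and `16 · 4 + 4 = 68`, the latter rounded up to `256`.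
  calc _ ≤ 16 * (16 * P + 4 * ENNReal.ofReal ℓ ^ 2 * T) + 4 * ENNReal.ofReal ℓ ^ 2 * T := by
        refine h1.trans ?_
        gcongr
        refine h2.trans ?_
        gcongr
    _ = 256 * P + 68 * (ENNReal.ofReal ℓ ^ 2 * T) := by ring
    _ ≤ 256 * P + 256 * (ENNReal.ofReal ℓ ^ 2 * T) := by gcongr; norm_num
    _ = _ := by ring

end Anyon
end

noncomputable section

namespace Anyon

variable {N : ℕ}

/-! ### Local exclusion -/

/-- A set of configurations, with exactly the particles in `S` inside the region `Q`, which does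
not restrict the positions of these particles within `Q`. -/
structure IsSector (Q : Set Plane) (S : Finset (Fin N)) (A : Set (Config N)) : Prop where
  measurableSet : MeasurableSet A
  mem_iff : ∀ x ∈ A, ∀ j, x j ∈ Q ↔ j ∈ S
  update_mem : ∀ x ∈ A, ∀ j ∈ S, ∀ z ∈ Q, Function.update x j z ∈ A

theorem measurableSet_forall_mem_square (U : Finset (Fin N)) (c : Fin N → Plane)
    (ℓ : Fin N → ℝ) : MeasurableSet {x : Config N | ∀ l ∈ U, x l ∈ square (c l) (ℓ l)} := by
  rw [show {x : Config N | ∀ l ∈ U, x l ∈ square (c l) (ℓ l)} =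
    ⋂ l ∈ U, (fun x : Config N => x l) ⁻¹' square (c l) (ℓ l) by ext; simp]
  exact Finset.measurableSet_biInter _ fun l _ =>
    (measurableSet_square _ _).preimage (measurable_pi_apply l)

/-- Iterating the Poincaré inequality, the particles in a square are moved to subsquares. -/
theorem IsCore.localize {η : Config N → ℂ} (hη : IsCore η) (α : ℝ) {c : Plane} {ℓ : ℝ}
    (hℓ : 0 < ℓ) {S : Finset (Fin N)} {A : Set (Config N)} (hA : IsSector (square c ℓ) S A)
    {c' : Fin N → Plane} {ℓ' : Fin N → ℝ} (hℓ' : ∀ l, ℓ ≤ 8 * ℓ' l) (hsub : ∀ l a, c a ≤ c' l a)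
    (hsub' : ∀ l a, c' l a + ℓ' l ≤ c a + ℓ) (U : Finset (Fin N)) (hU : U ⊆ S) :
    ∫⁻ x in A, ‖η x‖ₑ ^ 2 ≤ 256 ^ U.card *
      ((∫⁻ x in A ∩ {x | ∀ l ∈ U, x l ∈ square (c' l) (ℓ' l)}, ‖η x‖ₑ ^ 2) +
        ENNReal.ofReal ℓ ^ 2 * ∑ l ∈ U, ∫⁻ x in A, ‖momentum α l η x‖ₑ ^ 2) := by
  induction U using Finset.induction_on with
  | empty => simp
  | insert u U hu ih =>
    have huS : u ∈ S := hU (Finset.mem_insert_self _ _)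
    -- Since `u ∉ U`, the constraints defining `B` leave particle `u` free in the large square, so
    -- the Poincaré inequality applies to it.
    set B := A ∩ {x : Config N | ∀ l ∈ U, x l ∈ square (c' l) (ℓ' l)} with hB
    have hBm : MeasurableSet B := hA.measurableSet.inter (measurableSet_forall_mem_square _ _ _)
    have h := hη.poincare_square α u hℓ (hℓ' u) (hsub u) (hsub' u) hBm
      (fun x hx => (hA.mem_iff x hx.1 u).2 huS) (fun x hx z hz =>
        ⟨hA.update_mem x hx.1 u huS z hz, fun l hl => by
          rw [Function.update_of_ne (ne_of_mem_of_not_mem hl hu)]; exact hx.2 l hl⟩)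
    have hset : B ∩ {x | x u ∈ square (c' u) (ℓ' u)} =
        A ∩ {x | ∀ l ∈ insert u U, x l ∈ square (c' l) (ℓ' l)} := by
      ext x
      simp only [hB, Set.mem_inter_iff, Set.mem_ofPred_eq, Finset.forall_mem_insert]
      tauto
    rw [hset] at h
    have hD : ∫⁻ x in B, ‖momentum α u η x‖ₑ ^ 2 ≤ ∫⁻ x in A, ‖momentum α u η x‖ₑ ^ 2 :=
      lintegral_mono_set Set.inter_subset_left
    rw [Finset.card_insert_of_notMem hu, Finset.sum_insert hu]
    set P := ∫⁻ x in A ∩ {x | ∀ l ∈ insert u U, x l ∈ square (c' l) (ℓ' l)}, ‖η x‖ₑ ^ 2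
    set T := ∑ l ∈ U, ∫⁻ x in A, ‖momentum α l η x‖ₑ ^ 2
    set Du := ∫⁻ x in A, ‖momentum α u η x‖ₑ ^ 2
    calc _ ≤ 256 ^ U.card * ((256 * (P + ENNReal.ofReal ℓ ^ 2 * Du)) +
          ENNReal.ofReal ℓ ^ 2 * T) := by
            refine (ih fun l hl => hU (Finset.mem_insert_of_mem hl)).trans ?_
            gcongr
            refine h.trans ?_
            gcongr
      _ ≤ 256 ^ U.card * ((256 * (P + ENNReal.ofReal ℓ ^ 2 * Du)) +
          256 * (ENNReal.ofReal ℓ ^ 2 * T)) := by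
            exact mul_le_mul_right (add_le_add le_rfl
              (le_mul_of_one_le_left zero_le (show (1 : ℝ≥0∞) ≤ 256 by norm_num))) _
      _ = _ := by rw [pow_succ]; ring

theorem abs_apply_le_norm (z : Plane) (a : Fin 2) : |z a| ≤ ‖z‖ := PiLp.norm_apply_le z a

theorem norm_le_abs_add_abs (z : Plane) : ‖z‖ ≤ |z 0| + |z 1| := by
  rw [EuclideanSpace.norm_eq, Fin.sum_univ_two]
  apply Real.sqrt_le_iff.2
  refine ⟨by positivity, ?_⟩
  simp only [Real.norm_eq_abs]
  nlinarith [abs_nonneg (z 0), abs_nonneg (z 1)]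

/-- Two successive single-particle moves, of `k` and then of `j`, realise the change of relative
coordinate. -/
theorem pairPath_mem_of_isSector {c : Plane} {ℓ : ℝ} {S : Finset (Fin N)} {A : Set (Config N)}
    (hA : IsSector (square c ℓ) S A) {j k : Fin N} (hj : j ∈ S) (hk : k ∈ S)
    {X : Plane} {x : Config N} {r r' : Plane} (h : pairPath j k X x r ∈ A)
    (h1 : X + (1 / 2 : ℝ) • r' ∈ square c ℓ) (h2 : X - (1 / 2 : ℝ) • r' ∈ square c ℓ) :
    pairPath j k X x r' ∈ A := by
  have := hA.update_mem _ (hA.update_mem _ h k hk _ h2) j hj _ h1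
  convert this using 1
  ext l : 1
  by_cases hlj : l = j
  · subst hlj; simp [pairPath]
  by_cases hlk : l = k
  · subst hlk; simp [pairPath, hlj]
  · simp [pairPath, hlj, hlk]

/-- The exclusion bound for a bounded number of particles in a square. -/
theorem IsCore.exclusion_few {η : Config N → ℂ} (hη : IsCore η) {α : ℝ} (h0 : 0 ≤ α) (h1 : α ≤ 1)
    {c : Plane} {ℓ : ℝ} (hℓ : 0 < ℓ) {S : Finset (Fin N)} {A : Set (Config N)}
    (hA : IsSector (square c ℓ) S A) (hS : 2 ≤ S.card) (hS' : S.card ≤ 4) :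
    ENNReal.ofReal α * ∫⁻ x in A, ‖η x‖ₑ ^ 2 ≤
      2 * 256 ^ 4 * (ENNReal.ofReal ℓ ^ 2 * ∑ j ∈ S, ∫⁻ x in A, ‖momentum α j η x‖ₑ ^ 2) := by
  obtain ⟨j, hj, k, hk, hjk⟩ := Finset.one_lt_card.1 hS
  -- The pair is sent to a small square covering `[ℓ/4, 3ℓ/8)` in each coordinate relative to `c`,
  -- and the others to the quarter `[ℓ/2, ℓ)`. This leaves a gap `ℓ/8`, half the disc radius `ℓ/4`.
  -- Both sides are at least `ℓ/8`, as the localization requires.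
  set q₁ : Plane := WithLp.toLp 2 fun a => c a + ℓ / 4 with hq₁
  set q₂ : Plane := WithLp.toLp 2 fun a => c a + ℓ / 2 with hq₂
  have e₁ : ∀ a, q₁ a = c a + ℓ / 4 := fun a => rfl
  have e₂ : ∀ a, q₂ a = c a + ℓ / 2 := fun a => rfl
  set c' : Fin N → Plane := fun l => if l = j ∨ l = k then q₁ else q₂ with hc'
  set ℓ' : Fin N → ℝ := fun l => if l = j ∨ l = k then ℓ / 8 else ℓ / 2 with hℓ'
  have hloc := hη.localize α hℓ hA (c' := c') (ℓ' := ℓ')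
    (fun l => by simp only [hℓ']; split_ifs <;> linarith)
    (fun l a => by simp only [hc']; split_ifs <;> simp only [e₁, e₂] <;> linarith)
    (fun l a => by simp only [hc', hℓ']; split_ifs <;> simp only [e₁, e₂] <;> linarith)
    S subset_rfl
  set T := ∑ j ∈ S, ∫⁻ x in A, ‖momentum α j η x‖ₑ ^ 2 with hT
  -- The localized set is enlarged: constraining the midpoint and the distance, instead of both
  -- positions, makes the fibres in the relative coordinate full discs.
  set B : Set (Config N) := {x | x ∈ A ∧ (1 / 2 : ℝ) • (x j + x k) ∈ square q₁ (ℓ / 8) ∧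
    (∀ l ∈ (S.erase j).erase k, x l ∈ square q₂ (ℓ / 2)) ∧ ‖x j - x k‖ < ℓ / 4} with hB
  have hBm : MeasurableSet B := by
    refine hA.measurableSet.inter (MeasurableSet.inter ?_ (MeasurableSet.inter ?_ ?_))
    · exact (measurableSet_square _ _).preimage (by fun_prop :
        Measurable fun x : Config N => (1 / 2 : ℝ) • (x j + x k))
    · exact measurableSet_forall_mem_square _ (fun _ => q₂) (fun _ => ℓ / 2)
    · exact measurableSet_lt (by fun_prop : Measurable fun x : Config N => ‖x j - x k‖)
        measurable_const
  have hpath : ∀ X x r, pairPath j k X x r ∈ B ↔ pairPath j k X x r ∈ A ∧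
      X ∈ square q₁ (ℓ / 8) ∧ (∀ l ∈ (S.erase j).erase k, x l ∈ square q₂ (ℓ / 2)) ∧
      ‖r‖ < ℓ / 4 := by
    intro X x r
    have m1 : (1 / 2 : ℝ) • (pairPath j k X x r j + pairPath j k X x r k) = X := by
      rw [pairPath_left, pairPath_right hjk]; module
    have m2 : pairPath j k X x r j - pairPath j k X x r k = r := by
      rw [pairPath_left, pairPath_right hjk]; module
    have m3 : (∀ l ∈ (S.erase j).erase k, pairPath j k X x r l ∈ square q₂ (ℓ / 2)) ↔
        ∀ l ∈ (S.erase j).erase k, x l ∈ square q₂ (ℓ / 2) := by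
      refine forall₂_congr fun l hl => ?_
      simp only [Finset.mem_erase] at hl
      rw [pairPath_of_ne hl.2.1 hl.1]
    rw [hB, Set.mem_ofPred_eq, m1, m2, m3]
  have hsub : A ∩ {x | ∀ l ∈ S, x l ∈ square (c' l) (ℓ' l)} ⊆ B := by
    rintro x ⟨hxA, hx⟩
    have hxj : x j ∈ square q₁ (ℓ / 8) := by simpa [hc', hℓ'] using hx j hj
    have hxk : x k ∈ square q₁ (ℓ / 8) := by simpa [hc', hℓ'] using hx k hk
    refine ⟨hxA, fun a => ?_, fun l hl => ?_, ?_⟩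
    · have ha := hxj a
      have hb := hxk a
      simp only [Set.mem_Ico, PiLp.smul_apply, PiLp.add_apply, smul_eq_mul] at ha hb ⊢
      constructor <;> linarith
    · simp only [Finset.mem_erase] at hl
      have := hx l hl.2.2
      simpa [hc', hℓ', hl.1, hl.2.1] using this
    · refine (norm_le_abs_add_abs _).trans_lt ?_
      have ha0 := hxj 0
      have hb0 := hxk 0
      have ha1 := hxj 1
      have hb1 := hxk 1
      simp only [Set.mem_Ico] at ha0 hb0 ha1 hb1
      have d0 : |(x j - x k) 0| < ℓ / 8 := by
        rw [PiLp.sub_apply, abs_lt]; constructor <;> linarith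
      have d1 : |(x j - x k) 1| < ℓ / 8 := by
        rw [PiLp.sub_apply, abs_lt]; constructor <;> linarith
      linarith
  have hBA : B ⊆ A := fun x hx => hx.1
  have hpair := hη.pair_bound h0 h1 (δ := ℓ / 4) (by linarith) hjk hBm
    (fun X x r h => ((hpath X x r).1 h).2.2.2) (fun X x r h l hlj hlk => ?_)
    (fun X x r r' h hr' => ?_)
  · have hpair' : ENNReal.ofReal α * ∫⁻ x in B, ‖η x‖ₑ ^ 2 ≤ ENNReal.ofReal ℓ ^ 2 * T := by
      refine hpair.trans ?_
      have hc : ENNReal.ofReal ((ℓ / 4) ^ 2 / 4) ≤ ENNReal.ofReal ℓ ^ 2 := by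
        rw [← ENNReal.ofReal_pow hℓ.le]
        exact ENNReal.ofReal_le_ofReal (by nlinarith)
      have hmj := hη.measurable_momentum α j
      refine mul_le_mul' hc ?_
      rw [lintegral_add_left (by fun_prop), hT, ← Finset.add_sum_erase _ _ hj,
        ← Finset.add_sum_erase _ _ (Finset.mem_erase.2 ⟨hjk.symm, hk⟩)]
      refine add_le_add (lintegral_mono_set hBA) (le_add_right (lintegral_mono_set hBA))
    have hα : ENNReal.ofReal α ≤ 1 := by simpa using h1
    set P := ∫⁻ x in A ∩ {x | ∀ l ∈ S, x l ∈ square (c' l) (ℓ' l)}, ‖η x‖ₑ ^ 2 with hP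
    have hPB : P ≤ ∫⁻ x in B, ‖η x‖ₑ ^ 2 := lintegral_mono_set hsub
    -- There are at most four localization steps. The kinetic error of the localization is kept by
    -- using `α ≤ 1`, and the localized mass is paid for by the pair bound.
    calc _ ≤ ENNReal.ofReal α * (256 ^ 4 * (P + ENNReal.ofReal ℓ ^ 2 * T)) := by
          gcongr
          refine hloc.trans ?_
          gcongr
          norm_num
      _ = 256 ^ 4 * (ENNReal.ofReal α * P + ENNReal.ofReal α * (ENNReal.ofReal ℓ ^ 2 * T)) := by ring
      _ ≤ 256 ^ 4 * (ENNReal.ofReal ℓ ^ 2 * T + 1 * (ENNReal.ofReal ℓ ^ 2 * T)) := by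
          exact mul_le_mul_right (add_le_add ((mul_le_mul_right hPB _).trans hpair')
            (mul_le_mul_left hα _)) _
      _ = _ := by ring
  · obtain ⟨hmem, hX, hl, -⟩ := (hpath X x r).1 h
    have hbound : ∀ a, ℓ / 8 ≤ |X a - x l a| → ℓ / 4 / 2 ≤ ‖X - x l‖ := fun a ha => by
      refine le_trans ?_ (abs_apply_le_norm (X - x l) a)
      rw [PiLp.sub_apply]; linarith
    by_cases hlS : l ∈ S
    · have h2 := hl l (by simp [hlS, hlj, hlk]) 0
      have h3 := hX 0
      simp only [Set.mem_Ico, e₁, e₂] at h2 h3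
      refine hbound 0 ?_
      rw [abs_sub_comm]
      exact le_trans (by linarith) (le_abs_self _)
    · have h2 : x l ∉ square c ℓ := by
        have := mt (hA.mem_iff _ hmem l).1 hlS
        rwa [pairPath_of_ne hlj hlk] at this
      simp only [square, Set.mem_ofPred_eq, not_forall, Set.mem_Ico, not_and_or, not_le, not_lt]
        at h2
      obtain ⟨a, ha⟩ := h2
      have h3 := hX a
      simp only [Set.mem_Ico, e₁] at h3
      refine hbound a ?_
      rcases ha with ha | ha
      · exact le_trans (by linarith) (le_abs_self _)
      · rw [abs_sub_comm]
        exact le_trans (by linarith) (le_abs_self _)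
  · obtain ⟨hmem, hX, hl, -⟩ := (hpath X x r).1 h
    refine (hpath X x r').2 ⟨?_, hX, hl, hr'⟩
    refine pairPath_mem_of_isSector hA hj hk hmem (fun a => ?_) (fun a => ?_)
    -- Since `|r'| / 2 < ℓ/8`, both particles stay in `[ℓ/8, ℓ/2)` in each coordinate relative to
    -- `c`.
    all_goals
      have h3 := hX a
      have h4 := abs_lt.1 ((abs_apply_le_norm r' a).trans_lt hr')
      simp only [Set.mem_Ico, e₁, PiLp.add_apply, PiLp.sub_apply, PiLp.smul_apply, smul_eq_mul]
        at h3 ⊢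
      constructor <;> linarith

end Anyon
end

/-! ### Separation on the support and decomposition into fibres -/

noncomputable section

namespace Anyon

variable {N : ℕ}

/-- On the support of `η`, small squares contain at most one particle. -/
theorem IsCore.exists_separation {η : Config N → ℂ} (hη : IsCore η) :
    ∃ ε : ℝ, 0 < ε ∧ ∀ x, η x ≠ 0 → ∀ j k, j ≠ k → ∀ c ℓ, ℓ ≤ ε → x j ∈ square c ℓ →
      x k ∉ square c ℓ := by
  -- Compactness of the support keeps all pairs a positive distance apart. The factor `2` covers the
  -- distance of two points in a square of side `ε`, bounded by the sum of the coordinate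
  -- differences.
  have h : ∀ᶠ ε : ℝ in 𝓝[>] 0, ∀ j k : Fin N, j ≠ k → ∀ x ∈ tsupport η, 2 * ε < ‖x j - x k‖ := by
    rw [eventually_all]
    intro j
    rw [eventually_all]
    intro k
    by_cases hjk : j = k
    · simp [hjk]
    obtain ⟨d, hd, hle⟩ := hη.compact.isCompact.exists_forall_le' (a := (0 : ℝ))
      (f := fun x : Config N => ‖x j - x k‖) (by fun_prop)
      (fun x hx => norm_pos_iff.2 (sub_ne_zero.2 (hη.support hx j k hjk)))
    have : ∀ᶠ ε : ℝ in 𝓝[>] 0, ε < d / 2 := nhdsWithin_le_nhds (gt_mem_nhds (by linarith))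
    filter_upwards [this] with ε hε _ x hx
    linarith [hle x hx]
  obtain ⟨ε, hε, hpos⟩ := (h.and self_mem_nhdsWithin).exists
  refine ⟨ε, hpos, fun x hx j k hjk c ℓ hℓ hj hk => ?_⟩
  have h1 := hε j k hjk x (subset_tsupport η hx)
  have h2 := norm_le_abs_add_abs (x j - x k)
  have d : ∀ a, |(x j - x k) a| ≤ ℓ := fun a => by
    have ha := hj a
    have hb := hk a
    simp only [Set.mem_Ico] at ha hb
    rw [PiLp.sub_apply, abs_le]
    constructor <;> linarith
  linarith [d 0, d 1]

/-- The integral over the fibres of a map to a finite type. -/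
theorem setLIntegral_eq_sum_fibres {X ι : Type*} [MeasurableSpace X] {μ : Measure X} [Fintype ι]
    (g : X → ι) (hg : ∀ i, MeasurableSet (g ⁻¹' {i})) (A : Set X) (F : X → ℝ≥0∞) :
    ∫⁻ x in A, F x ∂μ = ∑ i, ∫⁻ x in A ∩ g ⁻¹' {i}, F x ∂μ := by
  have h : ∫⁻ x in ⋃ i ∈ (Finset.univ : Finset ι), g ⁻¹' {i}, F x ∂(μ.restrict A) =
      ∑ i, ∫⁻ x in g ⁻¹' {i}, F x ∂(μ.restrict A) :=
    lintegral_biUnion_finset (fun i _ j _ hij => Set.disjoint_left.2 fun x hi hj =>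
      hij (hi.symm.trans hj)) (fun i _ => hg i) F
  have hu : ⋃ i ∈ (Finset.univ : Finset ι), g ⁻¹' {i} = Set.univ := by ext; simp
  rw [hu, Measure.restrict_univ] at h
  rw [h]
  refine Finset.sum_congr rfl fun i _ => ?_
  rw [Measure.restrict_restrict (hg i), Set.inter_comm]

/-! ### Dyadic subdivision -/

/-- The lower left corner of the quarter `b` of a square. -/
def quarterCorner (c : Plane) (ℓ : ℝ) (b : Fin 2 → Bool) : Plane :=
  WithLp.toLp 2 fun a => c a + if b a then ℓ / 2 else 0

/-- The quarter of a square that contains a given point of it. -/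
def quarterIndex (c : Plane) (ℓ : ℝ) (z : Plane) : Fin 2 → Bool :=
  fun a => decide (c a + ℓ / 2 ≤ z a)

theorem mem_square_quarter {c : Plane} {ℓ : ℝ} (hℓ : 0 < ℓ) (b : Fin 2 → Bool) (z : Plane) :
    z ∈ square (quarterCorner c ℓ b) (ℓ / 2) ↔ z ∈ square c ℓ ∧ quarterIndex c ℓ z = b := by
  simp only [square, Set.mem_ofPred_eq, quarterIndex, funext_iff, ← forall_and]
  refine forall_congr' fun a => ?_
  simp only [quarterCorner, Set.mem_Ico]
  cases b a
  · simp only [Bool.false_eq_true, if_false, decide_eq_false_iff_not, not_le]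
    constructor
    · intro h; exact ⟨⟨by linarith, by linarith⟩, by linarith⟩
    · intro h; exact ⟨by linarith, by linarith⟩
  · simp only [if_true, decide_eq_true_eq]
    constructor
    · intro h; exact ⟨⟨by linarith, by linarith⟩, by linarith⟩
    · intro h; exact ⟨by linarith, by linarith⟩

theorem measurableSet_quarterIndex (c : Plane) (ℓ : ℝ) (b : Fin 2 → Bool) :
    MeasurableSet (quarterIndex c ℓ ⁻¹' {b}) := by
  have : quarterIndex c ℓ ⁻¹' {b} = ⋂ a, {z : Plane | c a + ℓ / 2 ≤ z a ↔ b a = true} := by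
    ext z
    simp only [quarterIndex, Set.mem_preimage, Set.mem_singleton_iff, funext_iff, Set.mem_iInter,
      Set.mem_ofPred_eq]
    refine forall_congr' fun a => ?_
    cases b a <;> simp
  rw [this]
  refine MeasurableSet.iInter fun a => ?_
  have hm : MeasurableSet {z : Plane | c a + ℓ / 2 ≤ z a} :=
    measurableSet_le measurable_const (by fun_prop)
  by_cases hb : b a = true
  · simpa [hb] using hm
  · simp only [hb, Bool.false_eq_true, iff_false]
    exact hm.compl

/-- The assignment of quarters to the particles. -/
def quarterIndices (c : Plane) (ℓ : ℝ) (x : Config N) : Fin N → Fin 2 → Bool :=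
  fun j => quarterIndex c ℓ (x j)

theorem measurableSet_quarterIndices (c : Plane) (ℓ : ℝ) (f : Fin N → Fin 2 → Bool) :
    MeasurableSet (quarterIndices c ℓ ⁻¹' {f}) := by
  have : quarterIndices c ℓ ⁻¹' {f} =
      ⋂ j, (fun x : Config N => x j) ⁻¹' (quarterIndex c ℓ ⁻¹' {f j}) := by
    ext x
    simp [quarterIndices, funext_iff]
  rw [this]
  exact MeasurableSet.iInter fun j =>
    (measurableSet_quarterIndex c ℓ (f j)).preimage (measurable_pi_apply j)

/-- Fixing the quarter of every particle gives a sector for each quarter at once, which makes the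
dyadic induction possible. -/
theorem IsSector.quarter {c : Plane} {ℓ : ℝ} (hℓ : 0 < ℓ) {S : Finset (Fin N)}
    {A : Set (Config N)} (hA : IsSector (square c ℓ) S A) (f : Fin N → Fin 2 → Bool)
    (b : Fin 2 → Bool) :
    IsSector (square (quarterCorner c ℓ b) (ℓ / 2)) (S.filter fun j => f j = b)
      (A ∩ quarterIndices c ℓ ⁻¹' {f}) where
  measurableSet := hA.measurableSet.inter (measurableSet_quarterIndices c ℓ f)
  mem_iff x hx j := by
    have hf : quarterIndex c ℓ (x j) = f j := congrFun hx.2 j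
    rw [mem_square_quarter hℓ, hA.mem_iff x hx.1 j, hf, Finset.mem_filter]
  update_mem x hx j hj z hz := by
    rw [Finset.mem_filter] at hj
    rw [mem_square_quarter hℓ] at hz
    refine ⟨hA.update_mem x hx.1 j hj.1 z hz.1, ?_⟩
    have hf : ∀ l, quarterIndex c ℓ (x l) = f l := congrFun hx.2
    refine funext fun l => ?_
    simp only [quarterIndices]
    by_cases hl : l = j
    · subst hl; rw [Function.update_self, hz.2, hj.2]
    · rw [Function.update_of_ne hl, hf]

/-- The truncated sum is at least `n - 4`, and `n - 1 ≤ 4 (n - 4)` exactly from `n = 5` on. This is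
why up to four particles need the direct argument. -/
theorem card_sub_one_le_four_mul_sum (S : Finset (Fin N)) (f : Fin N → Fin 2 → Bool)
    (hS : 5 ≤ S.card) :
    S.card - 1 ≤ 4 * ∑ b, ((S.filter fun j => f j = b).card - 1) := by
  have h1 : S.card = ∑ b, (S.filter fun j => f j = b).card :=
    Finset.card_eq_sum_card_fiberwise fun _ _ => Finset.mem_coe.2 (Finset.mem_univ _)
  have h2 : ∑ b, (S.filter fun j => f j = b).card ≤
      ∑ b : Fin 2 → Bool, (((S.filter fun j => f j = b).card - 1) + 1) :=
    Finset.sum_le_sum fun b _ => by omega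
  rw [Finset.sum_add_distrib] at h2
  simp only [Finset.sum_const, Finset.card_univ, Fintype.card_fun, Fintype.card_bool,
    Fintype.card_fin, smul_eq_mul, mul_one] at h2
  omega

/-- Local exclusion: the kinetic energy of `n` particles in a square of side `ℓ` is at least of
order `α (n - 1) / ℓ²`. -/
theorem IsCore.exclusion {η : Config N → ℂ} (hη : IsCore η) {α : ℝ} (h0 : 0 ≤ α) (h1 : α ≤ 1)
    {c : Plane} {ℓ : ℝ} (hℓ : 0 < ℓ) {S : Finset (Fin N)} {A : Set (Config N)}
    (hA : IsSector (square c ℓ) S A) :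
    ENNReal.ofReal α * (((S.card - 1 : ℕ) : ℝ≥0∞) * ∫⁻ x in A, ‖η x‖ₑ ^ 2) ≤
      6 * 256 ^ 4 * (ENNReal.ofReal ℓ ^ 2 * ∑ j ∈ S, ∫⁻ x in A, ‖momentum α j η x‖ₑ ^ 2) := by
  obtain ⟨ε, hε, hsep⟩ := hη.exists_separation
  -- The induction runs on the number of halvings needed to reach the separation scale `ε`, below
  -- which two particles in the square force `η = 0`.
  obtain ⟨m, hm⟩ : ∃ m : ℕ, ℓ ≤ ε * 2 ^ m := by
    obtain ⟨m, hm⟩ := pow_unbounded_of_one_lt (ℓ / ε) (one_lt_two)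
    exact ⟨m, by rw [div_lt_iff₀ hε] at hm; linarith⟩
  induction m generalizing c ℓ S A with
  | zero =>
    rcases le_or_gt S.card 1 with hS | hS
    · simp [Nat.sub_eq_zero_of_le hS]
    · obtain ⟨j, hj, k, hk, hjk⟩ := Finset.one_lt_card.1 hS
      have : ∫⁻ x in A, ‖η x‖ₑ ^ 2 = 0 := by
        rw [setLIntegral_congr_fun hA.measurableSet (g := fun _ => 0), lintegral_zero]
        intro x hx
        by_contra hne
        have hne' : η x ≠ 0 := fun h => hne (by simp [h])
        exact hsep x hne' j k hjk c ℓ (by simpa using hm) ((hA.mem_iff x hx j).2 hj)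
          ((hA.mem_iff x hx k).2 hk)
      simp [this]
  | succ m ih =>
    rcases le_or_gt S.card 1 with hS | hS
    · simp [Nat.sub_eq_zero_of_le hS]
    rcases le_or_gt S.card 4 with hS4 | hS4
    · have h := hη.exclusion_few h0 h1 hℓ hA hS hS4
      have h3 : ((S.card - 1 : ℕ) : ℝ≥0∞) ≤ 3 := by exact_mod_cast (by omega : S.card - 1 ≤ 3)
      calc _ ≤ ENNReal.ofReal α * (3 * ∫⁻ x in A, ‖η x‖ₑ ^ 2) := by gcongr
        _ = 3 * (ENNReal.ofReal α * ∫⁻ x in A, ‖η x‖ₑ ^ 2) := by ring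
        _ ≤ 3 * (2 * 256 ^ 4 *
            (ENNReal.ofReal ℓ ^ 2 * ∑ j ∈ S, ∫⁻ x in A, ‖momentum α j η x‖ₑ ^ 2)) := by gcongr
        _ = _ := by ring
    -- The factor `4` lost in counting particles is exactly recovered from `(ℓ/2)² = ℓ²/4`, so the
    -- constant does not grow with the depth.
    · have hℓ2 : ENNReal.ofReal ℓ ^ 2 = 4 * ENNReal.ofReal (ℓ / 2) ^ 2 := by
        rw [← ENNReal.ofReal_pow hℓ.le, ← ENNReal.ofReal_pow (by linarith), ← ENNReal.ofReal_ofNat 4,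
          ← ENNReal.ofReal_mul (by norm_num)]
        congr 1; ring
      have hpart : ∀ F : Config N → ℝ≥0∞, ∫⁻ x in A, F x =
          ∑ f : Fin N → Fin 2 → Bool, ∫⁻ x in A ∩ quarterIndices c ℓ ⁻¹' {f}, F x := fun F =>
        setLIntegral_eq_sum_fibres _ (measurableSet_quarterIndices c ℓ) A F
      simp only [hpart]
      rw [Finset.sum_comm, Finset.mul_sum, Finset.mul_sum, Finset.mul_sum, Finset.mul_sum]
      refine Finset.sum_le_sum fun f _ => ?_
      set P := ∫⁻ x in A ∩ quarterIndices c ℓ ⁻¹' {f}, ‖η x‖ₑ ^ 2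
      set T : Fin N → ℝ≥0∞ := fun j =>
        ∫⁻ x in A ∩ quarterIndices c ℓ ⁻¹' {f}, ‖momentum α j η x‖ₑ ^ 2 with hT
      have hb : ∀ b, ENNReal.ofReal α * ((((S.filter fun j => f j = b).card - 1 : ℕ) : ℝ≥0∞) * P) ≤
          6 * 256 ^ 4 * (ENNReal.ofReal (ℓ / 2) ^ 2 * ∑ j ∈ S.filter fun j => f j = b, T j) :=
        fun b => ih (by linarith) (hA.quarter hℓ f b) (by rw [pow_succ] at hm; linarith)
      have hcard : ((S.card - 1 : ℕ) : ℝ≥0∞) ≤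
          4 * ∑ b, (((S.filter fun j => f j = b).card - 1 : ℕ) : ℝ≥0∞) := by
        exact_mod_cast card_sub_one_le_four_mul_sum S f hS4
      have hsum : ∑ j ∈ S, T j = ∑ b, ∑ j ∈ S.filter fun j => f j = b, T j :=
        (Finset.sum_fiberwise S f T).symm
      calc _ ≤ ENNReal.ofReal α * ((4 * ∑ b, (((S.filter fun j => f j = b).card - 1 : ℕ) : ℝ≥0∞)) *
            P) := by gcongr
        _ = 4 * ∑ b, ENNReal.ofReal α *
            ((((S.filter fun j => f j = b).card - 1 : ℕ) : ℝ≥0∞) * P) := by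
            rw [← Finset.mul_sum, ← Finset.sum_mul]; ring
        _ ≤ 4 * ∑ b, 6 * 256 ^ 4 * (ENNReal.ofReal (ℓ / 2) ^ 2 *
            ∑ j ∈ S.filter fun j => f j = b, T j) := by
            exact mul_le_mul_right (Finset.sum_le_sum fun b _ => hb b) _
        _ = _ := by
            rw [← Finset.mul_sum, ← Finset.mul_sum, ← hsum, hℓ2]; ring

end Anyon
end

noncomputable section

namespace Anyon

variable {N : ℕ}

/-! ### Expected particle number and kinetic energy in a region -/

theorem measurableSet_apply_mem {Q : Set Plane} (hQ : MeasurableSet Q) (j : Fin N) :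
    MeasurableSet {x : Config N | x j ∈ Q} :=
  hQ.preimage (measurable_pi_apply j)

/-- The integral of the one-body functions `F j` over configurations with `x j ∈ Q`. -/
def regionIntegral (F : Fin N → Config N → ℝ≥0∞) (Q : Set Plane) : ℝ≥0∞ :=
  ∑ j, ∫⁻ x in {x : Config N | x j ∈ Q}, F j x

open Classical in
/-- The particles inside a region. -/
def particlesIn (Q : Set Plane) (x : Config N) : Finset (Fin N) :=
  Finset.univ.filter fun j => x j ∈ Q

theorem mem_particlesIn {Q : Set Plane} {x : Config N} {j : Fin N} :
    j ∈ particlesIn Q x ↔ x j ∈ Q := by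
  simp [particlesIn]

theorem isSector_particlesIn {Q : Set Plane} (hQ : MeasurableSet Q) (S : Finset (Fin N)) :
    IsSector Q S (particlesIn Q ⁻¹' {S}) where
  measurableSet := by
    have : particlesIn Q ⁻¹' {S} = ⋂ j : Fin N, {x : Config N | x j ∈ Q ↔ j ∈ S} := by
      ext x
      simp only [Set.mem_preimage, Set.mem_singleton_iff, Finset.ext_iff, mem_particlesIn,
        Set.mem_iInter, Set.mem_ofPred_eq]
    rw [this]
    refine MeasurableSet.iInter fun j => ?_
    by_cases hj : j ∈ S
    · simpa [hj] using measurableSet_apply_mem hQ j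
    · simp only [hj, iff_false]
      exact (measurableSet_apply_mem hQ j).compl
  mem_iff x hx j := by
    rw [← mem_particlesIn, show particlesIn Q x = S from hx]
  update_mem x hx j hj z hz := by
    have h : ∀ l, x l ∈ Q ↔ l ∈ S := fun l => by
      rw [← mem_particlesIn, show particlesIn Q x = S from hx]
    show particlesIn Q _ = S
    ext l
    rw [mem_particlesIn]
    by_cases hl : l = j
    · subst hl; simpa [hj] using hz
    · rw [Function.update_of_ne hl, h]

/-- Configurations are grouped by the exact set `S` of particles in `Q`. For constant `F` in `j`,
the inner sum becomes multiplication by the particle number. -/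
theorem regionIntegral_eq_sum {Q : Set Plane} (hQ : MeasurableSet Q)
    (F : Fin N → Config N → ℝ≥0∞) :
    regionIntegral F Q = ∑ S, ∑ j ∈ S, ∫⁻ x in particlesIn Q ⁻¹' {S}, F j x := by
  have h : ∀ j, ∫⁻ x in {x : Config N | x j ∈ Q}, F j x =
      ∑ S : Finset (Fin N), if j ∈ S then ∫⁻ x in particlesIn Q ⁻¹' {S}, F j x else 0 := by
    intro j
    rw [setLIntegral_eq_sum_fibres (particlesIn Q)
      (fun S => (isSector_particlesIn hQ S).measurableSet)]
    refine Finset.sum_congr rfl fun S _ => ?_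
    split_ifs with hj
    · congr 2
      refine Set.inter_eq_right.2 fun x hx => ?_
      exact ((isSector_particlesIn hQ S).mem_iff x hx j).2 hj
    · have : {x : Config N | x j ∈ Q} ∩ particlesIn Q ⁻¹' {S} = ∅ := by
        ext x
        simp only [Set.mem_inter_iff, Set.mem_empty_iff_false, iff_false, not_and]
        intro hx hS
        exact hj (((isSector_particlesIn hQ S).mem_iff x hS j).1 hx)
      simp [this]
  simp only [regionIntegral, h]
  rw [Finset.sum_comm]
  refine Finset.sum_congr rfl fun S _ => ?_
  rw [← Finset.sum_filter]
  simp

/-- Local exclusion in expectation. -/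
theorem IsCore.exclusion_region {η : Config N → ℂ} (hη : IsCore η) {α : ℝ} (h0 : 0 ≤ α)
    (h1 : α ≤ 1) (c : Plane) {ℓ : ℝ} (hℓ : 0 < ℓ) :
    ENNReal.ofReal α * regionIntegral (fun _ x => ‖η x‖ₑ ^ 2) (square c ℓ) ≤
      ENNReal.ofReal α * (∫⁻ x, ‖η x‖ₑ ^ 2) + 6 * 256 ^ 4 * (ENNReal.ofReal ℓ ^ 2 *
        regionIntegral (fun j x => ‖momentum α j η x‖ₑ ^ 2) (square c ℓ)) := by
  have hQ := measurableSet_square c ℓ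
  have hm : ∫⁻ x, ‖η x‖ₑ ^ 2 =
      ∑ S, ∫⁻ x in particlesIn (square c ℓ) ⁻¹' {S}, ‖η x‖ₑ ^ 2 := by
    rw [← setLIntegral_univ, setLIntegral_eq_sum_fibres (particlesIn (square c ℓ))
      (fun S => (isSector_particlesIn hQ S).measurableSet)]
    simp
  rw [regionIntegral_eq_sum hQ, regionIntegral_eq_sum hQ, hm]
  simp only [Finset.mul_sum (s := (Finset.univ : Finset (Finset (Fin N))))]
  rw [← Finset.sum_add_distrib]
  refine Finset.sum_le_sum fun S _ => ?_
  refine le_trans ?_ (add_le_add le_rfl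
    (hη.exclusion h0 h1 hℓ (isSector_particlesIn hQ S)))
  rw [← mul_add, Finset.sum_const, nsmul_eq_mul]
  refine mul_le_mul_right ?_ _
  set P := ∫⁻ x in particlesIn (square c ℓ) ⁻¹' {S}, ‖η x‖ₑ ^ 2
  -- The subtraction is truncated, so the inequality also covers the empty set.
  have : (S.card : ℝ≥0∞) ≤ 1 + ((S.card - 1 : ℕ) : ℝ≥0∞) := by
    exact_mod_cast (by omega : S.card ≤ 1 + (S.card - 1))
  calc (S.card : ℝ≥0∞) * P ≤ (1 + ((S.card - 1 : ℕ) : ℝ≥0∞)) * P := by gcongr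
    _ = _ := by ring

/-! ### Local uncertainty -/

theorem setLIntegral_square {f : Plane → ℝ≥0∞} (hf : Measurable f) (c : Plane) (ℓ : ℝ)
    {a b : Fin 2} (hab : b ≠ a) :
    ∫⁻ z in square c ℓ, f z = ∫⁻ (t : ℝ) in Set.Ico (c b) (c b + ℓ),
      ∫⁻ (s : ℝ) in Set.Ico (c a) (c a + ℓ), f (slicePoint a s t) := by
  have hQ := measurableSet_square c ℓ
  rw [← lintegral_indicator hQ, lintegral_slice (hf.indicator hQ) a,
    ← lintegral_indicator measurableSet_Ico]
  refine lintegral_congr fun t => ?_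
  have hmem : ∀ s, slicePoint a s t ∈ square c ℓ ↔ s ∈ Set.Ico (c a) (c a + ℓ) ∧
      t ∈ Set.Ico (c b) (c b + ℓ) := fun s => by
    constructor
    · intro h
      have h1 := h a
      have h2 := h b
      rw [slicePoint_self] at h1
      rw [slicePoint_of_ne hab] at h2
      exact ⟨h1, h2⟩
    · rintro ⟨h1, h2⟩ i
      by_cases hi : i = a
      · subst hi; rwa [slicePoint_self]
      · rw [slicePoint_of_ne hi]
        have : i = b := by omega
        rwa [this]
  by_cases ht : t ∈ Set.Ico (c b) (c b + ℓ)
  · rw [Set.indicator_of_mem ht, ← lintegral_indicator measurableSet_Ico]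
    refine lintegral_congr fun s => ?_
    by_cases hs : s ∈ Set.Ico (c a) (c a + ℓ)
    · rw [Set.indicator_of_mem hs, Set.indicator_of_mem ((hmem s).2 ⟨hs, ht⟩)]
    · rw [Set.indicator_of_notMem hs, Set.indicator_of_notMem fun h => hs ((hmem s).1 h).1]
  · rw [Set.indicator_of_notMem ht]
    have : ∀ s, (square c ℓ).indicator f (slicePoint a s t) = 0 := fun s =>
      Set.indicator_of_notMem (fun h => ht ((hmem s).1 h).2) _
    simp [this]

theorem slicePoint_one_eq (s t : ℝ) : slicePoint 1 s t = slicePoint 0 t s := by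
  simp [slicePoint]

/-- The two-dimensional Ladyzhenskaya inequality: a function bounded by its line integrals in both
directions is square integrable. -/
theorem ladyzhenskaya_square {u H : Plane → ℝ≥0∞} (hu : Measurable u) (hH : Measurable H)
    (c : Plane) (ℓ : ℝ)
    (h : ∀ (a : Fin 2) (s t : ℝ), s ∈ Set.Ico (c a) (c a + ℓ) →
      u (slicePoint a s t) ≤ ∫⁻ (τ : ℝ) in Set.Ico (c a) (c a + ℓ), H (slicePoint a τ t)) :
    ∫⁻ z in square c ℓ, u z ^ 2 ≤ (∫⁻ z in square c ℓ, H z) ^ 2 := by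
  have h01 : (1 : Fin 2) ≠ 0 := by decide
  set B : Fin 2 → ℝ → ℝ≥0∞ := fun a t =>
    ∫⁻ (τ : ℝ) in Set.Ico (c a) (c a + ℓ), H (slicePoint a τ t) with hB
  have hBm : ∀ a, Measurable (B a) := fun a =>
    (hH.comp ((measurable_slicePoint a).comp measurable_swap)).lintegral_prod_right'
  rw [setLIntegral_square (hu.pow_const 2) c ℓ h01]
  -- One factor `u` is bounded by a horizontal line integral, which depends on `t` only, and the
  -- other by a vertical one, which depends on `s` only. The double integral then factorizes.
  calc _ ≤ ∫⁻ (t : ℝ) in Set.Ico (c 1) (c 1 + ℓ), ∫⁻ (s : ℝ) in Set.Ico (c 0) (c 0 + ℓ), B 0 t * B 1 s := by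
        refine setLIntegral_mono' measurableSet_Ico fun t ht =>
          setLIntegral_mono' measurableSet_Ico fun s hs => ?_
        rw [sq]
        refine mul_le_mul' (h 0 s t hs) ?_
        rw [← slicePoint_one_eq]
        exact h 1 t s ht
    _ = (∫⁻ (t : ℝ) in Set.Ico (c 1) (c 1 + ℓ), B 0 t) * ∫⁻ (s : ℝ) in Set.Ico (c 0) (c 0 + ℓ), B 1 s := by
        rw [← lintegral_mul_const _ (hBm 0)]
        exact lintegral_congr fun t => lintegral_const_mul _ (hBm 1)
    _ = _ := by
        rw [sq, setLIntegral_square hH c ℓ h01]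
        congr 1
        rw [← setLIntegral_square hH c ℓ h01, setLIntegral_square hH c ℓ h01.symm]

/-! ### Singling out one particle, and Cauchy–Schwarz over particles -/

theorem measurable_insertNth {n : ℕ} (j : Fin (n + 1)) :
    Measurable fun p : Plane × Config n => (Fin.insertNth j p.1 p.2 : Config (n + 1)) :=
  (MeasurableEquiv.piFinSuccAbove (fun _ => Plane) j).symm.measurable

theorem lintegral_insertNth {n : ℕ} (j : Fin (n + 1)) {F : Config (n + 1) → ℝ≥0∞}
    (hF : AEMeasurable F) :
    ∫⁻ x, F x = ∫⁻ z : Plane, ∫⁻ y : Config n, F (Fin.insertNth j z y) := by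
  have h := (volume_preserving_piFinSuccAbove (fun _ : Fin (n + 1) => Plane) j).symm
  rw [← h.lintegral_comp_emb (MeasurableEquiv.measurableEmbedding _), Measure.volume_eq_prod,
    lintegral_prod]
  · rfl
  · exact hF.comp_quasiMeasurePreserving h.quasiMeasurePreserving

theorem setLIntegral_insertNth {n : ℕ} (j : Fin (n + 1)) {F : Config (n + 1) → ℝ≥0∞}
    (hF : Measurable F) {Q : Set Plane} (hQ : MeasurableSet Q) :
    ∫⁻ x in {x : Config (n + 1) | x j ∈ Q}, F x =
      ∫⁻ z in Q, ∫⁻ y : Config n, F (Fin.insertNth j z y) := by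
  have hm := measurableSet_apply_mem (N := n + 1) hQ j
  rw [← lintegral_indicator hm, lintegral_insertNth j (hF.indicator hm).aemeasurable,
    ← lintegral_indicator hQ]
  refine lintegral_congr fun z => ?_
  by_cases hz : z ∈ Q
  · rw [Set.indicator_of_mem hz]
    refine lintegral_congr fun y => Set.indicator_of_mem (by simpa using hz) _
  · rw [Set.indicator_of_notMem hz]
    have : ∀ y : Config n, {x : Config (n + 1) | x j ∈ Q}.indicator F (Fin.insertNth j z y) = 0 :=
      fun y => Set.indicator_of_notMem (by simpa using hz) _
    simp [this]

theorem sq_lintegral_mul_le {X : Type*} [MeasurableSpace X] {μ : Measure X} {f g : X → ℝ≥0∞}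
    (hf : AEMeasurable f μ) (hg : AEMeasurable g μ) :
    (∫⁻ x, f x * g x ∂μ) ^ 2 ≤ (∫⁻ x, f x ^ 2 ∂μ) * ∫⁻ x, g x ^ 2 ∂μ := by
  have h := ENNReal.lintegral_mul_le_Lp_mul_Lq μ Real.HolderConjugate.two_two hf hg
  have h2 := pow_le_pow_left₀ zero_le h 2
  refine h2.trans_eq ?_
  rw [mul_pow, ← ENNReal.rpow_natCast, ← ENNReal.rpow_natCast, ← ENNReal.rpow_mul,
    ← ENNReal.rpow_mul]
  norm_num

theorem sq_regionIntegral_mul_le {f : Config N → ℝ≥0∞} {g : Fin N → Config N → ℝ≥0∞}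
    (hf : Measurable f) (hg : ∀ j, Measurable (g j)) {Q : Set Plane} :
    regionIntegral (fun j x => f x * g j x) Q ^ 2 ≤
      regionIntegral (fun _ x => f x ^ 2) Q * regionIntegral (fun j x => g j x ^ 2) Q := by
  have e : ∀ F : Fin N → Config N → ℝ≥0∞, regionIntegral F Q =
      ∑ j, ∫⁻ x in {x : Config N | x j ∈ Q}, F j x := fun F => rfl
  -- A single measure on pairs (particle, configuration) makes Cauchy–Schwarz act on the sum over
  -- `j` and on the integrals simultaneously.
  set μ : Measure (Fin N × Config N) := Measure.sum fun j : Fin N =>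
    ((volume : Measure (Config N)).restrict {x : Config N | x j ∈ Q}).map (fun x => (j, x)) with hμ
  have hregion : ∀ F : Fin N → Config N → ℝ≥0∞, (∀ j, Measurable (F j)) → regionIntegral F Q =
      ∫⁻ p, F p.1 p.2 ∂μ := fun F hF => by
    have hFm : Measurable fun p : Fin N × Config N => F p.1 p.2 :=
      measurable_from_prod_countable_right hF
    rw [hμ, lintegral_sum_measure, tsum_fintype, e]
    refine Finset.sum_congr rfl fun j _ => ?_
    rw [lintegral_map hFm (by fun_prop)]
  rw [hregion (fun j x => f x * g j x) (fun j => hf.mul (hg j)),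
    hregion (fun _ x => f x ^ 2) (fun _ => hf.pow_const 2),
    hregion (fun j x => g j x ^ 2) (fun j => (hg j).pow_const 2)]
  exact sq_lintegral_mul_le (hf.comp measurable_snd).aemeasurable
    (measurable_from_prod_countable_right hg).aemeasurable

end Anyon
end

/-! ### Local uncertainty for the one-body density -/

noncomputable section

namespace Anyon

variable {n : ℕ}

/-- By symmetry all summands agree. The sum form lets each `|η|²` be differentiated in its own
particle, so that every `D_j` enters once. -/
theorem density_eq_sum {η : Config (n + 1) → ℂ} (hη : IsCore η) (z : Plane) :
    density η z = ∑ j : Fin (n + 1), ∫⁻ y : Config n, ‖η (Fin.insertNth j z y)‖ₑ ^ 2 := by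
  have h : ∀ (j : Fin (n + 1)) (y : Config n),
      η (Fin.insertNth j z y) = η (Fin.cons z y : Config (n + 1)) := fun j y => by
    rw [← Fin.cons_comp_cycleRange]
    exact hη.symmetric _ _
  simp only [h, density, Finset.sum_const, Finset.card_univ, Fintype.card_fin, nsmul_eq_mul]

theorem measurable_density {η : Config (n + 1) → ℂ} (hη : Measurable η) :
    Measurable (density η) := by
  have h : Measurable fun p : Plane × Config n => ‖η (Fin.cons p.1 p.2 : Config (n + 1))‖ₑ ^ 2 := by
    have := (hη.comp (measurable_insertNth (0 : Fin (n + 1)))).enorm.pow_const 2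
    simpa [Function.comp_def, Fin.insertNth_zero] using! this
  exact h.lintegral_prod_right'.const_mul _

/-- Local uncertainty: the density in a square is controlled by the kinetic energy. -/
theorem IsCore.uncertainty {η : Config (n + 1) → ℂ} (hη : IsCore η) (α : ℝ) (c : Plane)
    (ℓ : ℝ) :
    ENNReal.ofReal ℓ ^ 2 * ∫⁻ z in square c ℓ, density η z ^ 2 ≤
      2 * regionIntegral (fun _ x => ‖η x‖ₑ ^ 2) (square c ℓ) ^ 2 +
      8 * ENNReal.ofReal ℓ ^ 2 * (regionIntegral (fun _ x => ‖η x‖ₑ ^ 2) (square c ℓ) *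
        regionIntegral (fun j x => ‖momentum α j η x‖ₑ ^ 2) (square c ℓ)) := by
  have hηm := hη.smooth.continuous.measurable
  have hDm := fun j => hη.measurable_momentum α j
  have hQ := measurableSet_square c ℓ
  set L := ENNReal.ofReal ℓ with hL
  have hvol : ∀ a, volume (Set.Ico (c a) (c a + ℓ)) = L := fun a => by
    rw [Real.volume_Ico]; congr 1; ring
  -- Averaging the fundamental theorem of calculus over an interval of length `L` bounds `L |η|²` at
  -- a point by the line integral of this function, in either direction.
  set F : Fin (n + 1) → Config (n + 1) → ℝ≥0∞ := fun j x =>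
    ‖η x‖ₑ ^ 2 + L * (2 * (‖η x‖ₑ * ‖momentum α j η x‖ₑ)) with hF
  have hFm : ∀ j, Measurable (F j) := fun j => by have := hDm j; fun_prop
  have hFi : ∀ j, Measurable fun p : Plane × Config n => F j (Fin.insertNth j p.1 p.2) := fun j =>
    (hFm j).comp (measurable_insertNth j)
  set H : Plane → ℝ≥0∞ := fun z => ∑ j, ∫⁻ y : Config n, F j (Fin.insertNth j z y) with hH
  have hHj : ∀ j, Measurable fun z => ∫⁻ y : Config n, F j (Fin.insertNth j z y) := fun j =>
    (hFi j).lintegral_prod_right'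
  have hHm : Measurable H := Finset.measurable_sum _ fun j _ => hHj j
  have hHint : ∫⁻ z in square c ℓ, H z = regionIntegral F (square c ℓ) := by
    rw [hH, lintegral_finsetSum _ fun j _ => hHj j]
    exact Finset.sum_congr rfl fun j _ => (setLIntegral_insertNth j (hFm j) hQ).symm
  have hslice : ∀ (j : Fin (n + 1)) (a : Fin 2) (s t : ℝ), s ∈ Set.Ico (c a) (c a + ℓ) →
      ∀ y : Config n, L * ‖η (Fin.insertNth j (slicePoint a s t) y)‖ₑ ^ 2 ≤
        ∫⁻ (τ : ℝ) in Set.Ico (c a) (c a + ℓ), F j (Fin.insertNth j (slicePoint a τ t) y) := by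
    intro j a s t hs y
    have hup : ∀ z, (Fin.insertNth j z y : Config (n + 1)) =
        Function.update (Fin.insertNth j 0 y : Config (n + 1)) j z := fun z => by
      simp
    have hγ : Measurable fun τ => (Fin.insertNth j (slicePoint a τ t) y : Config (n + 1)) :=
      (measurable_insertNth j).comp (Measurable.prodMk ((measurable_slicePoint a).comp
        (by fun_prop : Measurable fun τ : ℝ => (τ, t))) measurable_const)
    have hηγ : Measurable fun τ => ‖η (Fin.insertNth j (slicePoint a τ t) y)‖ₑ ^ 2 :=
      (hηm.comp hγ).enorm.pow_const 2
    have h := volume_mul_le_of_le_add (J := Set.Ico (c a) (c a + ℓ)) measurableSet_Ico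
      (v := fun τ => ‖η (Fin.insertNth j (slicePoint a τ t) y)‖ₑ ^ 2)
      (y := ‖η (Fin.insertNth j (slicePoint a s t) y)‖ₑ ^ 2)
      (c := ∫⁻ (τ : ℝ) in Set.Ico (c a) (c a + ℓ), 2 * (‖η (Fin.insertNth j (slicePoint a τ t) y)‖ₑ *
        ‖momentum α j η (Fin.insertNth j (slicePoint a τ t) y)‖ₑ)) (fun τ hτ => by
          have := hη.slice_bound α j a (Fin.insertNth j 0 y) t
            (Set.uIoc_subset_uIcc.trans (Set.ordConnected_Ico.uIcc_subset hτ hs))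
          simpa only [← hup] using this)
    rw [hvol, ← lintegral_const_mul' _ _ (by finiteness),
      ← lintegral_add_left hηγ] at h
    exact h
  have hlady := ladyzhenskaya_square (u := fun z => L * density η z)
    ((measurable_density hηm).const_mul _) hHm c ℓ (fun a s t hs => by
      rw [density_eq_sum hη, Finset.mul_sum, hH]
      have hpt : Measurable fun τ : ℝ => slicePoint a τ t :=
        (measurable_slicePoint a).comp (by fun_prop : Measurable fun τ : ℝ => (τ, t))
      have hHpt : ∀ j, Measurable fun τ : ℝ =>
          ∫⁻ y : Config n, F j (Fin.insertNth j (slicePoint a τ t) y) := fun j => (hHj j).comp hpt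
      dsimp only
      rw [lintegral_finsetSum _ fun j _ => hHpt j]
      refine Finset.sum_le_sum fun j _ => ?_
      rw [← lintegral_const_mul' _ _ (by finiteness), lintegral_lintegral_swap]
      · exact lintegral_mono fun y => hslice j a s t hs y
      · exact ((hFi j).comp (Measurable.prodMk (hpt.comp measurable_fst)
          measurable_snd)).aemeasurable)
  simp only [mul_pow] at hlady
  rw [lintegral_const_mul' _ _ (by finiteness), hHint] at hlady
  refine hlady.trans ?_
  set M := regionIntegral (fun _ x => ‖η x‖ₑ ^ 2) (square c ℓ)
  set T := regionIntegral (fun j x => ‖momentum α j η x‖ₑ ^ 2) (square c ℓ)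
  set X := regionIntegral (fun j x => ‖η x‖ₑ * ‖momentum α j η x‖ₑ) (square c ℓ) with hX
  have hFX : regionIntegral F (square c ℓ) = M + 2 * L * X := by
    simp only [M, hX, hF, regionIntegral, Finset.mul_sum, ← Finset.sum_add_distrib]
    refine Finset.sum_congr rfl fun j _ => ?_
    rw [lintegral_add_left (by fun_prop), lintegral_const_mul' _ _ (by finiteness),
      lintegral_const_mul' _ _ (by finiteness)]
    ring
  have hcs : X ^ 2 ≤ M * T := sq_regionIntegral_mul_le (f := fun x => ‖η x‖ₑ)
    (g := fun j x => ‖momentum α j η x‖ₑ) hηm.enorm (fun j => (hDm j).enorm)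
  have hsq : ∀ p q : ℝ≥0∞, (p + q) ^ 2 ≤ 2 * p ^ 2 + 2 * q ^ 2 := fun p q => by
    rcases eq_or_ne p ⊤ with rfl | hp
    · simp
    rcases eq_or_ne q ⊤ with rfl | hq
    · simp
    lift p to NNReal using hp
    lift q to NNReal using hq
    norm_cast
    rw [← NNReal.coe_le_coe]
    push_cast
    nlinarith [sq_nonneg ((p : ℝ) - q)]
  rw [hFX]
  calc (M + 2 * L * X) ^ 2 ≤ 2 * M ^ 2 + 2 * (2 * L * X) ^ 2 := hsq _ _
    _ = 2 * M ^ 2 + 8 * L ^ 2 * X ^ 2 := by ring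
    _ ≤ _ := by gcongr

end Anyon
end

noncomputable section

namespace Anyon

variable {n N : ℕ}

/-! ### The Lieb–Thirring inequality for core functions -/

theorem square_inter_quarterIndex {c : Plane} {ℓ : ℝ} (hℓ : 0 < ℓ) (b : Fin 2 → Bool) :
    square c ℓ ∩ quarterIndex c ℓ ⁻¹' {b} = square (quarterCorner c ℓ b) (ℓ / 2) := by
  ext z
  rw [mem_square_quarter hℓ]
  rfl

theorem setLIntegral_square_eq_sum_quarters {c : Plane} {ℓ : ℝ} (hℓ : 0 < ℓ)
    (f : Plane → ℝ≥0∞) :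
    ∫⁻ z in square c ℓ, f z = ∑ b, ∫⁻ z in square (quarterCorner c ℓ b) (ℓ / 2), f z := by
  rw [setLIntegral_eq_sum_fibres (quarterIndex c ℓ) (measurableSet_quarterIndex c ℓ)]
  simp only [square_inter_quarterIndex hℓ]

theorem regionIntegral_square_eq_sum_quarters {c : Plane} {ℓ : ℝ} (hℓ : 0 < ℓ)
    (F : Fin N → Config N → ℝ≥0∞) :
    regionIntegral F (square c ℓ) =
      ∑ b, regionIntegral F (square (quarterCorner c ℓ b) (ℓ / 2)) := by
  simp only [regionIntegral]
  rw [Finset.sum_comm]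
  refine Finset.sum_congr rfl fun j _ => ?_
  rw [setLIntegral_eq_sum_fibres (fun x : Config N => quarterIndex c ℓ (x j))
    (fun b => (measurableSet_quarterIndex c ℓ b).preimage (measurable_pi_apply j))]
  refine Finset.sum_congr rfl fun b _ => ?_
  rw [← square_inter_quarterIndex hℓ]
  rfl

theorem regionIntegral_le (F : Fin N → Config N → ℝ≥0∞) (Q : Set Plane) :
    regionIntegral F Q ≤ ∑ j, ∫⁻ x, F j x :=
  Finset.sum_le_sum fun _ _ => setLIntegral_le_lintegral _ _

theorem IsCore.lintegral_enorm_sq_ne_top {η : Config N → ℂ} (hη : IsCore η) :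
    ∫⁻ x, ‖η x‖ₑ ^ 2 ≠ ⊤ := by
  have h := (hη.smooth.continuous.memLp_of_hasCompactSupport (p := 2) (μ := volume) hη.compact)
  have := (memLp_two_iff_integrable_sq_norm h.aestronglyMeasurable).1 h |>.2
  rw [hasFiniteIntegral_iff_enorm] at this
  simpa using this.ne

/-- Small squares contain at most one particle. -/
theorem IsCore.regionIntegral_le_of_separated {η : Config N → ℂ} {ε : ℝ}
    (hsep : ∀ x, η x ≠ 0 → ∀ j k, j ≠ k → ∀ c ℓ, ℓ ≤ ε → x j ∈ square c ℓ → x k ∉ square c ℓ)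
    {c : Plane} {ℓ : ℝ} (hℓ : ℓ ≤ ε) :
    regionIntegral (fun _ x => ‖η x‖ₑ ^ 2) (square c ℓ) ≤ ∫⁻ x, ‖η x‖ₑ ^ 2 := by
  have hQ := measurableSet_square c ℓ
  rw [regionIntegral_eq_sum hQ, ← setLIntegral_univ (f := fun x => ‖η x‖ₑ ^ 2),
    setLIntegral_eq_sum_fibres (particlesIn (square c ℓ))
      (fun S => (isSector_particlesIn hQ S).measurableSet)]
  refine Finset.sum_le_sum fun S _ => ?_
  rw [Set.univ_inter]
  rcases le_or_gt S.card 1 with hS | hS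
  · rw [Finset.sum_const, nsmul_eq_mul]
    exact mul_le_of_le_one_left zero_le (by exact_mod_cast hS)
  · obtain ⟨j, hj, k, hk, hjk⟩ := Finset.one_lt_card.1 hS
    have hA := isSector_particlesIn (N := N) hQ S
    have : ∫⁻ x in particlesIn (square c ℓ) ⁻¹' {S}, ‖η x‖ₑ ^ 2 = 0 := by
      rw [setLIntegral_congr_fun hA.measurableSet (g := fun _ => 0), lintegral_zero]
      intro x hx
      by_contra hne
      have hne' : η x ≠ 0 := fun h => hne (by simp [h])
      exact hsep x hne' j k hjk c ℓ hℓ ((hA.mem_iff x hx j).2 hj) ((hA.mem_iff x hx k).2 hk)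
    simp [this]

/-! ### Dyadic summation of exclusion and uncertainty -/

section LiebThirring

variable {η : Config (n + 1) → ℂ} {α : ℝ}

/-- Squares with few particles: the density is controlled by uncertainty alone. -/
theorem IsCore.density_bound_of_le (hη : IsCore η) (α : ℝ) (c : Plane) (ℓ : ℝ)
    (hM : regionIntegral (fun _ x => ‖η x‖ₑ ^ 2) (square c ℓ) ≤ 2 * ∫⁻ x, ‖η x‖ₑ ^ 2) :
    ENNReal.ofReal ℓ ^ 2 * ∫⁻ z in square c ℓ, density η z ^ 2 ≤
      8 * (∫⁻ x, ‖η x‖ₑ ^ 2) ^ 2 + 16 * (ENNReal.ofReal ℓ ^ 2 * ((∫⁻ x, ‖η x‖ₑ ^ 2) *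
        regionIntegral (fun j x => ‖momentum α j η x‖ₑ ^ 2) (square c ℓ))) := by
  refine (hη.uncertainty α c ℓ).trans ?_
  set M := regionIntegral (fun _ x => ‖η x‖ₑ ^ 2) (square c ℓ)
  set T := regionIntegral (fun j x => ‖momentum α j η x‖ₑ ^ 2) (square c ℓ)
  set m := ∫⁻ x, ‖η x‖ₑ ^ 2
  calc _ ≤ 2 * (2 * m) ^ 2 + 8 * ENNReal.ofReal ℓ ^ 2 * ((2 * m) * T) := by gcongr
    _ = _ := by ring

/-- Squares with many particles: the density is controlled by exclusion and uncertainty. -/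
theorem IsCore.density_bound_of_gt (hη : IsCore η) (h0 : 0 ≤ α) (h1 : α ≤ 1) (c : Plane) {ℓ : ℝ}
    (hℓ : 0 < ℓ)
    (hM : 2 * ∫⁻ x, ‖η x‖ₑ ^ 2 < regionIntegral (fun _ x => ‖η x‖ₑ ^ 2) (square c ℓ)) :
    ENNReal.ofReal α * (ENNReal.ofReal ℓ ^ 2 * (∫⁻ z in square c ℓ, density η z ^ 2) +
        32 * (∫⁻ x, ‖η x‖ₑ ^ 2) ^ 2) ≤
      (960 * 256 ^ 4 + 16) * (ENNReal.ofReal ℓ ^ 2 * ((∫⁻ x, ‖η x‖ₑ ^ 2) *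
        regionIntegral (fun j x => ‖momentum α j η x‖ₑ ^ 2) (square c ℓ))) := by
  obtain ⟨ε, hε, hsep⟩ := hη.exists_separation
  obtain ⟨k, hk⟩ : ∃ k : ℕ, ℓ ≤ ε * 2 ^ k := by
    obtain ⟨k, hk⟩ := pow_unbounded_of_one_lt (ℓ / ε) one_lt_two
    exact ⟨k, by rw [div_lt_iff₀ hε] at hk; linarith⟩
  have hmtop := hη.lintegral_enorm_sq_ne_top
  set m := ∫⁻ x, ‖η x‖ₑ ^ 2 with hm
  set a := ENNReal.ofReal α with ha
  have ha1 : a ≤ 1 := by simpa [ha] using h1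
  set M : Set Plane → ℝ≥0∞ := regionIntegral (fun _ x => ‖η x‖ₑ ^ 2) with hMdef
  set T : Set Plane → ℝ≥0∞ := regionIntegral (fun j x => ‖momentum α j η x‖ₑ ^ 2) with hTdef
  set K : ℝ≥0∞ := 960 * 256 ^ 4 + 16 with hK
  have hK16 : 16 ≤ K := le_add_self
  -- The surplus `32 m²` on the left is what a parent square needs to pay for children with few
  -- particles. At the separation scale `M ≤ m`, so no square qualifies.
  induction k generalizing c ℓ with
  | zero =>
    exfalso
    have h := IsCore.regionIntegral_le_of_separated hsep (c := c) (ℓ := ℓ) (by simpa using hk)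
    have h2 : m ≤ 2 * m := le_mul_of_one_le_left zero_le (by norm_num)
    exact absurd (hM.trans_le (h.trans h2)) (lt_irrefl _)
  | succ k ih =>
    set L := ENNReal.ofReal ℓ with hL
    have hL2 : L ^ 2 = 4 * ENNReal.ofReal (ℓ / 2) ^ 2 := by
      rw [hL, ← ENNReal.ofReal_pow hℓ.le, ← ENNReal.ofReal_pow (by linarith),
        ← ENNReal.ofReal_ofNat 4, ← ENNReal.ofReal_mul (by norm_num)]
      congr 1; ring
    set q : (Fin 2 → Bool) → Set Plane := fun b => square (quarterCorner c ℓ b) (ℓ / 2) with hq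
    set R : Set Plane → ℝ≥0∞ := fun Q => ∫⁻ z in Q, density η z ^ 2 with hR
    have hRsum : R (square c ℓ) = ∑ b, R (q b) := setLIntegral_square_eq_sum_quarters hℓ _
    have hTsum : T (square c ℓ) = ∑ b, T (q b) := regionIntegral_square_eq_sum_quarters hℓ _
    -- Passing from side `ℓ/2` to `ℓ` multiplies the error `8 m²` by four.
    have hfew : ∀ b, M (q b) ≤ 2 * m → a * (L ^ 2 * R (q b)) ≤
        32 * (a * m ^ 2) + 16 * (L ^ 2 * (m * T (q b))) := by
      intro b hb
      have h := hη.density_bound_of_le α (quarterCorner c ℓ b) (ℓ / 2) hb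
      calc a * (L ^ 2 * R (q b)) = a * (4 * (ENNReal.ofReal (ℓ / 2) ^ 2 * R (q b))) := by
            rw [hL2]; ring
        _ ≤ a * (4 * (8 * m ^ 2 + 16 * (ENNReal.ofReal (ℓ / 2) ^ 2 * (m * T (q b))))) :=
            mul_le_mul_right (mul_le_mul_right h _) _
        _ = 32 * (a * m ^ 2) + a * (16 * (L ^ 2 * (m * T (q b)))) := by rw [hL2]; ring
        _ ≤ 32 * (a * m ^ 2) + 1 * (16 * (L ^ 2 * (m * T (q b)))) :=
            add_le_add le_rfl (mul_le_mul_left ha1 _)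
        _ = _ := by rw [one_mul]
    -- Rescaling turns the surplus `32` into `128 = 3 · 32 + 32`: it pays for the three other
    -- quarters and restores the surplus of the parent.
    have hmany : ∀ b, 2 * m < M (q b) →
        a * (L ^ 2 * R (q b)) + 128 * (a * m ^ 2) ≤ K * (L ^ 2 * (m * T (q b))) := by
      intro b hb
      have h := ih (quarterCorner c ℓ b) (ℓ := ℓ / 2) (by linarith)
        (by rw [pow_succ] at hk; linarith) hb
      calc _ = 4 * (a * (ENNReal.ofReal (ℓ / 2) ^ 2 * R (q b) + 32 * m ^ 2)) := by
            rw [hL2]; ring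
        _ ≤ 4 * (K * (ENNReal.ofReal (ℓ / 2) ^ 2 * (m * T (q b)))) := mul_le_mul_right h _
        _ = _ := by rw [hL2]; ring
    have hweak : ∀ b, a * (L ^ 2 * R (q b)) ≤ 32 * (a * m ^ 2) + K * (L ^ 2 * (m * T (q b))) := by
      intro b
      rcases le_or_gt (M (q b)) (2 * m) with hb | hb
      · exact (hfew b hb).trans (add_le_add le_rfl (mul_le_mul_left hK16 _))
      · exact (le_self_add.trans (hmany b hb)).trans le_add_self
    have ham : a * m ^ 2 ≠ ⊤ := by finiteness
    by_cases hex : ∃ b, 2 * m < M (q b)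
    · obtain ⟨b₀, hb₀⟩ := hex
      have hcard : (Finset.univ.erase b₀).card = 3 := by
        rw [Finset.card_erase_of_mem (Finset.mem_univ _), Finset.card_univ]
        rfl
      have hsum : ∑ b ∈ Finset.univ.erase b₀, a * (L ^ 2 * R (q b)) ≤
          96 * (a * m ^ 2) + ∑ b ∈ Finset.univ.erase b₀, K * (L ^ 2 * (m * T (q b))) := by
        refine (Finset.sum_le_sum fun b _ => hweak b).trans_eq ?_
        rw [Finset.sum_add_distrib, Finset.sum_const, hcard, nsmul_eq_mul]
        push_cast
        ring
      have hall : (a * (L ^ 2 * R (square c ℓ) + 32 * m ^ 2)) + 96 * (a * m ^ 2) ≤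
          K * (L ^ 2 * (m * T (square c ℓ))) + 96 * (a * m ^ 2) := by
        calc _ = (a * (L ^ 2 * R (q b₀)) + 128 * (a * m ^ 2)) +
              ∑ b ∈ Finset.univ.erase b₀, a * (L ^ 2 * R (q b)) := by
              rw [hRsum, ← Finset.add_sum_erase _ _ (Finset.mem_univ b₀), ← Finset.mul_sum,
                ← Finset.mul_sum]
              ring
          _ ≤ K * (L ^ 2 * (m * T (q b₀))) + (96 * (a * m ^ 2) +
              ∑ b ∈ Finset.univ.erase b₀, K * (L ^ 2 * (m * T (q b)))) :=
              add_le_add (hmany b₀ hb₀) hsum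
          _ = _ := by
              rw [hTsum, ← Finset.add_sum_erase _ _ (Finset.mem_univ b₀), ← Finset.mul_sum,
                ← Finset.mul_sum, ← Finset.mul_sum]
              ring
      exact (ENNReal.add_le_add_iff_right (by finiteness)).1 hall
    · push Not at hex
      -- When no quarter has many particles, the parent pays directly: `M > 2m` leaves at least `m`
      -- after the loss of `m` in the exclusion bound.
      have hexcl : a * m ≤ 6 * 256 ^ 4 * (L ^ 2 * T (square c ℓ)) := by
        have h := hη.exclusion_region h0 h1 c hℓ
        have h2 : a * m + a * m ≤ a * m + 6 * 256 ^ 4 * (L ^ 2 * T (square c ℓ)) := by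
          calc a * m + a * m = a * (2 * m) := by ring
            _ ≤ a * M (square c ℓ) := by gcongr
            _ ≤ _ := h
        exact (ENNReal.add_le_add_iff_left (by finiteness)).1 h2
      calc a * (L ^ 2 * R (square c ℓ) + 32 * m ^ 2)
          = ∑ b, a * (L ^ 2 * R (q b)) + 32 * (a * m ^ 2) := by
            rw [hRsum, ← Finset.mul_sum, ← Finset.mul_sum]; ring
        _ ≤ ∑ b, (32 * (a * m ^ 2) + 16 * (L ^ 2 * (m * T (q b)))) + 32 * (a * m ^ 2) :=
            add_le_add (Finset.sum_le_sum fun b _ => hfew b (hex b)) le_rfl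
        -- Four errors of `32` and the surplus `32` make `160`. Multiplying by the exclusion
        -- constant `6 · 256⁴` gives `960 · 256⁴`.
        _ = 160 * (m * (a * m)) + 16 * (L ^ 2 * (m * T (square c ℓ))) := by
            have hs : ∑ b, 16 * (L ^ 2 * (m * T (q b))) = 16 * (L ^ 2 * (m * ∑ b, T (q b))) := by
              simp only [Finset.mul_sum]
            rw [Finset.sum_add_distrib, hTsum, hs, Finset.sum_const, Finset.card_univ]
            simp only [Fintype.card_fun, Fintype.card_bool, Fintype.card_fin, nsmul_eq_mul]
            push_cast
            ring
        _ ≤ 160 * (m * (6 * 256 ^ 4 * (L ^ 2 * T (square c ℓ)))) +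
            16 * (L ^ 2 * (m * T (square c ℓ))) := by gcongr
        _ = _ := by rw [hK]; ring

/-- The Lieb–Thirring inequality on the form core. -/
theorem IsCore.lieb_thirring (hη : IsCore η) (h0 : 0 ≤ α) (h1 : α ≤ 1) :
    ENNReal.ofReal α * ∫⁻ z, density η z ^ 2 ≤ (960 * 256 ^ 4 + 16) *
      ((∫⁻ x, ‖η x‖ₑ ^ 2) * ∑ j, ∫⁻ x, ‖momentum α j η x‖ₑ ^ 2) := by
  have hmtop := hη.lintegral_enorm_sq_ne_top
  set m := ∫⁻ x, ‖η x‖ₑ ^ 2 with hm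
  set T := ∑ j, ∫⁻ x, ‖momentum α j η x‖ₑ ^ 2 with hT
  set a := ENNReal.ofReal α with ha
  have ha1 : a ≤ 1 := by simpa [ha] using h1
  have hsq : ∀ (c : Plane) (ℓ : ℝ), 0 < ℓ → a * ∫⁻ z in square c ℓ, density η z ^ 2 ≤
      (960 * 256 ^ 4 + 16) * (m * T) + 8 * m ^ 2 * (ENNReal.ofReal ℓ ^ 2)⁻¹ := by
    intro c ℓ hℓ
    set L := ENNReal.ofReal ℓ with hL
    have hL0 : L ^ 2 ≠ 0 := by simpa [hL] using hℓ
    have hLt : L ^ 2 ≠ ⊤ := by finiteness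
    have hTle := regionIntegral_le (fun j x => ‖momentum α j η x‖ₑ ^ 2) (square c ℓ)
    have h : L ^ 2 * (a * ∫⁻ z in square c ℓ, density η z ^ 2) ≤
        (960 * 256 ^ 4 + 16) * (L ^ 2 * (m * T)) + 8 * m ^ 2 := by
      rcases le_or_gt (regionIntegral (fun _ x => ‖η x‖ₑ ^ 2) (square c ℓ)) (2 * m) with hb | hb
      · calc _ = a * (L ^ 2 * ∫⁻ z in square c ℓ, density η z ^ 2) := by ring
          _ ≤ 1 * (8 * m ^ 2 + 16 * (L ^ 2 * (m * T))) := by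
              refine mul_le_mul' ha1 ((hη.density_bound_of_le α c ℓ hb).trans ?_)
              gcongr
          _ = 16 * (L ^ 2 * (m * T)) + 8 * m ^ 2 := by ring
          _ ≤ _ := by gcongr; exact le_add_self
      · calc _ ≤ a * (L ^ 2 * (∫⁻ z in square c ℓ, density η z ^ 2) + 32 * m ^ 2) := by
              rw [mul_left_comm]
              gcongr
              exact le_self_add
          _ ≤ (960 * 256 ^ 4 + 16) * (L ^ 2 * (m * T)) := by
              refine (hη.density_bound_of_gt h0 h1 c hℓ hb).trans ?_
              gcongr
          _ ≤ _ := le_self_add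
    rw [← ENNReal.mul_le_mul_iff_right hL0 hLt]
    refine h.trans_eq ?_
    rw [mul_add, mul_left_comm (L ^ 2) (8 * m ^ 2), ENNReal.mul_inv_cancel hL0 hLt]
    ring
  -- Centred squares of side `2 (k + 1)` exhaust the plane, and the error `8 m² / ℓ²` tends to zero.
  set corner : ℕ → Plane := fun k => WithLp.toLp 2 fun _ => -(k + 1 : ℝ) with hcorner
  set Q : ℕ → Set Plane := fun k => square (corner k) (2 * (k + 1)) with hQ
  have hmono : Monotone Q := by
    intro k k' hkk z hz i
    have h1 := hz i
    have h2 : (k : ℝ) ≤ k' := by exact_mod_cast hkk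
    simp only [hcorner, Set.mem_Ico] at h1 ⊢
    constructor <;> linarith
  have hunion : ⋃ k, Q k = Set.univ := by
    refine Set.eq_univ_of_forall fun z => Set.mem_iUnion.2 ?_
    obtain ⟨k, hk⟩ := exists_nat_gt ‖z‖
    refine ⟨k, fun i => ?_⟩
    have h1 := abs_le.1 (abs_apply_le_norm z i)
    simp only [hcorner, Set.mem_Ico]
    constructor <;> linarith
  have hlim : Tendsto (fun k : ℕ => (960 * 256 ^ 4 + 16) * (m * T) +
      8 * m ^ 2 * (ENNReal.ofReal (2 * ((k : ℝ) + 1)) ^ 2)⁻¹) atTop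
      (𝓝 ((960 * 256 ^ 4 + 16) * (m * T) + 8 * m ^ 2 * 0)) := by
    refine tendsto_const_nhds.add (ENNReal.Tendsto.const_mul ?_ (Or.inr (by finiteness)))
    rw [← ENNReal.inv_top]
    refine tendsto_inv_iff.2 ?_
    have h1 : Tendsto (fun k : ℕ => ENNReal.ofReal (2 * ((k : ℝ) + 1))) atTop (𝓝 ⊤) := by
      refine ENNReal.tendsto_ofReal_atTop.comp ?_
      exact (tendsto_atTop_add_const_right _ _ tendsto_natCast_atTop_atTop).const_mul_atTop
        two_pos
    simpa using ENNReal.Tendsto.pow (n := 2) h1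
  rw [← setLIntegral_univ, ← hunion, setLIntegral_iUnion_of_directed _ hmono.directed_le,
    ENNReal.mul_iSup]
  refine iSup_le fun k => ?_
  rw [mul_zero, add_zero] at hlim
  refine ge_of_tendsto hlim ?_
  filter_upwards [eventually_ge_atTop k] with k' hk'
  exact (mul_le_mul_right (lintegral_mono_set (hmono hk')) _).trans
    (hsq (corner k') (2 * (k' + 1)) (by positivity))

end LiebThirring

end Anyon
end

noncomputable section

namespace Anyon

variable {n N : ℕ}

/-! ### The form domain -/

theorem lintegral_enorm_sq_eq {X E : Type*} [MeasurableSpace X] [NormedAddCommGroup E]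
    {μ : Measure X} (f : X → E) : ∫⁻ x, ‖f x‖ₑ ^ 2 ∂μ = eLpNorm f 2 μ ^ 2 := by
  have h := eLpNorm_nnreal_pow_eq_lintegral (f := f) (μ := μ) (p := 2) (by norm_num)
  simpa using h.symm

/-- Convergence in `L²` gives almost everywhere convergence along a subsequence, which carries over
both symmetry and, through Fatou, the density bound. -/
theorem IsMomentum.exists_approx_ae {α : ℝ} {Ψ : Config N → ℂ}
    {D : Fin N → Config N → EuclideanSpace ℂ (Fin 2)} (h : IsMomentum α Ψ D) :
    ∃ η : ℕ → Config N → ℂ, (∀ m, IsCore (η m)) ∧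
      Tendsto (fun m => eLpNorm (η m - Ψ) 2 volume) atTop (𝓝 0) ∧
      (∀ j, Tendsto (fun m => eLpNorm (momentum α j (η m) - D j) 2 volume) atTop (𝓝 0)) ∧
      ∀ᵐ x, Tendsto (fun m => η m x) atTop (𝓝 (Ψ x)) := by
  obtain ⟨η, hη, h1, h2⟩ := h.approx
  have hmeas := tendstoInMeasure_of_tendsto_eLpNorm (p := 2) two_ne_zero
    (fun m => (hη m).smooth.continuous.aestronglyMeasurable) h.memLp.aestronglyMeasurable h1
  obtain ⟨φ, hφ, hae⟩ := hmeas.exists_seq_tendsto_ae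
  exact ⟨fun m => η (φ m), fun m => hη _, h1.comp hφ.tendsto_atTop,
    fun j => (h2 j).comp hφ.tendsto_atTop, hae⟩

theorem quasiMeasurePreserving_insertNth (j : Fin (n + 1)) :
    Measure.QuasiMeasurePreserving
      (fun p : Plane × Config n => (Fin.insertNth j p.1 p.2 : Config (n + 1)))
      (volume.prod volume) volume :=
  (volume_preserving_piFinSuccAbove (fun _ : Fin (n + 1) => Plane)
    j).symm.quasiMeasurePreserving

theorem ae_ae_insertNth {P : Config (n + 1) → Prop} (h : ∀ᵐ x, P x) (j : Fin (n + 1)) :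
    ∀ᵐ z : Plane, ∀ᵐ y : Config n, P (Fin.insertNth j z y) :=
  Measure.ae_ae_of_ae_prod ((quasiMeasurePreserving_insertNth j).ae h)

/-- Functions in the form domain are symmetric. -/
theorem IsMomentum.ae_symmetric {α : ℝ} {Ψ : Config (n + 1) → ℂ}
    {D : Fin (n + 1) → Config (n + 1) → EuclideanSpace ℂ (Fin 2)} (h : IsMomentum α Ψ D)
    (j : Fin (n + 1)) :
    ∀ᵐ z : Plane, ∀ᵐ y : Config n,
      Ψ (Fin.insertNth j z y) = Ψ (Fin.cons z y : Config (n + 1)) := by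
  obtain ⟨η, hη, -, -, hae⟩ := h.exists_approx_ae
  filter_upwards [ae_ae_insertNth hae j, ae_ae_insertNth hae 0] with z h1 h2
  filter_upwards [h1, h2] with y h1 h2
  have e : ∀ m, η m (Fin.insertNth j z y) = η m (Fin.insertNth 0 z y) := fun m => by
    rw [← Fin.cons_comp_cycleRange, Fin.insertNth_zero']
    exact (hη m).symmetric _ _
  simp only [e] at h1
  rw [Fin.insertNth_zero'] at h2
  rw [Fin.insertNth_zero'] at h1
  exact tendsto_nhds_unique h1 h2

/-- The one-body density is lower semicontinuous. -/
theorem lintegral_density_sq_le_liminf {Ψ : Config (n + 1) → ℂ} {η : ℕ → Config (n + 1) → ℂ}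
    (hη : ∀ m, Measurable (η m)) (hae : ∀ᵐ x, Tendsto (fun m => η m x) atTop (𝓝 (Ψ x))) :
    ∫⁻ z, density Ψ z ^ 2 ≤ liminf (fun m => ∫⁻ z, density (η m) z ^ 2) atTop := by
  have hcons : ∀ z, Measurable fun y : Config n => (Fin.cons z y : Config (n + 1)) := fun z => by
    have := (measurable_insertNth (n := n) 0).comp (measurable_prodMk_left (x := z))
    simpa [Function.comp_def, Fin.insertNth_zero'] using this
  have hmeas : ∀ m, Measurable fun z => density (η m) z ^ 2 := fun m =>
    (measurable_density (hη m)).pow_const 2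
  -- Fatou is used twice: here in `z`, and below in the remaining particles. Squaring is monotone
  -- and continuous, hence commutes with the lower limit.
  refine le_trans (lintegral_mono_ae ?_) (lintegral_liminf_le hmeas)
  filter_upwards [ae_ae_insertNth hae 0] with z hz
  have h1 : density Ψ z ≤ liminf (fun m => density (η m) z) atTop := by
    simp only [density]
    simp only [← lintegral_const_mul' _ _ (ENNReal.natCast_ne_top (n + 1))]
    refine le_trans (lintegral_mono_ae ?_) (lintegral_liminf_le fun m =>
      ((((hη m).comp (hcons z)).enorm.pow_const 2).const_mul _))
    filter_upwards [hz] with y hy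
    rw [Fin.insertNth_zero'] at hy
    have : Tendsto (fun m => ((n + 1 : ℕ) : ℝ≥0∞) * ‖η m (Fin.cons z y : Config (n + 1))‖ₑ ^ 2) atTop
        (𝓝 (((n + 1 : ℕ) : ℝ≥0∞) * ‖Ψ (Fin.cons z y : Config (n + 1))‖ₑ ^ 2)) :=
      ENNReal.Tendsto.const_mul (ENNReal.Tendsto.pow hy.enorm)
        (Or.inr (ENNReal.natCast_ne_top _))
    exact this.liminf_eq.ge
  refine (pow_le_pow_left₀ zero_le h1 2).trans_eq ?_
  exact Monotone.map_liminf_of_continuousAt (f := fun x : ℝ≥0∞ => x ^ 2)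
    (fun x y h => pow_le_pow_left₀ zero_le h 2) _ (ENNReal.continuous_pow 2).continuousAt

/-- The Lieb–Thirring inequality on the form domain. -/
theorem IsMomentum.lieb_thirring {α : ℝ} (h0 : 0 ≤ α) (h1 : α ≤ 1) {Ψ : Config (n + 1) → ℂ}
    {D : Fin (n + 1) → Config (n + 1) → EuclideanSpace ℂ (Fin 2)} (h : IsMomentum α Ψ D)
    (hΨ : eLpNorm Ψ 2 volume = 1) :
    ENNReal.ofReal α * ∫⁻ z, density Ψ z ^ 2 ≤ (960 * 256 ^ 4 + 16) * kineticEnergy D := by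
  obtain ⟨η, hη, hlim, hlimD, hae⟩ := h.exists_approx_ae
  set K : ℝ≥0∞ := 960 * 256 ^ 4 + 16 with hK
  have hKtop : K ≠ ⊤ := by rw [hK]; finiteness
  have hηm : ∀ m, Measurable (η m) := fun m => (hη m).smooth.continuous.measurable
  have hD : ∀ j, eLpNorm (D j) 2 volume ≠ ⊤ := fun j => (h.memLp_momentum j).2.ne
  -- The triangle inequality gives this majorant of the right-hand side for `η m`. It converges
  -- because the errors vanish and `Ψ` is normalized.
  set u : ℕ → ℝ≥0∞ := fun m => K * ((eLpNorm Ψ 2 volume + eLpNorm (η m - Ψ) 2 volume) ^ 2 *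
    ∑ j, (eLpNorm (D j) 2 volume + eLpNorm (momentum α j (η m) - D j) 2 volume) ^ 2) with hu
  have hulim : Tendsto u atTop (𝓝 (K * kineticEnergy D)) := by
    have hsum : Tendsto (fun m => ∑ j, (eLpNorm (D j) 2 volume +
        eLpNorm (momentum α j (η m) - D j) 2 volume) ^ 2) atTop (𝓝 (kineticEnergy D)) := by
      have e : kineticEnergy D = ∑ j, (eLpNorm (D j) 2 volume + 0) ^ 2 := by
        simp only [kineticEnergy, add_zero, lintegral_enorm_sq_eq]
      rw [e]
      exact tendsto_finsetSum _ fun j _ => ENNReal.Tendsto.pow (tendsto_const_nhds.add (hlimD j))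
    have hone : Tendsto (fun m => (eLpNorm Ψ 2 volume + eLpNorm (η m - Ψ) 2 volume) ^ 2) atTop
        (𝓝 1) := by
      have := ENNReal.Tendsto.pow (n := 2) (tendsto_const_nhds (x := eLpNorm Ψ 2 volume).add hlim)
      simpa [hΨ] using this
    have hfin : kineticEnergy D ≠ ⊤ := by
      simp only [kineticEnergy, lintegral_enorm_sq_eq]
      exact ENNReal.sum_ne_top.2 fun j _ => ENNReal.pow_ne_top (hD j)
    have := ENNReal.Tendsto.const_mul (a := K) (ENNReal.Tendsto.mul hone (Or.inl one_ne_zero) hsum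
      (Or.inr ENNReal.one_ne_top)) (Or.inr hKtop)
    rwa [one_mul] at this
  have hbound : ∀ m, ENNReal.ofReal α * ∫⁻ z, density (η m) z ^ 2 ≤ u m := by
    intro m
    refine ((hη m).lieb_thirring h0 h1).trans ?_
    simp only [lintegral_enorm_sq_eq, hu]
    have tri : ∀ {E : Type} [NormedAddCommGroup E] (f g : Config (n + 1) → E),
        AEStronglyMeasurable f volume → AEStronglyMeasurable g volume →
        eLpNorm f 2 volume ≤ eLpNorm g 2 volume + eLpNorm (f - g) 2 volume := by
      intro E _ f g hf hg
      have := eLpNorm_add_le (p := 2) hg (hf.sub hg) (by norm_num)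
      simpa using this
    refine mul_le_mul_right (mul_le_mul' (pow_le_pow_left₀ zero_le (tri _ _ ?_ ?_) 2)
      (Finset.sum_le_sum fun j _ => pow_le_pow_left₀ zero_le (tri _ _ ?_ ?_) 2)) _
    · exact (hηm m).aestronglyMeasurable
    · exact h.memLp.1
    · exact ((hη m).measurable_momentum α j).aestronglyMeasurable
    · exact (h.memLp_momentum j).1
  calc ENNReal.ofReal α * ∫⁻ z, density Ψ z ^ 2
      ≤ ENNReal.ofReal α * liminf (fun m => ∫⁻ z, density (η m) z ^ 2) atTop :=
        mul_le_mul_right (lintegral_density_sq_le_liminf hηm hae) _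
    _ = liminf (fun m => ENNReal.ofReal α * ∫⁻ z, density (η m) z ^ 2) atTop :=
        Monotone.map_liminf_of_continuousAt (f := fun x : ℝ≥0∞ => ENNReal.ofReal α * x)
          (fun x y h => mul_le_mul_right h _) _
          (ENNReal.continuous_const_mul ENNReal.ofReal_ne_top).continuousAt
    _ ≤ liminf u atTop := liminf_le_liminf (Eventually.of_forall hbound)
    _ = _ := hulim.liminf_eq

/-! ### The potential energy -/

/-- Symmetry lets the weighted particle `j` be moved to the first slot. -/
theorem IsMomentum.sum_lintegral_mul_eq {α : ℝ} {Ψ : Config (n + 1) → ℂ}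
    {D : Fin (n + 1) → Config (n + 1) → EuclideanSpace ℂ (Fin 2)} (h : IsMomentum α Ψ D)
    {w : Plane → ℝ≥0∞} (hw : AEMeasurable w) (hwt : ∀ z, w z ≠ ⊤) :
    ∑ j, ∫⁻ x : Config (n + 1), w (x j) * ‖Ψ x‖ₑ ^ 2 = ∫⁻ z, w z * density Ψ z := by
  have hj : ∀ j, ∫⁻ x : Config (n + 1), w (x j) * ‖Ψ x‖ₑ ^ 2 =
      ∫⁻ z, w z * ∫⁻ y : Config n, ‖Ψ (Fin.cons z y : Config (n + 1))‖ₑ ^ 2 := by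
    intro j
    have hm : AEMeasurable fun x : Config (n + 1) => w (x j) * ‖Ψ x‖ₑ ^ 2 :=
      (hw.comp_quasiMeasurePreserving (Measure.quasiMeasurePreserving_eval _ j)).mul
        (h.memLp.1.aemeasurable.enorm.pow_const 2)
    rw [lintegral_insertNth j hm]
    refine lintegral_congr_ae ?_
    filter_upwards [h.ae_symmetric j] with z hz
    rw [← lintegral_const_mul' _ _ (hwt z)]
    refine lintegral_congr_ae ?_
    filter_upwards [hz] with y hy
    rw [hy, Fin.insertNth_apply_same]
  simp only [hj, Finset.sum_const, Finset.card_univ, Fintype.card_fin, nsmul_eq_mul, density]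
  rw [← lintegral_const_mul' _ _ (ENNReal.natCast_ne_top _)]
  exact lintegral_congr fun z => by ring

/-- Completing the square, with equality at `ρ = r / (2k)`. This is the origin of the factor `1 /
(4Cα)` in the energy bound. -/
theorem ofReal_mul_le_young {k r : ℝ} (hk : 0 < k) (hr : 0 ≤ r) (ρ : ℝ≥0∞) :
    ENNReal.ofReal r * ρ ≤
      ENNReal.ofReal k * ρ ^ 2 + ENNReal.ofReal (1 / (4 * k)) * ENNReal.ofReal (r ^ 2) := by
  rcases eq_or_ne ρ ⊤ with rfl | hρ
  · simp [ENNReal.mul_top, hk]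
  obtain ⟨s, hs, rfl⟩ : ∃ s : ℝ, 0 ≤ s ∧ ρ = ENNReal.ofReal s :=
    ⟨ρ.toReal, ENNReal.toReal_nonneg, (ENNReal.ofReal_toReal hρ).symm⟩
  rw [← ENNReal.ofReal_pow hs, ← ENNReal.ofReal_mul hr, ← ENNReal.ofReal_mul hk.le,
    ← ENNReal.ofReal_mul (by positivity), ← ENNReal.ofReal_add (by positivity) (by positivity)]
  apply ENNReal.ofReal_le_ofReal
  have e : k * s ^ 2 + 1 / (4 * k) * r ^ 2 - r * s = 1 / (4 * k) * (2 * k * s - r) ^ 2 := by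
    field_simp; ring
  have : 0 ≤ 1 / (4 * k) * (2 * k * s - r) ^ 2 := by positivity
  linarith

/-- Only `V₋` can lower the energy. Its expectation is `∫ V₋ ρ`, and Young's inequality splits this
into a part `k ∫ ρ²`, absorbed by `hLT`, and a part depending on `V` alone. -/
theorem IsMomentum.neg_potential_le {α k : ℝ} (hk : 0 < k) {Ψ : Config (n + 1) → ℂ}
    {D : Fin (n + 1) → Config (n + 1) → EuclideanSpace ℂ (Fin 2)} (h : IsMomentum α Ψ D)
    (hLT : ENNReal.ofReal k * ∫⁻ z, density Ψ z ^ 2 ≤ kineticEnergy D) {V : Plane → ℝ}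
    (hV : AEMeasurable V) (hVint : ∀ j, Integrable fun x : Config (n + 1) => V (x j) * ‖Ψ x‖ ^ 2) :
    ENNReal.ofReal (-∫ x : Config (n + 1), (∑ j, V (x j)) * ‖Ψ x‖ ^ 2) ≤
      kineticEnergy D +
        ENNReal.ofReal (1 / (4 * k)) * ∫⁻ z, ENNReal.ofReal (max (-V z) 0 ^ 2) := by
  have hw : AEMeasurable fun z => ENNReal.ofReal (max (-V z) 0) :=
    ((hV.neg.max aemeasurable_const)).ennreal_ofReal
  have hg : Integrable fun x : Config (n + 1) => -((∑ j, V (x j)) * ‖Ψ x‖ ^ 2) := by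
    simp only [Finset.sum_mul]
    exact (integrable_finsetSum _ fun j _ => hVint j).neg
  calc _ = ENNReal.ofReal (∫ x : Config (n + 1), -((∑ j, V (x j)) * ‖Ψ x‖ ^ 2)) := by
        rw [integral_neg]
    _ ≤ ENNReal.ofReal (∫ x : Config (n + 1), max (-((∑ j, V (x j)) * ‖Ψ x‖ ^ 2)) 0) :=
        ENNReal.ofReal_le_ofReal (integral_mono hg hg.pos_part fun x => le_max_left _ _)
    _ = ∫⁻ x : Config (n + 1), ENNReal.ofReal (max (-((∑ j, V (x j)) * ‖Ψ x‖ ^ 2)) 0) :=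
        ofReal_integral_eq_lintegral_ofReal hg.pos_part
          (Eventually.of_forall fun x => le_max_right _ _)
    _ ≤ ∫⁻ x : Config (n + 1), ∑ j, ENNReal.ofReal (max (-V (x j)) 0) * ‖Ψ x‖ₑ ^ 2 := by
        refine lintegral_mono fun x => ?_
        have e : ∀ j, ENNReal.ofReal (max (-V (x j)) 0) * ‖Ψ x‖ₑ ^ 2 =
            ENNReal.ofReal (max (-V (x j)) 0 * ‖Ψ x‖ ^ 2) := fun j => by
          rw [ENNReal.ofReal_mul (le_max_right _ _), ENNReal.ofReal_pow (norm_nonneg _),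
            ofReal_norm]
        simp only [e]
        rw [← ENNReal.ofReal_sum_of_nonneg fun j _ =>
          mul_nonneg (le_max_right _ _) (by positivity)]
        apply ENNReal.ofReal_le_ofReal
        refine max_le ?_ (Finset.sum_nonneg fun j _ =>
          mul_nonneg (le_max_right _ _) (by positivity))
        rw [← neg_mul, ← Finset.sum_neg_distrib, Finset.sum_mul]
        exact Finset.sum_le_sum fun j _ =>
          mul_le_mul_of_nonneg_right (le_max_left _ _) (by positivity)
    _ = ∑ j, ∫⁻ x : Config (n + 1), ENNReal.ofReal (max (-V (x j)) 0) * ‖Ψ x‖ₑ ^ 2 :=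
        lintegral_finsetSum' _ fun j _ =>
          (hw.comp_quasiMeasurePreserving (Measure.quasiMeasurePreserving_eval _ j)).mul
            (h.memLp.1.aemeasurable.enorm.pow_const 2)
    _ = ∫⁻ z, ENNReal.ofReal (max (-V z) 0) * density Ψ z :=
        h.sum_lintegral_mul_eq hw fun z => ENNReal.ofReal_ne_top
    _ ≤ ∫⁻ z, (ENNReal.ofReal k * density Ψ z ^ 2 +
          ENNReal.ofReal (1 / (4 * k)) * ENNReal.ofReal (max (-V z) 0 ^ 2)) :=
        lintegral_mono fun z => ofReal_mul_le_young hk (le_max_right _ _) _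
    _ = ENNReal.ofReal k * (∫⁻ z, density Ψ z ^ 2) +
          ENNReal.ofReal (1 / (4 * k)) * ∫⁻ z, ENNReal.ofReal (max (-V z) 0 ^ 2) := by
        rw [lintegral_add_right', lintegral_const_mul' _ _ ENNReal.ofReal_ne_top,
          lintegral_const_mul' _ _ ENNReal.ofReal_ne_top]
        exact (((hV.neg.max aemeasurable_const).pow_const 2).ennreal_ofReal).const_mul _
    _ ≤ _ := add_le_add hLT le_rfl

end Anyon

end

/-! ### Both assertions with an explicit constant -/

theorem theorem2 :
    ∃ C : ℝ, 0 < C ∧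
      (∀ α : ℝ, 0 ≤ α → α ≤ 1 → ∀ (n : ℕ) (Ψ : Anyon.Config (n + 1) → ℂ)
        (D : Fin (n + 1) → Anyon.Config (n + 1) → EuclideanSpace ℂ (Fin 2)),
        Anyon.IsMomentum α Ψ D → eLpNorm Ψ 2 volume = 1 →
        ENNReal.ofReal (C * α) * ∫⁻ x, Anyon.density Ψ x ^ 2 ≤ Anyon.kineticEnergy D) ∧
      (∀ α : ℝ, 0 < α → α ≤ 1 → ∀ (N : ℕ), 1 ≤ N →
        ∀ V : Anyon.Plane → ℝ, AEMeasurable V volume →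
        -((ENNReal.ofReal (1 / (4 * C * α)) *
            ∫⁻ x, ENNReal.ofReal (max (-V x) 0 ^ 2) : ℝ≥0∞) : EReal) ≤
          Anyon.groundStateEnergy α N V) := by
  -- The constant is the reciprocal of the one in the Lieb–Thirring inequality on the form domain.
  have hC : (0 : ℝ) < (960 * 256 ^ 4 + 16)⁻¹ := by positivity
  have hLT : ∀ α : ℝ, 0 ≤ α → α ≤ 1 → ∀ (n : ℕ) (Ψ : Anyon.Config (n + 1) → ℂ)
      (D : Fin (n + 1) → Anyon.Config (n + 1) → EuclideanSpace ℂ (Fin 2)),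
      Anyon.IsMomentum α Ψ D → eLpNorm Ψ 2 volume = 1 →
      ENNReal.ofReal ((960 * 256 ^ 4 + 16)⁻¹ * α) * ∫⁻ x, Anyon.density Ψ x ^ 2 ≤
        Anyon.kineticEnergy D := by
    intro α h0 h1 n Ψ D h hΨ
    have hK : ENNReal.ofReal ((960 * 256 ^ 4 + 16 : ℝ)⁻¹) * (960 * 256 ^ 4 + 16) = 1 := by
      have e : (960 * 256 ^ 4 + 16 : ℝ≥0∞) = ENNReal.ofReal (960 * 256 ^ 4 + 16) := by
        rw [ENNReal.ofReal_add (by norm_num) (by norm_num), ENNReal.ofReal_mul (by norm_num),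
          ENNReal.ofReal_pow (by norm_num)]
        simp
      rw [e, ← ENNReal.ofReal_mul hC.le, inv_mul_cancel₀ (by norm_num), ENNReal.ofReal_one]
    rw [ENNReal.ofReal_mul hC.le, mul_assoc]
    refine (mul_le_mul_right (h.lieb_thirring h0 h1 hΨ) _).trans_eq ?_
    rw [← mul_assoc, hK, one_mul]
  refine ⟨(960 * 256 ^ 4 + 16)⁻¹, hC, hLT, fun α h0 h1 N hN V hV => ?_⟩
  obtain ⟨n, rfl⟩ := Nat.exists_eq_add_of_le' hN
  refine le_sInf ?_
  rintro e ⟨Ψ, D, h, hΨ, hVint, rfl⟩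
  have key := h.neg_potential_le (mul_pos hC h0) (hLT α h0.le h1 n Ψ D h hΨ) hV hVint
  rw [← mul_assoc] at key
  set I := ∫ x : Anyon.Config (n + 1), (∑ j, V (x j)) * ‖Ψ x‖ ^ 2
  set W := ENNReal.ofReal (1 / (4 * (960 * 256 ^ 4 + 16)⁻¹ * α)) *
    ∫⁻ x, ENNReal.ofReal (max (-V x) 0 ^ 2)
  set T := Anyon.kineticEnergy D
  -- If `W` is infinite the lower bound is `-∞`. If `T` is infinite the energy is `+∞`, since `I` is
  -- a real number. Otherwise everything is real.
  rcases eq_or_ne W ⊤ with hW | hW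
  · rw [hW]; simp
  rcases eq_or_ne T ⊤ with hT | hT
  · rw [hT]; simp
  have hreal : -I ≤ T.toReal + W.toReal := by
    rw [← ENNReal.toReal_add hT hW]
    exact (ENNReal.ofReal_le_iff_le_toReal (ENNReal.add_ne_top.2 ⟨hT, hW⟩)).1 key
  rw [← EReal.coe_ennreal_toReal hW, ← EReal.coe_ennreal_toReal hT, ← EReal.coe_neg,
    ← EReal.coe_add, EReal.coe_le_coe_iff]
  linarith
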